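/- Let $\mathfrak g$ be a symmetrizable Kac–Moody algebra with indecomposable generalized Cartan matrix $(a_{ij})_{i,j\in I}$ ($I$ finite), realization $(\mathfrak h,\{\alpha_i\},\{\alpha_i^\vee\})$ with $\alpha_j(\alpha_i^\vee)=a_{ij}$, Chevalley generators $e_i,f_i$, and invariant form normalized so that the numbers $d_i=(\alpha_i,\alpha_i)/2$ are relatively prime positive integers; put $d_{ij}=(\alpha_i,\alpha_j)/2$. The Yangian $Y=Y_\hbar\mathfrak g$ is the unital associative $\mathbb C[\hbar]$-algebra generated by $h\in\mathfrak h$ and $x_{ir}^\pm,h_{ir}$ ($i\in I$, $r\in\mathbb N$) subject to the linear relations of $\mathfrak h$ and $$h_{i0}=d_i\alpha_i^\vee,\quad [h_{ir},h_{js}]=[h_{ir},h]=[h,h']=0,\quad [h,x_{js}^\pm]=\pm\alpha_j(h)x_{js}^\pm,\quad [x_{ir}^+,x_{js}^-]=\delta_{ij}h_{i,r+s},$$ $$[h_{i,r+1},x_{js}^\pm]-[h_{ir},x_{j,s+1}^\pm]=\pm\hbar d_{ij}(h_{ir}x_{js}^\pm+x_{js}^\pm h_{ir}),$$ $$[x_{i,r+1}^\pm,x_{js}^\pm]-[x_{ir}^\pm,x_{j,s+1}^\pm]=\pm\hbar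 d_{ij}(x_{ir}^\pm x_{js}^\pm+x_{js}^\pm x_{ir}^\pm),$$ $$\sum_{\pi\in S_m}[x_{i,r_{\pi(1)}}^\pm,[\cdots,[x_{i,r_{\pi(m)}}^\pm,x_{js}^\pm]\cdots]]=0\quad(i\ne j,\ m=1-a_{ij}).$$ It is graded, $Y=\bigoplus_{k\ge0}Y_k$, with $\deg\hbar=1$, $\deg h=0$, $\deg x_{ir}^\pm=\deg h_{ir}=r$; put $Y_+=\bigoplus_{k>0}Y_k$ and $\widehat Y=\prod_{k\ge0}Y_k$. The Yangian double $\mathrm DY=\mathrm DY_\hbar\mathfrak g$ is the $\mathbb C[\![\hbar]\!]$-algebra topologically (for the $\hbar$-adic topology) generated by $h\in\mathfrak h$ and $\mathcal X_{ir}^\pm,\mathcal H_{ir}$ ($i\in I$, $r\in\mathbb Z$), subject to the same relations with all modes in $\mathbb Z$. Let $\iota:Y\to\mathrm DY$ be the natural map $h\mapsto h$, $x_{ir}^\pm\mapsto\mathcal X_{ir}^\pm$, $h_{ir}\mapsto\mathcal H_{ir}$; for $c\in\mathbb C$ let $\tau_c$ be the endomorphism of $Y$ with $h\mapsto h$, $x_{ir}^\pm\mapsto\sum_k\binom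 rk c^{r-k}x_{ik}^\pm$, $h_{ir}\mapsto\sum_k\binom rk c^{r-k}h_{ik}$; put $\Gamma=\iota\circ\tau_{-1}$. Let $\mathcal J$ be the kernel of the homomorphism $\mathrm DY\to U(\mathfrak g)$ with $\hbar\mapsto0$, $h\mapsto h$, $\mathcal X_{ir}^+\mapsto\sqrt{d_i}\,e_i$, $\mathcal X_{ir}^-\mapsto\sqrt{d_i}\,f_i$, $\mathcal H_{ir}\mapsto d_i\alpha_i^\vee$. Filter $Y$, $\mathrm DY$ and $\widehat Y$ by $\{Y_+^n\}$, $\{\mathcal J^n\}$ and $\{\prod_{k\ge n}Y_k\}$ ($n\in\mathbb N$); on associated graded algebras $\hbar$ acts as its symbol in degree one. There is a unique homomorphism of $\mathbb C[\![\hbar]\!]$-algebras $\Phi:\mathrm DY\to\widehat Y$ such that $\Phi\circ\iota$ is $\tau_1$ followed by the canonical map $Y\to\widehat Y$. For all $i\in I$, $r\in\mathbb Z$ and $h\in\mathfrak h$ it satisfies $\Phi(\mathcal X_{ir}^\pm)=\sum_{n\ge0}\binom rn x_{in}^\pm$, $\Phi(\mathcal H_{ir})=\sum_{n\ge0}\binom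 rn h_{in}$ and $\Phi(h)=h$. Moreover: (1) $\Gamma$, $\Phi$ and the canonical map $Y\to\widehat Y$ are filtered. Sending $y\in Y_n$ to its class in $Y_+^n/Y_+^{n+1}$ gives an isomorphism of $\mathbb C[\hbar]$-algebras $Y\cong\mathrm{gr}\,Y$, and $Y\to\widehat Y$ induces an isomorphism $\mathrm{gr}\,Y\cong\mathrm{gr}\,\widehat Y$. (2) Under these identifications, $\mathrm{gr}(\Gamma):Y\to\mathrm{gr}_{\mathcal J}(\mathrm DY)=\bigoplus_{n\ge 0}\mathcal J^n/\mathcal J^{n+1}$ is an isomorphism of graded $\mathbb C[\hbar]$-algebras with inverse $\mathrm{gr}(\Phi):\mathrm{gr}_{\mathcal J}(\mathrm DY)\to\mathrm{gr}(\widehat Y)\cong Y$. (3) Let $R=\bigoplus_{n\in\mathbb Z}v^{-n}\mathcal J^n\subset\mathrm DY[v^{\pm1}]$ be the extended Rees algebra, where $\mathcal J^{n}=\mathrm DY$ for $n\le0$. It is the subalgebra generated by $v$, $\mathrm DY$ and $v^{-1}\mathcal J$, and it is torsion free and flat over $\mathbb C[v]$. For every $c\in\mathbb C^\times$ there is an isomorphism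 $R/(v-c)R\cong\mathrm DY$ sending the class of each $x\in\mathrm DY$ to $x$. At $v=0$ there are $\mathbb C$-algebra isomorphisms $R/vR\cong\mathrm{gr}_{\mathcal J}(\mathrm DY)\cong Y$, the first sending the class of $v^{-n}x$ to the class of $x$ in $\mathcal J^n/\mathcal J^{n+1}$ for $n\in\mathbb N$, $x\in\mathcal J^n$, and the second being $\mathrm{gr}(\Phi)$; the composite sends the class of $v^{-1}\hbar$ to $\hbar$. Thus $R$ is a flat deformation of $Y$ over $\mathbb C[v]$, and $Y$ is a degeneration of $\mathrm DY$. -/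

import Mathlib

open scoped Polynomial PowerSeries DirectSum LaurentPolynomial

noncomputable section

namespace YangianDouble

/-- An indecomposable symmetrizable generalized Cartan matrix `a` with symmetrizing positive integers
`d i` (jointly coprime) together with a realization `(𝔥, {α_i}, {α_i^∨})` of it, where
`dim 𝔥 = 2 |I| - rank a`. The invariant form satisfies `(α_i, α_j) = d i * a i j`. -/
structure KacMoodyDatum (I : Type*) [Fintype I] (𝔥 : Type*) [AddCommGroup 𝔥] [Module ℂ 𝔥] where
  a : Matrix I I ℤ
  a_diag : ∀ i, a i i = 2
  a_nonpos : ∀ i j, i ≠ j → a i j ≤ 0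
  a_zero : ∀ i j, a i j = 0 → a j i = 0
  indecomposable : ∀ s : Set I, s.Nonempty → sᶜ.Nonempty → ∃ i ∈ s, ∃ j ∈ sᶜ, a i j ≠ 0
  d : I → ℕ
  d_pos : ∀ i, 0 < d i
  d_coprime : Finset.univ.gcd d = 1
  d_symm : ∀ i j, (d i : ℤ) * a i j = d j * a j i
  root : I → Module.Dual ℂ 𝔥
  coroot : I → 𝔥
  root_linearIndependent : LinearIndependent ℂ root
  coroot_linearIndependent : LinearIndependent ℂ coroot
  root_coroot : ∀ i j, root j (coroot i) = (a i j : ℂ)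
  finrank_add_rank :
    Module.finrank ℂ 𝔥 + (a.map (Int.cast : ℤ → ℂ)).rank = 2 * Fintype.card I

/-- Generators `h` (`h ∈ 𝔥`), `x_{ir}^±` (the sign is `ε : ℤˣ`) and `h_{ir}`, with modes `r : K`;
`K = ℕ` for the Yangian and `K = ℤ` for the Yangian double. -/
inductive Gen (I 𝔥 K : Type*)
  | cartan (h : 𝔥)
  | x (ε : ℤˣ) (i : I) (r : K)
  | h (i : I) (r : K)

variable {I : Type*} [Fintype I] {𝔥 : Type*} [AddCommGroup 𝔥] [Module ℂ 𝔥]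

namespace KacMoodyDatum

/-- `d_{ij} = (α_i, α_j) / 2`. -/
def dd (D : KacMoodyDatum I 𝔥) (i j : I) : ℂ := (D.d i : ℂ) * (D.a i j : ℂ) / 2

/-- `1 - a_{ij}`, a natural number when `i ≠ j`. -/
def serreDeg (D : KacMoodyDatum I 𝔥) (i j : I) : ℕ := (1 - D.a i j).toNat

end KacMoodyDatum

/-- The defining relations, as pairs (left side, right side), for a family `g` of elements of a
`ℂ`-algebra indexed by the generators, and an element `ħ`. The modes range over `K`.
For `K = ℤ` these are the coefficients of the current relations of the Yangian double. -/
inductive DefRel (D : KacMoodyDatum I 𝔥) {K : Type*} [AddMonoidWithOne K]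
    {R : Type*} [Ring R] [Algebra ℂ R] (ħ : R) (g : Gen I 𝔥 K → R) : R → R → Prop
  | cartan_add (h h' : 𝔥) :
      DefRel D ħ g (g (.cartan (h + h'))) (g (.cartan h) + g (.cartan h'))
  | cartan_smul (c : ℂ) (h : 𝔥) : DefRel D ħ g (g (.cartan (c • h))) (c • g (.cartan h))
  | h_zero (i : I) : DefRel D ħ g (g (.h i 0)) (g (.cartan ((D.d i : ℂ) • D.coroot i)))
  | h_h (i j : I) (r s : K) : DefRel D ħ g ⁅g (.h i r), g (.h j s)⁆ 0
  | h_cartan (i : I) (r : K) (h : 𝔥) : DefRel D ħ g ⁅g (.h i r), g (.cartan h)⁆ 0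
  | cartan_cartan (h h' : 𝔥) : DefRel D ħ g ⁅g (.cartan h), g (.cartan h')⁆ 0
  | cartan_x (ε : ℤˣ) (h : 𝔥) (j : I) (s : K) :
      DefRel D ħ g ⁅g (.cartan h), g (.x ε j s)⁆ ((((ε : ℤ) : ℂ) * D.root j h) • g (.x ε j s))
  | x_x_same (i : I) (r s : K) : DefRel D ħ g ⁅g (.x 1 i r), g (.x (-1) i s)⁆ (g (.h i (r + s)))
  | x_x_ne (i j : I) (hij : i ≠ j) (r s : K) : DefRel D ħ g ⁅g (.x 1 i r), g (.x (-1) j s)⁆ 0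
  | h_x (ε : ℤˣ) (i j : I) (r s : K) :
      DefRel D ħ g
        (⁅g (.h i (r + 1)), g (.x ε j s)⁆ - ⁅g (.h i r), g (.x ε j (s + 1))⁆)
        ((((ε : ℤ) : ℂ) * D.dd i j) •
          (ħ * (g (.h i r) * g (.x ε j s) + g (.x ε j s) * g (.h i r))))
  | x_x (ε : ℤˣ) (i j : I) (r s : K) :
      DefRel D ħ g
        (⁅g (.x ε i (r + 1)), g (.x ε j s)⁆ - ⁅g (.x ε i r), g (.x ε j (s + 1))⁆)
        ((((ε : ℤ) : ℂ) * D.dd i j) •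
          (ħ * (g (.x ε i r) * g (.x ε j s) + g (.x ε j s) * g (.x ε i r))))
  | serre (ε : ℤˣ) (i j : I) (hij : i ≠ j) (r : Fin (D.serreDeg i j) → K) (s : K) :
      DefRel D ħ g
        (∑ π : Equiv.Perm (Fin (D.serreDeg i j)),
          (List.ofFn fun k => g (.x ε i (r (π k)))).foldr (fun u w => ⁅u, w⁆) (g (.x ε j s)))
        0

/-- The family `g` satisfies all the defining relations. -/
def IsSolution (D : KacMoodyDatum I 𝔥) {K : Type*} [AddMonoidWithOne K]
    {R : Type*} [Ring R] [Algebra ℂ R] (ħ : R) (g : Gen I 𝔥 K → R) : Prop :=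
  ∀ a b, DefRel D ħ g a b → a = b

theorem foldr_bracket_map {R S : Type*} [Ring R] [Ring S] (f : R →+* S) (l : List R) (z : R) :
    f (l.foldr (fun u w => ⁅u, w⁆) z) = (l.map f).foldr (fun u w => ⁅u, w⁆) (f z) := by
  induction l with
  | nil => rfl
  | cons a l ih =>
    simp only [List.foldr_cons, List.map_cons, ← ih]
    simp [Ring.lie_def]

theorem DefRel.map {D : KacMoodyDatum I 𝔥} {K : Type*} [AddMonoidWithOne K]
    {R S : Type*} [Ring R] [Algebra ℂ R] [Ring S] [Algebra ℂ S] (f : R →ₐ[ℂ] S)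
    {ħ : R} {g : Gen I 𝔥 K → R} {ħ' : S} {g' : Gen I 𝔥 K → S} (hħ : f ħ = ħ')
    (hg : ∀ x, f (g x) = g' x) {a b : R} (h : DefRel D ħ g a b) : DefRel D ħ' g' (f a) (f b) := by
  have hb : ∀ u v : R, f ⁅u, v⁆ = ⁅f u, f v⁆ := fun u v => by simp [Ring.lie_def]
  cases h with
  | cartan_add h h' => simpa [hg] using DefRel.cartan_add h h'
  | cartan_smul c h => simpa [hg] using DefRel.cartan_smul c h
  | h_zero i => simpa [hg] using DefRel.h_zero i
  | h_h i j r s => simpa [hg, hb] using DefRel.h_h i j r s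
  | h_cartan i r h => simpa [hg, hb] using DefRel.h_cartan i r h
  | cartan_cartan h h' => simpa [hg, hb] using DefRel.cartan_cartan h h'
  | cartan_x ε h j s =>
    have := DefRel.cartan_x (D := D) (ħ := ħ') (g := g') ε h j s
    rw [hb, map_smul, hg, hg]; exact this
  | x_x_same i r s => simpa only [hg, hb] using DefRel.x_x_same i r s
  | x_x_ne i j hij r s => simpa only [hg, hb, map_zero] using DefRel.x_x_ne i j hij r s
  | h_x ε i j r s =>
    have := DefRel.h_x (D := D) (ħ := ħ') (g := g') ε i j r s
    simpa only [map_sub, map_smul, map_mul, map_add, hg, hb, hħ] using this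
  | x_x ε i j r s =>
    have := DefRel.x_x (D := D) (ħ := ħ') (g := g') ε i j r s
    simpa only [map_sub, map_smul, map_mul, map_add, hg, hb, hħ] using this
  | serre ε i j hij r s =>
    have := DefRel.serre (D := D) (ħ := ħ') (g := g') ε i j hij r s
    rw [map_sum, map_zero]
    convert this using 3 with π
    have := foldr_bracket_map (f : R →+* S) (List.ofFn fun k => g (.x ε i (r (π k)))) (g (.x ε j s))
    simpa [List.map_ofFn, Function.comp_def, hg] using this

theorem DefRel.exists_preimage {D : KacMoodyDatum I 𝔥} {K : Type*} [AddMonoidWithOne K]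
    {R S : Type*} [Ring R] [Algebra ℂ R] [Ring S] [Algebra ℂ S] (f : R →ₐ[ℂ] S)
    {ħ : R} {g : Gen I 𝔥 K → R} {ħ' : S} {g' : Gen I 𝔥 K → S} (hħ : f ħ = ħ')
    (hg : ∀ x, f (g x) = g' x) {a b : S} (h : DefRel D ħ' g' a b) :
    ∃ a' b' : R, DefRel D ħ g a' b' ∧ f a' = a ∧ f b' = b := by
  have hb : ∀ u v : R, f ⁅u, v⁆ = ⁅f u, f v⁆ := fun u v => by simp [Ring.lie_def]
  cases h with
  | cartan_add h h' => exact ⟨_, _, .cartan_add h h', by simp [hg], by simp [hg]⟩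
  | cartan_smul c h => exact ⟨_, _, .cartan_smul c h, by simp [hg], by simp [hg]⟩
  | h_zero i => exact ⟨_, _, .h_zero i, by simp [hg], by simp [hg]⟩
  | h_h i j r s => exact ⟨_, _, .h_h i j r s, by simp only [hb, hg], by simp⟩
  | h_cartan i r h => exact ⟨_, _, .h_cartan i r h, by simp only [hb, hg], by simp⟩
  | cartan_cartan h h' => exact ⟨_, _, .cartan_cartan h h', by simp only [hb, hg], by simp⟩
  | cartan_x ε h j s =>
    exact ⟨_, _, .cartan_x ε h j s, by simp only [hb, hg], by simp only [map_smul, hg]⟩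
  | x_x_same i r s => exact ⟨_, _, .x_x_same i r s, by simp only [hb, hg], by simp only [hg]⟩
  | x_x_ne i j hij r s => exact ⟨_, _, .x_x_ne i j hij r s, by simp only [hb, hg], by simp⟩
  | h_x ε i j r s =>
    exact ⟨_, _, .h_x ε i j r s, by simp only [hb, hg, map_sub],
      by simp only [map_smul, map_mul, map_add, hg, hħ]⟩
  | x_x ε i j r s =>
    exact ⟨_, _, .x_x ε i j r s, by simp only [hb, hg, map_sub],
      by simp only [map_smul, map_mul, map_add, hg, hħ]⟩
  | serre ε i j hij r s =>
    refine ⟨_, _, .serre ε i j hij r s, ?_, by simp⟩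
    rw [map_sum]
    refine Finset.sum_congr rfl fun π _ => ?_
    have := foldr_bracket_map (f : R →+* S) (List.ofFn fun k => g (.x ε i (r (π k)))) (g (.x ε j s))
    simpa [List.map_ofFn, Function.comp_def, hg] using this

/-- The free `ℂ[ħ]`-algebra on the generators of the Yangian (`Polynomial.X` is `ħ`). -/
abbrev YFree (I 𝔥 : Type*) : Type _ := FreeAlgebra ℂ[X] (Gen I 𝔥 ℕ)

/-- The congruence generated by the defining relations with modes in `ℕ`. -/
def yangianCon (D : KacMoodyDatum I 𝔥) : RingCon (YFree I 𝔥) :=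
  ringConGen (DefRel D (algebraMap ℂ[X] (YFree I 𝔥) Polynomial.X) (FreeAlgebra.ι ℂ[X]))

/-- The Yangian `Y_ħ𝔤`, an algebra over `ℂ[ħ]`; the polynomial variable acts as `ħ`. -/
def Yangian (D : KacMoodyDatum I 𝔥) : Type _ := (yangianCon D).Quotient

section
variable (D : KacMoodyDatum I 𝔥)
instance : Ring (Yangian D) := inferInstanceAs (Ring (yangianCon D).Quotient)
instance : Algebra ℂ[X] (Yangian D) := inferInstanceAs (Algebra ℂ[X] (yangianCon D).Quotient)
instance : Algebra ℂ (Yangian D) := inferInstanceAs (Algebra ℂ (yangianCon D).Quotient)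
instance : IsScalarTower ℂ ℂ[X] (Yangian D) :=
  inferInstanceAs (IsScalarTower ℂ ℂ[X] (yangianCon D).Quotient)

def Yangian.mk : YFree I 𝔥 →ₐ[ℂ[X]] Yangian D := (yangianCon D).mkₐ ℂ[X]

/-- The generators of the Yangian. -/
def Yangian.gen (x : Gen I 𝔥 ℕ) : Yangian D := Yangian.mk D (FreeAlgebra.ι ℂ[X] x)

/-- The element `ħ` of the Yangian. -/
def Yangian.hbar : Yangian D := algebraMap ℂ[X] (Yangian D) Polynomial.X

/-- The universal property of the presentation of the Yangian. -/
def Yangian.lift {S : Type*} [Ring S] [Algebra ℂ[X] S] [Algebra ℂ S] [IsScalarTower ℂ ℂ[X] S]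
    (g : Gen I 𝔥 ℕ → S) (hg : IsSolution D (algebraMap ℂ[X] S Polynomial.X) g) :
    Yangian D →ₐ[ℂ[X]] S :=
  (yangianCon D).liftₐ (FreeAlgebra.lift ℂ[X] g) (by
    refine RingCon.ringConGen_le.mpr fun a b h => ?_
    exact hg _ _ (h.map ((FreeAlgebra.lift ℂ[X] g).restrictScalars ℂ) (by simp) (by simp)))

theorem Yangian.lift_gen {S : Type*} [Ring S] [Algebra ℂ[X] S] [Algebra ℂ S]
    [IsScalarTower ℂ ℂ[X] S]
    (g : Gen I 𝔥 ℕ → S) (hg : IsSolution D (algebraMap ℂ[X] S Polynomial.X) g)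
    (x : Gen I 𝔥 ℕ) : Yangian.lift D g hg (Yangian.gen D x) = g x :=
  FreeAlgebra.lift_ι_apply g x

theorem Yangian.gen_isSolution : IsSolution D (Yangian.hbar D) (Yangian.gen D) := by
  intro a b h
  obtain ⟨a', b', hab, rfl, rfl⟩ := h.exists_preimage ((Yangian.mk D).restrictScalars ℂ)
    (g := FreeAlgebra.ι ℂ[X]) (ħ := algebraMap ℂ[X] (YFree I 𝔥) Polynomial.X)
    (by simp [Yangian.hbar]) (fun x => rfl)
  exact (yangianCon D).eq.mpr (RingConGen.Rel.of _ _ hab)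
end
/-- Power series in `ħ` (`PowerSeries.X`) over the free `ℂ`-algebra on the generators with modes
in `ℤ`: the topologically free `ℂ⟦ħ⟧`-algebra on these generators. -/
abbrev DFree (I 𝔥 : Type*) : Type _ := PowerSeries (FreeAlgebra ℂ (Gen I 𝔥 ℤ))

/-- The congruence modulo the closure in the `ħ`-adic topology of the two-sided ideal generated by
the relations. The closure of an ideal `𝔞` is `⋂ n, (𝔞 + (ħ ^ n))`. -/
def dCon (D : KacMoodyDatum I 𝔥) : RingCon (DFree I 𝔥) :=
  ⨅ n : ℕ, ringConGen fun a b =>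
    DefRel D (PowerSeries.X : DFree I 𝔥) (fun x => PowerSeries.C (FreeAlgebra.ι ℂ x)) a b ∨
      (a = PowerSeries.X ^ n ∧ b = 0)

/-- The Yangian double `DY_ħ𝔤`: the algebra over `ℂ⟦ħ⟧` topologically generated by the generators
with modes in `ℤ` subject to the defining relations. -/
def DY (D : KacMoodyDatum I 𝔥) : Type _ := (dCon D).Quotient

section
variable (D : KacMoodyDatum I 𝔥)
instance : Ring (DY D) := inferInstanceAs (Ring (dCon D).Quotient)
instance : Algebra ℂ (DY D) := inferInstanceAs (Algebra ℂ (dCon D).Quotient)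

def DY.mk : DFree I 𝔥 →ₐ[ℂ] DY D := (dCon D).mkₐ ℂ

theorem DY.mk_surjective : Function.Surjective (DY.mk D) := (dCon D).mk'_surjective

/-- The generators of the Yangian double. -/
def DY.gen (x : Gen I 𝔥 ℤ) : DY D := DY.mk D (PowerSeries.C (FreeAlgebra.ι ℂ x))

/-- The element `ħ` of the Yangian double. -/
def DY.hbar : DY D := DY.mk D PowerSeries.X

instance : Algebra (PowerSeries ℂ) (DY D) :=
  RingHom.toAlgebra' ((DY.mk D : DFree I 𝔥 →+* DY D).comp
      (PowerSeries.map (algebraMap ℂ (FreeAlgebra ℂ (Gen I 𝔥 ℤ))))) (by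
    intro c x
    obtain ⟨x, rfl⟩ := DY.mk_surjective D x
    simp only [RingHom.comp_apply, RingHom.coe_coe, ← map_mul]
    congr 1
    ext n
    simp only [PowerSeries.coeff_mul, PowerSeries.coeff_map, Algebra.commutes]
    exact Finset.sum_nbij' Prod.swap Prod.swap (by simp [add_comm]) (by simp [add_comm])
      (by simp) (by simp) (by simp))

instance : Algebra ℂ[X] (DY D) :=
  Algebra.compHom (DY D) (Polynomial.coeToPowerSeries.ringHom : ℂ[X] →+* PowerSeries ℂ)

theorem DY.algebraMap_X : algebraMap ℂ[X] (DY D) Polynomial.X = DY.hbar D := by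
  change DY.mk D (PowerSeries.map _ ((Polynomial.X : ℂ[X]) : PowerSeries ℂ)) = _
  simp [DY.hbar]

instance : IsScalarTower ℂ (PowerSeries ℂ) (DY D) := by
  refine IsScalarTower.of_algebraMap_eq fun c => ?_
  change _ = DY.mk D (PowerSeries.map _ (algebraMap ℂ (PowerSeries ℂ) c))
  rw [← (DY.mk D).commutes c]
  congr 1

instance : IsScalarTower ℂ[X] (PowerSeries ℂ) (DY D) := by
  refine IsScalarTower.of_algebraMap_eq fun c => rfl

instance : IsScalarTower ℂ ℂ[X] (DY D) := by
  refine IsScalarTower.of_algebraMap_eq fun c => ?_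
  rw [IsScalarTower.algebraMap_apply ℂ (PowerSeries ℂ) (DY D),
    IsScalarTower.algebraMap_apply ℂ[X] (PowerSeries ℂ) (DY D)]
  congr 1
  ext n
  change _ = PowerSeries.coeff n ((Polynomial.C c : ℂ[X]) : PowerSeries ℂ)
  simp [PowerSeries.coeff_C]

theorem DY.gen_isSolution : IsSolution D (DY.hbar D) (DY.gen D) := by
  intro a b h
  obtain ⟨a', b', hab, rfl, rfl⟩ := h.exists_preimage (DY.mk D)
    (g := fun x => PowerSeries.C (FreeAlgebra.ι ℂ x)) (ħ := (PowerSeries.X : DFree I 𝔥))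
    rfl (fun x => rfl)
  refine (dCon D).eq.mpr ?_
  rw [dCon, RingCon.coe_iInf]
  simp only [iInf_apply, iInf_Prop_eq]
  exact fun n => RingConGen.Rel.of _ _ (Or.inl hab)

/-- A generator of the Yangian, seen as a generator of the Yangian double. -/
def Gen.ofNat : Gen I 𝔥 ℕ → Gen I 𝔥 ℤ
  | .cartan y => .cartan y
  | .x ε i r => .x ε i r
  | .h i r => .h i r

theorem IsSolution.ofNat {R : Type*} [Ring R] [Algebra ℂ R] {ħ : R} {g : Gen I 𝔥 ℤ → R}
    (hg : IsSolution D ħ g) : IsSolution D ħ (g ∘ Gen.ofNat) := by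
  intro a b h
  cases h with
  | cartan_add h h' => have := hg _ _ (DefRel.cartan_add h h'); exact this
  | cartan_smul c h => have := hg _ _ (DefRel.cartan_smul c h); exact this
  | h_zero i => have := hg _ _ (DefRel.h_zero i); exact this
  | h_h i j r s => have := hg _ _ (DefRel.h_h i j (r : ℤ) (s : ℤ)); exact this
  | h_cartan i r h => have := hg _ _ (DefRel.h_cartan i (r : ℤ) h); exact this
  | cartan_cartan h h' => have := hg _ _ (DefRel.cartan_cartan h h'); exact this
  | cartan_x ε h j s => have := hg _ _ (DefRel.cartan_x ε h j (s : ℤ)); exact this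
  | x_x_same i r s => simpa [Gen.ofNat] using hg _ _ (DefRel.x_x_same i (r : ℤ) (s : ℤ))
  | x_x_ne i j hij r s => have := hg _ _ (DefRel.x_x_ne i j hij (r : ℤ) (s : ℤ)); exact this
  | h_x ε i j r s => simpa [Gen.ofNat] using hg _ _ (DefRel.h_x ε i j (r : ℤ) (s : ℤ))
  | x_x ε i j r s => simpa [Gen.ofNat] using hg _ _ (DefRel.x_x ε i j (r : ℤ) (s : ℤ))
  | serre ε i j hij r s => have := hg _ _ (DefRel.serre ε i j hij (fun k => (r k : ℤ)) (s : ℤ)); exact this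

/-- The natural homomorphism `ι : Y_ħ𝔤 → DY_ħ𝔤`, sending each generator to the generator of the
Yangian double with the same name. -/
def iota : Yangian D →ₐ[ℂ[X]] DY D :=
  Yangian.lift D (DY.gen D ∘ Gen.ofNat) (by
    rw [DY.algebraMap_X]; exact (DY.gen_isSolution D).ofNat)

/-- Generators of the Kac-Moody algebra: `𝔥`, `e_i`, `f_i`. -/
inductive KMGen (I 𝔥 : Type*)
  | cartan (h : 𝔥)
  | e (i : I)
  | f (i : I)

abbrev kmH (I : Type*) {𝔥 : Type*} (h : 𝔥) : FreeLieAlgebra ℂ (KMGen I 𝔥) :=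
  FreeLieAlgebra.of ℂ (.cartan h)

abbrev kmE {I : Type*} (𝔥 : Type*) (i : I) : FreeLieAlgebra ℂ (KMGen I 𝔥) :=
  FreeLieAlgebra.of ℂ (.e i)

abbrev kmF {I : Type*} (𝔥 : Type*) (i : I) : FreeLieAlgebra ℂ (KMGen I 𝔥) :=
  FreeLieAlgebra.of ℂ (.f i)

/-- Chevalley-Serre relations; the elements listed are set to zero. -/
inductive KMRel (D : KacMoodyDatum I 𝔥) : FreeLieAlgebra ℂ (KMGen I 𝔥) → Prop
  | cartan_add (h h' : 𝔥) :
      KMRel D (kmH I (h + h') - (kmH I h + kmH I h'))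
  | cartan_smul (c : ℂ) (h : 𝔥) : KMRel D (kmH I (c • h) - c • kmH I h)
  | cartan_cartan (h h' : 𝔥) : KMRel D ⁅kmH I h, kmH I h'⁆
  | cartan_e (h : 𝔥) (i : I) :
      KMRel D (⁅kmH I h, kmE 𝔥 i⁆ - D.root i h • kmE 𝔥 i)
  | cartan_f (h : 𝔥) (i : I) :
      KMRel D (⁅kmH I h, kmF 𝔥 i⁆ + D.root i h • kmF 𝔥 i)
  | e_f_same (i : I) : KMRel D (⁅kmE 𝔥 i, kmF 𝔥 i⁆ - kmH I (D.coroot i))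
  | e_f_ne (i j : I) (hij : i ≠ j) : KMRel D ⁅kmE 𝔥 i, kmF 𝔥 j⁆
  | serre_e (i j : I) (hij : i ≠ j) :
      KMRel D ((LieAlgebra.ad ℂ _ (kmE 𝔥 i) ^ D.serreDeg i j) (kmE 𝔥 j))
  | serre_f (i j : I) (hij : i ≠ j) :
      KMRel D ((LieAlgebra.ad ℂ _ (kmF 𝔥 i) ^ D.serreDeg i j) (kmF 𝔥 j))

def kmIdeal : LieIdeal ℂ (FreeLieAlgebra ℂ (KMGen I 𝔥)) :=
  LieSubmodule.lieSpan ℂ _ {y | KMRel D y}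

/-- The symmetrizable Kac-Moody algebra `𝔤`, by its Chevalley-Serre presentation. -/
abbrev KacMoody : Type _ := FreeLieAlgebra ℂ (KMGen I 𝔥) ⧸ kmIdeal D

/-- The enveloping algebra `U(𝔤)`. -/
abbrev UKacMoody : Type _ := UniversalEnvelopingAlgebra ℂ (KacMoody D)

section
attribute [local instance] LieRing.ofAssociativeRing

/-- The image in `U(𝔤)` of a Lie polynomial in the generators of `𝔤`. -/
def toU : FreeLieAlgebra ℂ (KMGen I 𝔥) →ₗ[ℂ] UKacMoody D :=
  (UniversalEnvelopingAlgebra.ι ℂ (L := KacMoody D)).toLinearMap.comp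
    (kmIdeal D).toSubmodule.mkQ

theorem toU_lie (y z : FreeLieAlgebra ℂ (KMGen I 𝔥)) : toU D ⁅y, z⁆ = ⁅toU D y, toU D z⁆ :=
  LieHom.map_lie (UniversalEnvelopingAlgebra.ι ℂ)
    (LieSubmodule.Quotient.mk y : KacMoody D) (LieSubmodule.Quotient.mk z)

end

theorem toU_rel {y : FreeLieAlgebra ℂ (KMGen I 𝔥)} (h : KMRel D y) : toU D y = 0 := by
  have : (kmIdeal D).toSubmodule.mkQ y = 0 :=
    (Submodule.Quotient.mk_eq_zero _).mpr (LieSubmodule.subset_lieSpan h)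
  rw [toU, LinearMap.comp_apply, this, map_zero]

/-- The values of the evaluation at `t = 1`: each `𝒳_{ir}^+` goes to `√(d_i) e_i`, each `𝒳_{ir}^-` to
`√(d_i) f_i`, each `ℋ_{ir}` to `d_i α_i^∨`, and `h ∈ 𝔥` to itself. -/
def evGen {K : Type*} : Gen I 𝔥 K → UKacMoody D
  | .cartan h => toU D (kmH I h)
  | .x ε i _ => (Real.sqrt (D.d i) : ℂ) • toU D (if ε = 1 then kmE 𝔥 i else kmF 𝔥 i)
  | .h i _ => (D.d i : ℂ) • toU D (kmH I (D.coroot i))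

theorem toU_serre (c : ℂ) (l : List (UKacMoody D)) (y : FreeLieAlgebra ℂ (KMGen I 𝔥))
    (hl : ∀ u ∈ l, u = c • toU D y) (z : FreeLieAlgebra ℂ (KMGen I 𝔥)) (b : ℂ) :
    l.foldr (fun u w => ⁅u, w⁆) (b • toU D z) =
      (c ^ l.length * b) • toU D ((LieAlgebra.ad ℂ _ y ^ l.length) z) := by
  induction l with
  | nil => simp
  | cons u l ih =>
    rw [List.foldr_cons, ih fun v hv => hl v (List.mem_cons_of_mem _ hv),
      hl u List.mem_cons_self, List.length_cons, pow_succ' (LieAlgebra.ad ℂ _ y)]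
    rw [Module.End.mul_apply, LieAlgebra.ad_apply, toU_lie]
    simp only [Ring.lie_def, smul_mul_smul_comm]
    rw [mul_comm (_ * b) c, ← smul_sub]
    congr 1
    ring

theorem evGen_isSolution {K : Type*} [AddMonoidWithOne K] :
    IsSolution D (0 : UKacMoody D) (evGen D : Gen I 𝔥 K → UKacMoody D) := by
  intro a b h
  have hne : (-1 : ℤˣ) ≠ 1 := by decide
  cases h with
  | cartan_add h h' =>
    have := toU_rel D (.cartan_add h h'); rw [map_sub, map_add, sub_eq_zero] at this; exact this
  | cartan_smul c h =>
    have := toU_rel D (.cartan_smul c h); rw [map_sub, map_smul, sub_eq_zero] at this; exact this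
  | h_zero i =>
    have := toU_rel D (.cartan_smul (D.d i) (D.coroot i))
    rw [map_sub, map_smul, sub_eq_zero] at this; exact this.symm
  | h_h i j r s =>
    have := toU_rel D (.cartan_cartan (D.coroot i) (D.coroot j))
    rw [toU_lie, Ring.lie_def] at this
    simp only [evGen, Ring.lie_def, smul_mul_smul_comm]
    rw [mul_comm (D.d j : ℂ), ← smul_sub, this, smul_zero]
  | h_cartan i r h =>
    have := toU_rel D (.cartan_cartan (D.coroot i) h)
    rw [toU_lie, Ring.lie_def] at this
    simp only [evGen, Ring.lie_def, smul_mul_assoc, mul_smul_comm]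
    rw [← smul_sub, this, smul_zero]
  | cartan_cartan h h' =>
    have := toU_rel D (.cartan_cartan h h')
    rw [toU_lie] at this
    exact this
  | cartan_x ε h j s =>
    rcases Int.units_eq_one_or ε with rfl | rfl
    · have := toU_rel D (.cartan_e h j)
      rw [map_sub, map_smul, toU_lie, sub_eq_zero, Ring.lie_def] at this
      simp only [evGen, if_true, Ring.lie_def, smul_mul_assoc, mul_smul_comm]
      rw [← smul_sub, this, smul_comm]
      simp
    · have := toU_rel D (.cartan_f h j)
      rw [map_add, map_smul, toU_lie, ← sub_neg_eq_add, sub_eq_zero, Ring.lie_def] at this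
      simp only [evGen, if_neg hne, Ring.lie_def, smul_mul_assoc, mul_smul_comm]
      rw [← smul_sub, this, ← neg_smul, smul_comm]
      simp
  | x_x_same i r s =>
    have := toU_rel D (.e_f_same i)
    rw [map_sub, toU_lie, sub_eq_zero, Ring.lie_def] at this
    simp only [evGen, if_true, if_neg hne, Ring.lie_def, smul_mul_smul_comm]
    rw [← smul_sub, this, ← Complex.ofReal_mul, Real.mul_self_sqrt (Nat.cast_nonneg _)]
    simp
  | x_x_ne i j hij r s =>
    have := toU_rel D (.e_f_ne i j hij)
    rw [toU_lie, Ring.lie_def] at this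
    simp only [evGen, if_true, if_neg hne, Ring.lie_def, smul_mul_smul_comm]
    rw [mul_comm, ← smul_sub, this, smul_zero]
  | h_x ε i j r s => simp [evGen]
  | x_x ε i j r s => simp [evGen]
  | serre ε i j hij r s =>
    refine Finset.sum_eq_zero fun π _ => ?_
    simp only [evGen]
    rw [toU_serre D (Real.sqrt (D.d i) : ℂ) _ (if ε = 1 then kmE 𝔥 i else kmF 𝔥 i)
      (by simp), List.length_ofFn]
    rcases Int.units_eq_one_or ε with rfl | rfl
    · simp only [if_true]
      rw [toU_rel D (.serre_e i j hij), smul_zero]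
    · simp only [if_neg hne]
      rw [toU_rel D (.serre_f i j hij), smul_zero]

def evFree : DFree I 𝔥 →ₐ[ℂ] UKacMoody D :=
  AlgHom.ofLinearMap
    ((FreeAlgebra.lift ℂ (evGen D)).toLinearMap.comp
      (PowerSeries.coeff (R := FreeAlgebra ℂ (Gen I 𝔥 ℤ)) 0 |>.restrictScalars ℂ))
    (by simp) (by simp)

/-- The composite `DY_ħ𝔤 → DY_ħ𝔤 / ħ → U(𝔤)` of the reduction at `ħ = 0` and the evaluation at
`t = 1`. -/
def ev : DY D →ₐ[ℂ] UKacMoody D :=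
  (dCon D).liftₐ (evFree D) (by
    refine (iInf_le _ 1).trans (RingCon.ringConGen_le.mpr ?_)
    rintro a b (h | ⟨rfl, rfl⟩)
    · exact evGen_isSolution D _ _ (h.map (evFree D) (by simp [evFree]) (by simp [evFree]))
    · simp [evFree])

theorem ev_gen (x : Gen I 𝔥 ℤ) : ev D (DY.gen D x) = evGen D x := by
  change evFree D _ = _
  simp [evFree]

theorem ev_hbar : ev D (DY.hbar D) = 0 := by
  change evFree D _ = _
  simp [evFree]

/-- The evaluation ideal `𝒥`, the kernel of `ev`. -/
def evIdeal : Ideal (DY D) := RingHom.ker (ev D)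

instance : (evIdeal D).IsTwoSided := inferInstanceAs (RingHom.ker (ev D)).IsTwoSided

/-- The linear map sending `X ^ k` to `y_k`. -/
def polyEval {R : Type*} [Ring R] [Algebra ℂ R] (y : ℕ → R) : ℂ[X] →ₗ[ℂ] R :=
  Polynomial.lsum fun k => LinearMap.toSpanSingleton ℂ R (y k)

theorem polyEval_monomial {R : Type*} [Ring R] [Algebra ℂ R] (y : ℕ → R) (n : ℕ) (a : ℂ) :
    polyEval y (Polynomial.monomial n a) = a • y n := by
  simp [polyEval]

theorem polyEval_X_pow {R : Type*} [Ring R] [Algebra ℂ R] (y : ℕ → R) (n : ℕ) :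
    polyEval y (Polynomial.X ^ n) = y n := by
  rw [← Polynomial.monomial_one_right_eq_X_pow, polyEval_monomial, one_smul]

/-- `∑_{k ≤ r} (r choose k) c ^ (r - k) y_k`. -/
def shiftSeq {R : Type*} [Ring R] [Algebra ℂ R] (c : ℂ) (y : ℕ → R) (r : ℕ) : R :=
  ∑ k ∈ Finset.range (r + 1), ((r.choose k : ℂ) * c ^ (r - k)) • y k

theorem shiftSeq_eq {R : Type*} [Ring R] [Algebra ℂ R] (c : ℂ) (y : ℕ → R) (r : ℕ) :
    shiftSeq c y r = polyEval y ((Polynomial.X + Polynomial.C c) ^ r) := by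
  rw [add_pow, map_sum, shiftSeq]
  refine Finset.sum_congr rfl fun k _ => ?_
  rw [← polyEval_monomial]
  congr 1
  rw [← Polynomial.C_mul_X_pow_eq_monomial]
  simp only [map_mul, map_pow, map_natCast]
  ring

theorem polyEval_step {R : Type*} [Ring R] [Algebra ℂ R] (c : ℂ) (y : ℕ → R) (r : ℕ) :
    polyEval y ((Polynomial.X + Polynomial.C c) ^ (r + 1)) =
      polyEval y (Polynomial.X * (Polynomial.X + Polynomial.C c) ^ r) +
        c • polyEval y ((Polynomial.X + Polynomial.C c) ^ r) := by
  rw [pow_succ', add_mul, map_add, ← Polynomial.smul_eq_C_mul, map_smul]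

theorem poly_bilin {M : Type*} [AddCommGroup M] [Module ℂ M]
    (B : ℂ[X] →ₗ[ℂ] ℂ[X] →ₗ[ℂ] M)
    (h : ∀ r s : ℕ, B (Polynomial.X ^ r) (Polynomial.X ^ s) = 0) : B = 0 := by
  refine Polynomial.lhom_ext' fun r => LinearMap.ext_ring ?_
  refine Polynomial.lhom_ext' fun s => LinearMap.ext_ring ?_
  simpa [Polynomial.monomial_one_right_eq_X_pow] using h r s

theorem foldr_bracket_eq {R : Type*} [Ring R] [Algebra ℂ R] (l : List R) (z : R) :
    l.foldr (fun u w => ⁅u, w⁆) z =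
      (l.map fun u => LinearMap.mulLeft ℂ u - LinearMap.mulRight ℂ u).prod z := by
  induction l with
  | nil => simp
  | cons u l ih =>
    rw [List.foldr_cons, ih]
    simp [Ring.lie_def]

theorem poly_serre {R : Type*} [Ring R] [Algebra ℂ R] (m : ℕ) (y z : ℕ → R)
    (h : ∀ (r : Fin m → ℕ) (s : ℕ), ∑ π : Equiv.Perm (Fin m),
      (List.ofFn fun k => y (r (π k))).foldr (fun u w => ⁅u, w⁆) (z s) = 0)
    (p : Fin m → ℂ[X]) (q : ℂ[X]) : ∑ π : Equiv.Perm (Fin m),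
      (List.ofFn fun k => polyEval y (p (π k))).foldr (fun u w => ⁅u, w⁆) (polyEval z q) = 0 := by
  let A : ℂ[X] →ₗ[ℂ] Module.End ℂ R :=
    (LinearMap.mul ℂ R - (LinearMap.mul ℂ R).flip).comp (polyEval y)
  have hA : ∀ p, A p = LinearMap.mulLeft ℂ (polyEval y p) - LinearMap.mulRight ℂ (polyEval y p) :=
    fun p => rfl
  let N : MultilinearMap ℂ (fun _ : Fin m => ℂ[X]) (Module.End ℂ R) :=
    ∑ π : Equiv.Perm (Fin m),
      ((MultilinearMap.mkPiAlgebraFin ℂ m (Module.End ℂ R)).compLinearMap fun _ => A).domDomCongr π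
  have hN : ∀ (p : Fin m → ℂ[X]) (w : R), N p w = ∑ π : Equiv.Perm (Fin m),
      (List.ofFn fun k => polyEval y (p (π k))).foldr (fun u w => ⁅u, w⁆) w := by
    intro p w
    simp only [N, sum_apply, LinearMap.sum_apply, foldr_bracket_eq]
    refine Finset.sum_congr rfl fun π _ => ?_
    simp [MultilinearMap.domDomCongr_apply, List.map_ofFn, Function.comp_def, hA]
  rw [← hN]
  have key : ((LinearMap.applyₗ (polyEval z q) : Module.End ℂ R →ₗ[ℂ] R).compMultilinearMap N) = 0 := by
    refine Module.Basis.ext_multilinear (fun _ => Polynomial.basisMonomials ℂ) fun r => ?_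
    simp only [LinearMap.compMultilinearMap_apply, LinearMap.applyₗ_apply_apply,
      zero_apply]
    have hz : (N fun i => Polynomial.basisMonomials ℂ (r i)).comp (polyEval z) = 0 := by
      refine Polynomial.lhom_ext' fun s => LinearMap.ext_ring ?_
      simp only [LinearMap.comp_apply, hN, LinearMap.zero_apply, polyEval_monomial, one_smul,
        Polynomial.coe_basisMonomials]
      exact h r s
    exact LinearMap.congr_fun hz q
  exact congrArg (fun f => f p) key

theorem poly_exchange {R : Type*} [Ring R] [Algebra ℂ R] (ħ : R) (c : ℂ) (y z : ℕ → R)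
    (h : ∀ r s : ℕ, ⁅y (r + 1), z s⁆ - ⁅y r, z (s + 1)⁆ = c • (ħ * (y r * z s + z s * y r)))
    (p q : ℂ[X]) :
    ⁅polyEval y (Polynomial.X * p), polyEval z q⁆ - ⁅polyEval y p, polyEval z (Polynomial.X * q)⁆ =
      c • (ħ * (polyEval y p * polyEval z q + polyEval z q * polyEval y p)) := by
  let T : ℂ[X] →ₗ[ℂ] ℂ[X] := LinearMap.mulLeft ℂ Polynomial.X
  let C : R →ₗ[ℂ] R →ₗ[ℂ] R := LinearMap.mul ℂ R - (LinearMap.mul ℂ R).flip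
  let A : R →ₗ[ℂ] R →ₗ[ℂ] R := LinearMap.mul ℂ R + (LinearMap.mul ℂ R).flip
  let B : ℂ[X] →ₗ[ℂ] ℂ[X] →ₗ[ℂ] R :=
    C.compl₁₂ (polyEval y ∘ₗ T) (polyEval z) - C.compl₁₂ (polyEval y) (polyEval z ∘ₗ T) -
      (A.compl₁₂ (polyEval y) (polyEval z)).compr₂ (c • LinearMap.mulLeft ℂ ħ)
  have hB : ∀ p q, B p q = ⁅polyEval y (Polynomial.X * p), polyEval z q⁆ -
      ⁅polyEval y p, polyEval z (Polynomial.X * q)⁆ -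
      c • (ħ * (polyEval y p * polyEval z q + polyEval z q * polyEval y p)) := fun p q => rfl
  have : B = 0 := poly_bilin B fun r s => by
    rw [hB, ← pow_succ', ← pow_succ']
    simp only [polyEval_X_pow]
    rw [h, sub_self]
  rw [← sub_eq_zero, ← hB p q, this]
  rfl

theorem shiftSeq_exchange {R : Type*} [Ring R] [Algebra ℂ R] (a : ℂ) (ħ : R) (c : ℂ) (y z : ℕ → R)
    (h : ∀ r s : ℕ, ⁅y (r + 1), z s⁆ - ⁅y r, z (s + 1)⁆ = c • (ħ * (y r * z s + z s * y r)))
    (r s : ℕ) :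
    ⁅shiftSeq a y (r + 1), shiftSeq a z s⁆ - ⁅shiftSeq a y r, shiftSeq a z (s + 1)⁆ =
      c • (ħ * (shiftSeq a y r * shiftSeq a z s + shiftSeq a z s * shiftSeq a y r)) := by
  simp only [shiftSeq_eq]
  rw [← poly_exchange ħ c y z h, polyEval_step, polyEval_step]
  simp only [Ring.lie_def, add_mul, mul_add, smul_mul_assoc, mul_smul_comm]
  abel

theorem shiftSeq_lie {R : Type*} [Ring R] [Algebra ℂ R] (a b : ℂ) (y z w : ℕ → R)
    (h : ∀ r s : ℕ, ⁅y r, z s⁆ = b • w (r + s)) (r s : ℕ) :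
    ⁅shiftSeq a y r, shiftSeq a z s⁆ = b • shiftSeq a w (r + s) := by
  let C : R →ₗ[ℂ] R →ₗ[ℂ] R := LinearMap.mul ℂ R - (LinearMap.mul ℂ R).flip
  let B : ℂ[X] →ₗ[ℂ] ℂ[X] →ₗ[ℂ] R :=
    C.compl₁₂ (polyEval y) (polyEval z) - (LinearMap.mul ℂ ℂ[X]).compr₂ (b • polyEval w)
  have hB : ∀ p q, B p q = ⁅polyEval y p, polyEval z q⁆ - b • polyEval w (p * q) := fun p q => rfl
  have : B = 0 := poly_bilin B fun r s => by
    rw [hB, ← pow_add]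
    simp only [polyEval_X_pow]
    rw [h, sub_self]
  simp only [shiftSeq_eq]
  rw [← sub_eq_zero, pow_add, ← hB, this]
  rfl

theorem shiftSeq_zero {R : Type*} [Ring R] [Algebra ℂ R] (a : ℂ) (y : ℕ → R) :
    shiftSeq a y 0 = y 0 := by
  simp [shiftSeq]

theorem shiftSeq_lie_left {R : Type*} [Ring R] [Algebra ℂ R] (a b : ℂ) (u : R) (z : ℕ → R)
    (h : ∀ s : ℕ, ⁅u, z s⁆ = b • z s) (s : ℕ) : ⁅u, shiftSeq a z s⁆ = b • shiftSeq a z s := by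
  simp only [shiftSeq, Ring.lie_def, Finset.mul_sum, Finset.sum_mul, Finset.smul_sum,
    ← Finset.sum_sub_distrib]
  refine Finset.sum_congr rfl fun k _ => ?_
  rw [mul_smul_comm, smul_mul_assoc, ← smul_sub, ← Ring.lie_def, h, smul_comm]

/-- The values of the shift `τ_c` on generators. -/
def shiftGen {R : Type*} [Ring R] [Algebra ℂ R] (c : ℂ) (g : Gen I 𝔥 ℕ → R) : Gen I 𝔥 ℕ → R
  | .cartan y => g (.cartan y)
  | .x ε i r => shiftSeq c (fun k => g (.x ε i k)) r
  | .h i r => shiftSeq c (fun k => g (.h i k)) r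

theorem IsSolution.shift {D : KacMoodyDatum I 𝔥} {R : Type*} [Ring R] [Algebra ℂ R] {ħ : R}
    {g : Gen I 𝔥 ℕ → R} (hg : IsSolution D ħ g) (c : ℂ) : IsSolution D ħ (shiftGen c g) := by
  intro a b h
  cases h with
  | cartan_add h h' => have := hg _ _ (DefRel.cartan_add h h'); exact this
  | cartan_smul c h => have := hg _ _ (DefRel.cartan_smul c h); exact this
  | h_zero i => have := hg _ _ (DefRel.h_zero i); simpa [shiftGen, shiftSeq_zero] using this
  | h_h i j r s =>
    have := shiftSeq_lie c 0 (fun k => g (.h i k)) (fun k => g (.h j k)) 0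
      (fun r s => by rw [zero_smul]; exact hg _ _ (DefRel.h_h i j r s)) r s
    rwa [zero_smul] at this
  | h_cartan i r h =>
    have := shiftSeq_lie_left c 0 (g (.cartan h)) (fun k => g (.h i k))
      (fun s => by
        have := hg _ _ (DefRel.h_cartan i s h)
        rw [Ring.lie_def, sub_eq_zero] at this
        rw [zero_smul, Ring.lie_def, this, sub_self]) r
    rw [zero_smul, Ring.lie_def, sub_eq_zero] at this
    simp only [shiftGen]
    rw [Ring.lie_def, this, sub_self]
  | cartan_cartan h h' => have := hg _ _ (DefRel.cartan_cartan h h'); exact this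
  | cartan_x ε h j s =>
    exact shiftSeq_lie_left c _ (g (.cartan h)) (fun k => g (.x ε j k))
      (fun s => hg _ _ (DefRel.cartan_x ε h j s)) s
  | x_x_same i r s =>
    have := shiftSeq_lie c 1 (fun k => g (.x 1 i k)) (fun k => g (.x (-1) i k))
      (fun k => g (.h i k)) (fun r s => by rw [one_smul]; exact hg _ _ (DefRel.x_x_same i r s)) r s
    rwa [one_smul] at this
  | x_x_ne i j hij r s =>
    have := shiftSeq_lie c 0 (fun k => g (.x 1 i k)) (fun k => g (.x (-1) j k)) 0
      (fun r s => by rw [zero_smul]; exact hg _ _ (DefRel.x_x_ne i j hij r s)) r s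
    rwa [zero_smul] at this
  | h_x ε i j r s =>
    exact shiftSeq_exchange c ħ _ (fun k => g (.h i k)) (fun k => g (.x ε j k))
      (fun r s => hg _ _ (DefRel.h_x ε i j r s)) r s
  | x_x ε i j r s =>
    exact shiftSeq_exchange c ħ _ (fun k => g (.x ε i k)) (fun k => g (.x ε j k))
      (fun r s => hg _ _ (DefRel.x_x ε i j r s)) r s
  | serre ε i j hij r s =>
    have := poly_serre (D.serreDeg i j) (fun k => g (.x ε i k)) (fun k => g (.x ε j k))
      (fun r s => hg _ _ (DefRel.serre ε i j hij r s))
      (fun k => (Polynomial.X + Polynomial.C c) ^ r k) ((Polynomial.X + Polynomial.C c) ^ s)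
    simpa only [shiftGen, shiftSeq_eq] using this

/-- The shift homomorphism `τ_c` of the Yangian: `h ↦ h`,
`x_{ir}^± ↦ ∑_k (r choose k) c ^ (r - k) x_{ik}^±`, and likewise for `h_{ir}`. -/
def tau (c : ℂ) : Yangian D →ₐ[ℂ[X]] Yangian D :=
  Yangian.lift D (shiftGen c (Yangian.gen D)) ((Yangian.gen_isSolution D).shift c)

/-- `Γ = ι ∘ τ_{-1}`. -/
def Gamma : Yangian D →ₐ[ℂ[X]] DY D := (iota D).comp (tau D (-1))

/-- The degree of a generator; `ħ` has degree one. -/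
def Gen.deg : Gen I 𝔥 ℕ → ℕ
  | .cartan _ => 0
  | .x _ _ r => r
  | .h _ r => r

/-- The component `(Y_ħ𝔤)_k` of degree `k`: the span of the monomials in `ħ` and the generators of
total degree `k`. -/
def Yangian.grade (k : ℕ) : Submodule ℂ (Yangian D) :=
  Submodule.span ℂ {y | ∃ (n : ℕ) (l : List (Gen I 𝔥 ℕ)), n + (l.map Gen.deg).sum = k ∧
    y = Yangian.hbar D ^ n * (l.map (Yangian.gen D)).prod}

theorem Yangian.hbar_commute (y : Yangian D) : Commute (Yangian.hbar D) y :=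
  Algebra.commutes _ _

theorem Yangian.hbar_mem : Yangian.hbar D ∈ Yangian.grade D 1 :=
  Submodule.subset_span ⟨1, [], by simp, by simp⟩

theorem Yangian.gen_mem (x : Gen I 𝔥 ℕ) : Yangian.gen D x ∈ Yangian.grade D x.deg :=
  Submodule.subset_span ⟨0, [x], by simp, by simp⟩

instance Yangian.gradedMonoid : SetLike.GradedMonoid (Yangian.grade D) where
  one_mem := Submodule.subset_span ⟨0, [], by simp, by simp⟩
  mul_mem := by
    intro i j y z hy hz
    have := Submodule.mul_mem_mul hy hz
    rw [Yangian.grade, Yangian.grade, Submodule.span_mul_span] at this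
    refine Submodule.span_mono ?_ this
    rintro _ ⟨_, ⟨n, l, rfl, rfl⟩, _, ⟨m, l', rfl, rfl⟩, rfl⟩
    refine ⟨n + m, l ++ l', by simp; ring, ?_⟩
    simp only [List.map_append, List.prod_append, pow_add]
    rw [mul_assoc, ← mul_assoc _ (Yangian.hbar D ^ m),
      ← ((Yangian.hbar_commute D _).pow_left m).eq]
    simp only [mul_assoc]

/-- The formal series `∑ y_k t ^ k` with `y_k` homogeneous of degree `k`. Forgetting `t`, this is the
product `∏ k, (Y_ħ𝔤)_k` with its multiplication. -/
def hatSubalgebra : Subalgebra ℂ (PowerSeries (Yangian D)) where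
  carrier := {f | ∀ k, PowerSeries.coeff k f ∈ Yangian.grade D k}
  mul_mem' := by
    intro f g hf hg k
    rw [PowerSeries.coeff_mul]
    refine Submodule.sum_mem _ fun p hp => ?_
    rw [← Finset.HasAntidiagonal.mem_antidiagonal.mp hp]
    exact SetLike.mul_mem_graded (hf _) (hg _)
  add_mem' := by
    intro f g hf hg k
    rw [map_add]
    exact Submodule.add_mem _ (hf k) (hg k)
  algebraMap_mem' := by
    intro c k
    rw [PowerSeries.algebraMap_apply, PowerSeries.coeff_C]
    split_ifs with hk
    · subst hk
      rw [Algebra.algebraMap_eq_smul_one]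
      exact Submodule.smul_mem _ _ SetLike.GradedOne.one_mem
    · exact Submodule.zero_mem _

/-- The completion of the Yangian with respect to its grading, `∏ k, (Y_ħ𝔤)_k`. -/
def YHat : Type _ := hatSubalgebra D

instance : Ring (YHat D) := inferInstanceAs (Ring (hatSubalgebra D))
instance : Algebra ℂ (YHat D) := inferInstanceAs (Algebra ℂ (hatSubalgebra D))

/-- The homogeneous component of degree `k`. -/
def YHat.coeff (k : ℕ) : YHat D →ₗ[ℂ] Yangian D :=
  ((PowerSeries.coeff (R := Yangian D) k).restrictScalars ℂ).comp
    (hatSubalgebra D).val.toLinearMap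

theorem YHat.coeff_mem (k : ℕ) (f : YHat D) : YHat.coeff D k f ∈ Yangian.grade D k := f.2 k

theorem YHat.ext {f g : YHat D} (h : ∀ k, YHat.coeff D k f = YHat.coeff D k g) : f = g :=
  Subtype.ext (PowerSeries.ext h)

/-- The element with prescribed homogeneous components. -/
def YHat.mk (f : ℕ → Yangian D) (hf : ∀ k, f k ∈ Yangian.grade D k) : YHat D :=
  ⟨PowerSeries.mk f, fun k => by rw [PowerSeries.coeff_mk]; exact hf k⟩

theorem YHat.coeff_mk (f : ℕ → Yangian D) (hf : ∀ k, f k ∈ Yangian.grade D k) (k : ℕ) :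
    YHat.coeff D k (YHat.mk D f hf) = f k :=
  PowerSeries.coeff_mk k f

theorem YHat.coeff_mul (f g : YHat D) (k : ℕ) : YHat.coeff D k (f * g) =
    ∑ p ∈ Finset.HasAntidiagonal.antidiagonal k, YHat.coeff D p.1 f * YHat.coeff D p.2 g :=
  PowerSeries.coeff_mul k f.1 g.1

theorem YHat.coeff_one (k : ℕ) : YHat.coeff D k (1 : YHat D) = if k = 0 then 1 else 0 :=
  PowerSeries.coeff_one k

theorem Yangian.smul_hbar_pow_mem (c : ℂ) (n : ℕ) :
    c • Yangian.hbar D ^ n ∈ Yangian.grade D n := by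
  refine Submodule.smul_mem _ _ ?_
  simpa using SetLike.pow_mem_graded n (Yangian.hbar_mem D)

/-- The structure map of the completion as a `ℂ⟦ħ⟧`-algebra, `∑ c_n ħ ^ n ↦ (c_n ħ ^ n)_n`. -/
def YHat.ofSeries : PowerSeries ℂ →+* YHat D where
  toFun f := YHat.mk D (fun n => PowerSeries.coeff n f • Yangian.hbar D ^ n)
    fun n => Yangian.smul_hbar_pow_mem D _ n
  map_one' := by
    refine YHat.ext D fun k => ?_
    rw [YHat.coeff_mk, YHat.coeff_one, PowerSeries.coeff_one]
    split_ifs with hk <;> simp [hk]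
  map_mul' f g := by
    refine YHat.ext D fun k => ?_
    rw [YHat.coeff_mk, YHat.coeff_mul, PowerSeries.coeff_mul, Finset.sum_smul]
    refine Finset.sum_congr rfl fun p hp => ?_
    rw [YHat.coeff_mk, YHat.coeff_mk, smul_mul_smul_comm, ← pow_add, Finset.HasAntidiagonal.mem_antidiagonal.mp hp]
  map_zero' := by
    refine YHat.ext D fun k => ?_
    rw [YHat.coeff_mk, map_zero, map_zero, zero_smul]
  map_add' f g := by
    refine YHat.ext D fun k => ?_
    rw [YHat.coeff_mk, map_add, map_add, YHat.coeff_mk, YHat.coeff_mk, add_smul]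

theorem YHat.coeff_ofSeries (f : PowerSeries ℂ) (k : ℕ) :
    YHat.coeff D k (YHat.ofSeries D f) = PowerSeries.coeff k f • Yangian.hbar D ^ k :=
  PowerSeries.coeff_mk k fun n => PowerSeries.coeff n f • Yangian.hbar D ^ n

instance : Algebra (PowerSeries ℂ) (YHat D) :=
  RingHom.toAlgebra' (YHat.ofSeries D) (by
    intro c f
    refine YHat.ext D fun k => ?_
    rw [YHat.coeff_mul, YHat.coeff_mul]
    refine Finset.sum_nbij' Prod.swap Prod.swap (by simp [add_comm]) (by simp [add_comm])
      (by simp) (by simp) fun p _ => ?_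
    simp only [Prod.fst_swap, Prod.snd_swap]
    rw [YHat.coeff_ofSeries, smul_mul_assoc, mul_smul_comm,
      ((Yangian.hbar_commute D (YHat.coeff D p.2 f)).pow_left p.1).eq])

instance : Algebra ℂ[X] (YHat D) :=
  Algebra.compHom (YHat D) (Polynomial.coeToPowerSeries.ringHom : ℂ[X] →+* PowerSeries ℂ)

instance : IsScalarTower ℂ (PowerSeries ℂ) (YHat D) := by
  refine IsScalarTower.of_algebraMap_eq fun c => ?_
  refine YHat.ext D fun k => ?_
  change PowerSeries.coeff k (algebraMap ℂ (PowerSeries (Yangian D)) c) =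
    YHat.coeff D k (YHat.ofSeries D (algebraMap ℂ (PowerSeries ℂ) c))
  rw [YHat.coeff_ofSeries, PowerSeries.algebraMap_apply, PowerSeries.coeff_C,
    PowerSeries.algebraMap_apply, PowerSeries.coeff_C]
  split_ifs with hk <;> simp [hk, Algebra.algebraMap_eq_smul_one]

instance : IsScalarTower ℂ[X] (PowerSeries ℂ) (YHat D) :=
  IsScalarTower.of_algebraMap_eq fun _ => rfl

instance : IsScalarTower ℂ ℂ[X] (YHat D) := by
  refine IsScalarTower.of_algebraMap_eq fun c => ?_
  rw [IsScalarTower.algebraMap_apply ℂ (PowerSeries ℂ) (YHat D),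
    IsScalarTower.algebraMap_apply ℂ[X] (PowerSeries ℂ) (YHat D)]
  congr 1
  ext n
  change _ = PowerSeries.coeff n ((Polynomial.C c : ℂ[X]) : PowerSeries ℂ)
  simp [PowerSeries.coeff_C]

theorem monomial_lie {R : Type*} [Ring R] (i j : ℕ) (y z : R) :
    ⁅PowerSeries.monomial i y, PowerSeries.monomial j z⁆ = PowerSeries.monomial (i + j) ⁅y, z⁆ := by
  rw [Ring.lie_def, Ring.lie_def, PowerSeries.monomial_mul_monomial,
    PowerSeries.monomial_mul_monomial, add_comm j i, map_sub]

theorem monomial_foldr {R : Type*} [Ring R] (l : List (ℕ × R)) (s : ℕ) (z : R) :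
    (l.map fun p => PowerSeries.monomial p.1 p.2).foldr (fun u w => ⁅u, w⁆)
        (PowerSeries.monomial s z) =
      PowerSeries.monomial ((l.map Prod.fst).sum + s)
        ((l.map Prod.snd).foldr (fun u w => ⁅u, w⁆) z) := by
  induction l with
  | nil => simp
  | cons p l ih =>
    simp only [List.map_cons, List.foldr_cons, ih, monomial_lie, List.sum_cons, add_assoc]

theorem monomial_csmul {R : Type*} [Ring R] [Algebra ℂ R] (i : ℕ) (c : ℂ) (y : R) :
    c • PowerSeries.monomial i y = PowerSeries.monomial i (c • y) := by
  ext n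
  rw [PowerSeries.coeff_smul, PowerSeries.coeff_monomial, PowerSeries.coeff_monomial]
  split_ifs <;> simp

theorem IsSolution.monomial {D : KacMoodyDatum I 𝔥} {R : Type*} [Ring R] [Algebra ℂ R] {ħ : R}
    {g : Gen I 𝔥 ℕ → R} (hg : IsSolution D ħ g) :
    IsSolution D (PowerSeries.monomial 1 ħ : PowerSeries R)
      (fun x => PowerSeries.monomial x.deg (g x)) := by
  intro a b h
  cases h with
  | cartan_add h h' =>
    have := hg _ _ (DefRel.cartan_add h h')
    simp only [Gen.deg, this, map_add]
  | cartan_smul c h =>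
    have := hg _ _ (DefRel.cartan_smul c h)
    simp only [Gen.deg, this, monomial_csmul]
  | h_zero i =>
    have := hg _ _ (DefRel.h_zero i)
    simp only [Gen.deg, this]
  | h_h i j r s =>
    have := hg _ _ (DefRel.h_h i j r s)
    simp only [monomial_lie, this, map_zero]
  | h_cartan i r h =>
    have := hg _ _ (DefRel.h_cartan i r h)
    simp only [monomial_lie, this, map_zero]
  | cartan_cartan h h' =>
    have := hg _ _ (DefRel.cartan_cartan h h')
    simp only [monomial_lie, this, map_zero]
  | cartan_x ε h j s =>
    have := hg _ _ (DefRel.cartan_x ε h j s)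
    simp only [monomial_lie, this, monomial_csmul, Gen.deg, zero_add]
  | x_x_same i r s =>
    have := hg _ _ (DefRel.x_x_same i r s)
    simp only [monomial_lie, this, Gen.deg]
  | x_x_ne i j hij r s =>
    have := hg _ _ (DefRel.x_x_ne i j hij r s)
    simp only [monomial_lie, this, map_zero]
  | h_x ε i j r s =>
    have := hg _ _ (DefRel.h_x ε i j r s)
    have e1 : r + (s + 1) = r + 1 + s := by ring
    have e2 : 1 + (r + s) = r + 1 + s := by ring
    simp only [monomial_lie, PowerSeries.monomial_mul_monomial, Gen.deg, add_comm s r, ← map_add, monomial_csmul, e1, e2,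
      ← map_sub, this]
  | x_x ε i j r s =>
    have := hg _ _ (DefRel.x_x ε i j r s)
    have e1 : r + (s + 1) = r + 1 + s := by ring
    have e2 : 1 + (r + s) = r + 1 + s := by ring
    simp only [monomial_lie, PowerSeries.monomial_mul_monomial, Gen.deg, add_comm s r, ← map_add, monomial_csmul, e1, e2,
      ← map_sub, this]
  | serre ε i j hij r s =>
    have := hg _ _ (DefRel.serre ε i j hij r s)
    have key : ∀ π : Equiv.Perm (Fin (D.serreDeg i j)),
        (List.ofFn fun k => PowerSeries.monomial (r (π k)) (g (.x ε i (r (π k))))).foldr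
          (fun u w => ⁅u, w⁆) (PowerSeries.monomial s (g (.x ε j s))) =
        PowerSeries.monomial (∑ k, r k + s)
          ((List.ofFn fun k => g (.x ε i (r (π k)))).foldr (fun u w => ⁅u, w⁆) (g (.x ε j s))) := by
      intro π
      have := monomial_foldr (List.ofFn fun k => (r (π k), g (.x ε i (r (π k))))) s (g (.x ε j s))
      simp only [List.map_ofFn, Function.comp_def, List.sum_ofFn] at this
      rw [this, Equiv.sum_comp π r]
    simp only [Gen.deg]
    rw [Finset.sum_congr rfl fun π _ => key π, ← map_sum, this, map_zero]

/-- A homogeneous element of the Yangian, in the completion. -/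
def YHat.single (k : ℕ) (y : Yangian D) (hy : y ∈ Yangian.grade D k) : YHat D :=
  ⟨PowerSeries.monomial k y, fun n => by
    rw [PowerSeries.coeff_monomial]
    split_ifs with h
    · exact h ▸ hy
    · exact Submodule.zero_mem _⟩

theorem YHat.algebraMap_X :
    algebraMap ℂ[X] (YHat D) Polynomial.X =
      YHat.single D 1 (Yangian.hbar D) (Yangian.hbar_mem D) := by
  refine YHat.ext D fun k => ?_
  change YHat.coeff D k (YHat.ofSeries D ((Polynomial.X : ℂ[X]) : PowerSeries ℂ)) =
    PowerSeries.coeff k (PowerSeries.monomial 1 (Yangian.hbar D))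
  rw [YHat.coeff_ofSeries, PowerSeries.coeff_monomial, Polynomial.coe_X, PowerSeries.coeff_X]
  split_ifs with h <;> simp [h]

/-- The canonical homomorphism from the Yangian to its completion: a generator of degree `k` goes to
the element whose only component is that generator, in degree `k`. -/
def toHat : Yangian D →ₐ[ℂ[X]] YHat D :=
  Yangian.lift D (fun x => YHat.single D x.deg (Yangian.gen D x) (Yangian.gen_mem D x)) (by
    intro a b h
    rw [YHat.algebraMap_X] at h
    have := (Yangian.gen_isSolution D).monomial _ _
      (h.map (hatSubalgebra D).val rfl (fun _ => rfl))
    exact Subtype.ext this)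

end

/-- A descending `ℕ`-filtration of a `ℂ[ħ]`-algebra, starting with the whole algebra and with `ħ` in
filtration degree one. -/
structure FilteredAlg (A : Type*) [Ring A] [Algebra ℂ A] [Algebra ℂ[X] A] where
  F : ℕ → Submodule ℂ A
  zero_eq_top : F 0 = ⊤
  succ_le : ∀ n, F (n + 1) ≤ F n
  mul_mem : ∀ {i j : ℕ} {x y : A}, x ∈ F i → y ∈ F j → x * y ∈ F (i + j)
  hbar_mem : algebraMap ℂ[X] A Polynomial.X ∈ F 1

namespace FilteredAlg

section
variable {A : Type*} [Ring A] [Algebra ℂ A] [Algebra ℂ[X] A] (𝓕 : FilteredAlg A)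

theorem one_mem : (1 : A) ∈ 𝓕.F 0 := by rw [𝓕.zero_eq_top]; trivial

/-- The quotient `F n / F (n + 1)`. -/
def Piece (n : ℕ) : Type _ := 𝓕.F n ⧸ (𝓕.F (n + 1)).submoduleOf (𝓕.F n)

instance (n : ℕ) : AddCommGroup (𝓕.Piece n) :=
  inferInstanceAs (AddCommGroup (𝓕.F n ⧸ (𝓕.F (n + 1)).submoduleOf (𝓕.F n)))

instance (n : ℕ) : Module ℂ (𝓕.Piece n) :=
  inferInstanceAs (Module ℂ (𝓕.F n ⧸ (𝓕.F (n + 1)).submoduleOf (𝓕.F n)))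

/-- The class of an element of `F n` modulo `F (n + 1)`. -/
def cls (n : ℕ) : 𝓕.F n →ₗ[ℂ] 𝓕.Piece n := Submodule.mkQ ((𝓕.F (n + 1)).submoduleOf (𝓕.F n))

theorem cls_surjective (n : ℕ) : Function.Surjective (𝓕.cls n) := Submodule.Quotient.mk_surjective _

theorem cls_eq {n : ℕ} {x y : 𝓕.F n} : 𝓕.cls n x = 𝓕.cls n y ↔ (x : A) - y ∈ 𝓕.F (n + 1) :=
  Submodule.Quotient.eq _

/-- The product `F i / F (i + 1) × F j / F (j + 1) → F (i + j) / F (i + j + 1)`. -/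
def pieceMul {i j : ℕ} (a : 𝓕.Piece i) (b : 𝓕.Piece j) : 𝓕.Piece (i + j) :=
  Quotient.liftOn₂' a b (fun x y => 𝓕.cls (i + j) ⟨x * y, 𝓕.mul_mem x.2 y.2⟩) (by
    intro x y x' y' hx hy
    rw [Submodule.quotientRel_def] at hx hy
    have hx' : (x : A) - x' ∈ 𝓕.F (i + 1) := hx
    have hy' : (y : A) - y' ∈ 𝓕.F (j + 1) := hy
    rw [cls_eq]
    have h1 := 𝓕.mul_mem hx' y.2
    have h2 := 𝓕.mul_mem x'.2 hy'
    rw [show i + 1 + j = i + j + 1 by ring] at h1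
    rw [← add_assoc] at h2
    have := add_mem h1 h2
    convert this using 1
    simp only
    noncomm_ring)

theorem pieceMul_cls {i j : ℕ} (x : 𝓕.F i) (y : 𝓕.F j) :
    𝓕.pieceMul (𝓕.cls i x) (𝓕.cls j y) = 𝓕.cls (i + j) ⟨x * y, 𝓕.mul_mem x.2 y.2⟩ := rfl

theorem mk_cls_eq {i j : ℕ} (h : i = j) {x : 𝓕.F i} {y : 𝓕.F j} (hxy : (x : A) = y) :
    (GradedMonoid.mk i (𝓕.cls i x) : GradedMonoid 𝓕.Piece) = GradedMonoid.mk j (𝓕.cls j y) := by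
  subst h
  rw [Subtype.ext hxy]

instance : GradedMonoid.GOne 𝓕.Piece := ⟨𝓕.cls 0 ⟨1, 𝓕.one_mem⟩⟩

instance : GradedMonoid.GMul 𝓕.Piece := ⟨𝓕.pieceMul⟩

instance : DirectSum.GRing 𝓕.Piece where
  mul_zero := by
    intro i j a
    obtain ⟨x, rfl⟩ := 𝓕.cls_surjective _ a
    exact congrArg (𝓕.cls _) (Subtype.ext (mul_zero (x : A)))
  zero_mul := by
    intro i j a
    obtain ⟨x, rfl⟩ := 𝓕.cls_surjective _ a
    exact congrArg (𝓕.cls _) (Subtype.ext (zero_mul (x : A)))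
  mul_add := by
    intro i j a b c
    obtain ⟨x, rfl⟩ := 𝓕.cls_surjective _ a
    obtain ⟨y, rfl⟩ := 𝓕.cls_surjective _ b
    obtain ⟨z, rfl⟩ := 𝓕.cls_surjective _ c
    exact congrArg (𝓕.cls _) (Subtype.ext (mul_add (x : A) y z))
  add_mul := by
    intro i j a b c
    obtain ⟨x, rfl⟩ := 𝓕.cls_surjective _ a
    obtain ⟨y, rfl⟩ := 𝓕.cls_surjective _ b
    obtain ⟨z, rfl⟩ := 𝓕.cls_surjective _ c
    exact congrArg (𝓕.cls _) (Subtype.ext (add_mul (x : A) y z))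
  one_mul := by
    rintro ⟨i, a⟩
    obtain ⟨x, rfl⟩ := 𝓕.cls_surjective _ a
    exact 𝓕.mk_cls_eq (zero_add i) (one_mul (x : A))
  mul_one := by
    rintro ⟨i, a⟩
    obtain ⟨x, rfl⟩ := 𝓕.cls_surjective _ a
    exact 𝓕.mk_cls_eq (add_zero i) (mul_one (x : A))
  mul_assoc := by
    rintro ⟨i, a⟩ ⟨j, b⟩ ⟨k, c⟩
    obtain ⟨x, rfl⟩ := 𝓕.cls_surjective _ a
    obtain ⟨y, rfl⟩ := 𝓕.cls_surjective _ b
    obtain ⟨z, rfl⟩ := 𝓕.cls_surjective _ c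
    exact 𝓕.mk_cls_eq (add_assoc i j k) (mul_assoc (x : A) y z)
  natCast n := 𝓕.cls 0 ⟨n, by rw [𝓕.zero_eq_top]; trivial⟩
  natCast_zero := congrArg (𝓕.cls _) (Subtype.ext Nat.cast_zero)
  natCast_succ n := congrArg (𝓕.cls _) (Subtype.ext (Nat.cast_succ n))
  intCast n := 𝓕.cls 0 ⟨n, by rw [𝓕.zero_eq_top]; trivial⟩
  intCast_ofNat n := congrArg (𝓕.cls _) (Subtype.ext (Int.cast_natCast n))
  intCast_negSucc_ofNat n := congrArg (𝓕.cls _) (Subtype.ext (Int.cast_negSucc n))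

instance : DirectSum.GAlgebra ℂ 𝓕.Piece where
  toFun :=
    { toFun := fun c => 𝓕.cls 0 ⟨algebraMap ℂ A c, by rw [𝓕.zero_eq_top]; trivial⟩
      map_zero' := congrArg (𝓕.cls _) (Subtype.ext (map_zero _))
      map_add' := fun c d => congrArg (𝓕.cls _) (Subtype.ext (map_add _ c d)) }
  map_one := congrArg (𝓕.cls _) (Subtype.ext (map_one _))
  map_mul c d := 𝓕.mk_cls_eq rfl (map_mul _ c d)
  commutes := by
    rintro c ⟨i, a⟩
    obtain ⟨x, rfl⟩ := 𝓕.cls_surjective _ a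
    exact 𝓕.mk_cls_eq ((zero_add i).trans (add_zero i).symm) (Algebra.commutes c (x : A))
  smul_def := by
    rintro c ⟨i, a⟩
    obtain ⟨x, rfl⟩ := 𝓕.cls_surjective _ a
    exact 𝓕.mk_cls_eq (x := c • x) (zero_add i).symm (Algebra.smul_def c (x : A))

/-- The associated graded algebra `⨁ n, F n / F (n + 1)`. -/
abbrev Gr : Type _ := ⨁ n, 𝓕.Piece n

/-- The symbol of an element of `F n`, in degree `n` of the associated graded algebra. -/
def symb (n : ℕ) : 𝓕.F n →ₗ[ℂ] 𝓕.Gr :=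
  (DirectSum.lof ℂ ℕ 𝓕.Piece n).comp (𝓕.cls n)

theorem symb_mul {i j : ℕ} (x : 𝓕.F i) (y : 𝓕.F j) :
    𝓕.symb i x * 𝓕.symb j y = 𝓕.symb (i + j) ⟨x * y, 𝓕.mul_mem x.2 y.2⟩ :=
  DirectSum.of_mul_of (A := 𝓕.Piece) (𝓕.cls i x) (𝓕.cls j y)

theorem symb_congr {i j : ℕ} (h : i = j) {x : 𝓕.F i} {y : 𝓕.F j} (hxy : (x : A) = y) :
    𝓕.symb i x = 𝓕.symb j y := by
  subst h
  rw [Subtype.ext hxy]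

theorem symb_one : 𝓕.symb 0 ⟨1, 𝓕.one_mem⟩ = 1 := rfl

theorem Gr.induction {P : 𝓕.Gr → Prop} (h0 : P 0) (hs : ∀ n x, P (𝓕.symb n x))
    (hadd : ∀ a b, P a → P b → P (a + b)) (a : 𝓕.Gr) : P a := by
  refine DirectSum.induction_on (β := 𝓕.Piece) a h0 (fun n x => ?_) hadd
  obtain ⟨x, rfl⟩ := 𝓕.cls_surjective n x
  exact hs n x

/-- The component of degree `n` of the associated graded algebra. -/
def homog (n : ℕ) : Submodule ℂ 𝓕.Gr := LinearMap.range (𝓕.symb n)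

/-- The symbol of `ħ` in degree one. -/
def grHbar : 𝓕.Gr := 𝓕.symb 1 ⟨algebraMap ℂ[X] A Polynomial.X, 𝓕.hbar_mem⟩

theorem grHbar_commute (a : 𝓕.Gr) : Commute 𝓕.grHbar a := by
  refine Gr.induction 𝓕 (Commute.zero_right _) (fun n x => ?_) (fun a b => Commute.add_right) a
  change _ * _ = _ * _
  rw [grHbar, symb_mul, symb_mul]
  exact 𝓕.symb_congr (add_comm 1 n) (Algebra.commutes _ (x : A))

/-- The associated graded algebra is a graded `ℂ[ħ]`-algebra, `ħ` acting by its symbol in degree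
one. -/
instance : Algebra ℂ[X] 𝓕.Gr :=
  RingHom.toAlgebra' (Polynomial.aeval 𝓕.grHbar : ℂ[X] →ₐ[ℂ] 𝓕.Gr).toRingHom (by
    intro p a
    change Commute (Polynomial.aeval 𝓕.grHbar p) a
    induction p using Polynomial.induction_on' with
    | add p q hp hq => rw [map_add]; exact hp.add_left hq
    | monomial n c =>
      rw [Polynomial.aeval_monomial]
      have hc : Commute (algebraMap ℂ 𝓕.Gr c) a := Algebra.commutes c a
      exact hc.mul_left ((𝓕.grHbar_commute a).pow_left n))

theorem algebraMap_eq (p : ℂ[X]) : algebraMap ℂ[X] 𝓕.Gr p = Polynomial.aeval 𝓕.grHbar p := rfl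

end

section
variable {A B : Type*} [Ring A] [Algebra ℂ A] [Algebra ℂ[X] A] [IsScalarTower ℂ ℂ[X] A]
  [Ring B] [Algebra ℂ B] [Algebra ℂ[X] B] [IsScalarTower ℂ ℂ[X] B]
  (𝓕 : FilteredAlg A) (𝓖 : FilteredAlg B)

/-- A homomorphism is filtered if it maps `F n` to `G n`. -/
def IsFiltered (f : A →ₐ[ℂ[X]] B) : Prop := ∀ n, ∀ x ∈ 𝓕.F n, f x ∈ 𝓖.F n

/-- The map induced by a filtered homomorphism on `F n / F (n + 1)`. -/
def grMapPiece (f : A →ₐ[ℂ[X]] B) (hf : IsFiltered 𝓕 𝓖 f) (n : ℕ) : 𝓕.Piece n →ₗ[ℂ] 𝓖.Piece n :=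
  Submodule.mapQ _ _ ((f.restrictScalars ℂ).toLinearMap.restrict (hf n)) fun x hx =>
    hf (n + 1) x hx

/-- The associated graded map of a filtered homomorphism, as a `ℂ`-algebra map. -/
def grMapℂ (f : A →ₐ[ℂ[X]] B) (hf : IsFiltered 𝓕 𝓖 f) : 𝓕.Gr →ₐ[ℂ] 𝓖.Gr :=
  DirectSum.toAlgebra ℂ 𝓕.Piece
    (fun n => (DirectSum.lof ℂ ℕ 𝓖.Piece n).comp (grMapPiece 𝓕 𝓖 f hf n))
    (𝓖.symb_congr rfl (map_one f))
    (by
      intro i j a b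
      obtain ⟨x, rfl⟩ := 𝓕.cls_surjective _ a
      obtain ⟨y, rfl⟩ := 𝓕.cls_surjective _ b
      refine Eq.trans ?_ (𝓖.symb_mul ⟨f x, hf i x x.2⟩ ⟨f y, hf j y y.2⟩).symm
      exact 𝓖.symb_congr rfl (map_mul f (x : A) y))

theorem grMapℂ_symb (f : A →ₐ[ℂ[X]] B) (hf : IsFiltered 𝓕 𝓖 f) (n : ℕ) (x : 𝓕.F n) :
    grMapℂ 𝓕 𝓖 f hf (𝓕.symb n x) = 𝓖.symb n ⟨f x, hf n x x.2⟩ := by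
  exact DirectSum.toModule_lof ℂ n (𝓕.cls n x)

/-- The associated graded map of a filtered homomorphism. -/
def grMap (f : A →ₐ[ℂ[X]] B) (hf : IsFiltered 𝓕 𝓖 f) : 𝓕.Gr →ₐ[ℂ[X]] 𝓖.Gr :=
  { (grMapℂ 𝓕 𝓖 f hf : 𝓕.Gr →+* 𝓖.Gr) with
    commutes' := fun p => by
      change grMapℂ 𝓕 𝓖 f hf (Polynomial.aeval 𝓕.grHbar p) = Polynomial.aeval 𝓖.grHbar p
      rw [← Polynomial.aeval_algHom_apply]
      congr 2
      rw [grHbar, grMapℂ_symb]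
      exact 𝓖.symb_congr rfl (f.commutes _) }

theorem grMap_symb (f : A →ₐ[ℂ[X]] B) (hf : IsFiltered 𝓕 𝓖 f) (n : ℕ) (x : 𝓕.F n) :
    grMap 𝓕 𝓖 f hf (𝓕.symb n x) = 𝓖.symb n ⟨f x, hf n x x.2⟩ :=
  grMapℂ_symb 𝓕 𝓖 f hf n x

end

end FilteredAlg

/-- The filtration by the powers of a two-sided ideal that contains `ħ`. -/
def idealFilt {A : Type*} [Ring A] [Algebra ℂ A] [Algebra ℂ[X] A] (J : Ideal A) [J.IsTwoSided]
    (hJ : algebraMap ℂ[X] A Polynomial.X ∈ J) : FilteredAlg A where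
  F n := (J ^ n).restrictScalars ℂ
  zero_eq_top := by rw [Submodule.pow_zero, Ideal.one_eq_top]; rfl
  succ_le n := by
    have : J ^ (n + 1) ≤ J ^ n := Ideal.pow_le_pow_right n.le_succ
    exact this
  mul_mem := by
    intro i j x y hx hy
    change _ ∈ J ^ (i + j)
    rw [Ideal.IsTwoSided.pow_add]
    exact Ideal.mul_mem_mul hx hy
  hbar_mem := by
    change _ ∈ J ^ 1
    rw [Submodule.pow_one]
    exact hJ

section
variable (D : KacMoodyDatum I 𝔥)

/-- The ideal `Y_+ = ⨁ k > 0, (Y_ħ𝔤)_k`. -/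
def Yangian.plus : Ideal (Yangian D) :=
  (TwoSidedIdeal.span {y | ∃ k > 0, y ∈ Yangian.grade D k}).asIdeal

instance : (Yangian.plus D).IsTwoSided :=
  inferInstanceAs
    (TwoSidedIdeal.span {y : Yangian D | ∃ k > 0, y ∈ Yangian.grade D k}).asIdeal.IsTwoSided

/-- The filtration of the Yangian by the powers of `Y_+`. -/
def yFilt : FilteredAlg (Yangian D) :=
  idealFilt (Yangian.plus D) (TwoSidedIdeal.mem_asIdeal.mpr (TwoSidedIdeal.subset_span
    ⟨1, one_pos, Yangian.hbar_mem D⟩))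

/-- The filtration of the Yangian double by the powers of `𝒥`. -/
def evFilt : FilteredAlg (DY D) :=
  idealFilt (evIdeal D) (by rw [DY.algebraMap_X]; exact ev_hbar D)

/-- The filtration of the completion by the ideals `∏ k ≥ n, (Y_ħ𝔤)_k`. -/
def hatFilt : FilteredAlg (YHat D) where
  F n :=
    { carrier := {f | ∀ k < n, YHat.coeff D k f = 0}
      add_mem' := fun {f g} hf hg k hk => by rw [map_add, hf k hk, hg k hk, add_zero]
      zero_mem' := fun k _ => map_zero _
      smul_mem' := fun c f hf k hk => by rw [map_smul, hf k hk, smul_zero] }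
  zero_eq_top := by
    ext f
    simp
  succ_le n f hf k hk := hf k (hk.trans (Nat.lt_succ_self n))
  mul_mem := by
    intro i j f g hf hg k hk
    rw [YHat.coeff_mul]
    refine Finset.sum_eq_zero fun p hp => ?_
    have := Finset.HasAntidiagonal.mem_antidiagonal.mp hp
    rcases lt_or_ge p.1 i with h | h
    · rw [hf _ h, zero_mul]
    · rw [hg _ (by omega), mul_zero]
  hbar_mem := by
    intro k hk
    rw [YHat.algebraMap_X]
    change PowerSeries.coeff k (PowerSeries.monomial 1 (Yangian.hbar D)) = 0
    rw [PowerSeries.coeff_monomial, if_neg (by omega)]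

/-- The element `∑ n, (r choose n) y_n` of the completion. -/
def phiSeq (y : ℕ → Yangian D) (hy : ∀ n, y n ∈ Yangian.grade D n) (r : ℤ) : YHat D :=
  YHat.mk D (fun n => ((Ring.choose r n : ℤ) : ℂ) • y n) fun n => Submodule.smul_mem _ _ (hy n)

/-- The values of `Φ` on the generators: `𝒳_{ir}^± ↦ ∑ n, (r choose n) x_{in}^±`,
`ℋ_{ir} ↦ ∑ n, (r choose n) h_{in}` and `h ↦ h`, for all `r ∈ ℤ`. -/
def phiGen : Gen I 𝔥 ℤ → YHat D
  | .cartan y => toHat D (Yangian.gen D (.cartan y))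
  | .x ε i r => phiSeq D (fun n => Yangian.gen D (.x ε i n)) (fun n => Yangian.gen_mem D (.x ε i n)) r
  | .h i r => phiSeq D (fun n => Yangian.gen D (.h i n)) (fun n => Yangian.gen_mem D (.h i n)) r

theorem evIdeal_pow_mul {m n k : ℕ} (h : k ≤ m + n) {x y : DY D} (hx : x ∈ evIdeal D ^ m)
    (hy : y ∈ evIdeal D ^ n) : x * y ∈ evIdeal D ^ k := by
  refine Ideal.pow_le_pow_right h ?_
  rw [Ideal.IsTwoSided.pow_add]
  exact Ideal.mul_mem_mul hx hy

/-- The extended Rees algebra `⨁ n ∈ ℤ, v ^ (-n) 𝒥 ^ n` in `DY_ħ𝔤[v, v⁻¹]`, where `𝒥 ^ n` is the whole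
algebra for `n ≤ 0`. The Laurent variable `T` is `v`. -/
def rees : Subalgebra ℂ (DY D)[T;T⁻¹] where
  carrier := {f | ∀ n : ℤ, f.coeff n ∈ evIdeal D ^ (-n).toNat}
  add_mem' := fun {f g} hf hg n => Submodule.add_mem _ (hf n) (hg n)
  algebraMap_mem' := by
    intro c n
    change (AddMonoidAlgebra.single (0 : ℤ) (algebraMap ℂ (DY D) c)).coeff n ∈ _
    rw [AddMonoidAlgebra.coeff_single, Finsupp.single_apply]
    split_ifs with h
    · subst h
      rw [neg_zero, Int.toNat_zero, Submodule.pow_zero, Ideal.one_eq_top]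
      trivial
    · exact Submodule.zero_mem _
  mul_mem' := by
    classical
    intro f g hf hg n
    rw [AddMonoidAlgebra.coeff_mul, Finsupp.sum]
    refine Submodule.sum_mem _ fun i _ => Submodule.sum_mem _ fun j _ => ?_
    dsimp only
    split_ifs with h
    · exact evIdeal_pow_mul D (by omega) (hf i) (hg j)
    · exact Submodule.zero_mem _

theorem single_mem_rees {n : ℤ} {x : DY D} :
    (AddMonoidAlgebra.single n x : (DY D)[T;T⁻¹]) ∈ rees D ↔ x ∈ evIdeal D ^ (-n).toNat := by
  constructor
  · intro h
    have := h n
    rwa [AddMonoidAlgebra.coeff_single, Finsupp.single_eq_same] at this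
  · intro h m
    rw [AddMonoidAlgebra.coeff_single, Finsupp.single_apply]
    split_ifs with hm
    · exact hm ▸ h
    · exact Submodule.zero_mem _

/-- The extended Rees algebra as a type. -/
abbrev Rees : Type _ := rees D

namespace Rees

/-- The element `v` of the extended Rees algebra. -/
def v : Rees D := ⟨LaurentPolynomial.T 1, (single_mem_rees D).mpr (by
  rw [show (-1 : ℤ).toNat = 0 from rfl, Submodule.pow_zero, Ideal.one_eq_top]
  trivial)⟩

theorem v_commute (f : Rees D) : Commute (v D) f :=
  Subtype.ext (LaurentPolynomial.commute_T 1 (f : (DY D)[T;T⁻¹]))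

/-- The extended Rees algebra as an algebra over `ℂ[v]`: the polynomial variable acts as `v`. -/
instance : Algebra ℂ[X] (Rees D) :=
  RingHom.toAlgebra' (Polynomial.aeval (v D) : ℂ[X] →ₐ[ℂ] Rees D).toRingHom (by
    intro p a
    change Commute (Polynomial.aeval (v D) p) a
    induction p using Polynomial.induction_on' with
    | add p q hp hq => rw [map_add]; exact hp.add_left hq
    | monomial n c =>
      rw [Polynomial.aeval_monomial]
      have hc : Commute (algebraMap ℂ (Rees D) c) a := Algebra.commutes c a
      exact hc.mul_left ((v_commute D a).pow_left n))

/-- The element `v ^ (-n) x` for `x ∈ 𝒥 ^ n`. -/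
def mono (n : ℕ) (x : DY D) (hx : x ∈ evIdeal D ^ n) : Rees D :=
  ⟨LaurentPolynomial.C x * LaurentPolynomial.T (-n), by
    rw [← LaurentPolynomial.single_eq_C_mul_T, single_mem_rees, neg_neg, Int.toNat_natCast]
    exact hx⟩

/-- The ideal generated by the central element `v - c`. -/
def fibreIdeal (c : ℂ) : Ideal (Rees D) := Ideal.span {v D - algebraMap ℂ (Rees D) c}

instance (c : ℂ) : (fibreIdeal D c).IsTwoSided := ⟨fun {a} b ha => by
  obtain ⟨e, rfl⟩ := Ideal.mem_span_singleton'.mp ha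
  have hb : Commute (algebraMap ℂ (Rees D) c) b := Algebra.commutes c b
  rw [mul_assoc, ((v_commute D b).sub_left hb).eq, ← mul_assoc]
  exact Ideal.mem_span_singleton'.mpr ⟨_, rfl⟩⟩

/-- The fibre at `v = c` of the extended Rees algebra. -/
abbrev Fibre (c : ℂ) : Type _ := Rees D ⧸ fibreIdeal D c

/-- The projection to the fibre. -/
def toFibre (c : ℂ) : Rees D →ₐ[ℂ] Fibre D c := Ideal.Quotient.mkₐ ℂ (fibreIdeal D c)

end Rees

end
end YangianDouble

end

open YangianDouble FilteredAlg
open scoped Polynomial PowerSeries LaurentPolynomial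

/-!
The argument rests on the raising operators `S u = c⁻¹ [a, u] - ½ ħ (b u + u b)` (`raise`). With
`c = ± 2 d_i`, `b = h_{i0}` and `a = h_{i1}` such an operator sends `x_{ir}^±` to `x_{i,r+1}^±`, and with
`a = h_{i1} - h_{i0}` it sends `x_{ir}^±` to `x_{i,r+1}^± - x_{ir}^±`; moreover `h_{ir}` is the
commutator of `x_{ir}^+` and `x_{i0}^-`. Hence the Yangian is generated by `ħ`, elements of degree zero
and the `h_{i1}`, all of degree one, so that `Y_k ⊆ Y_+ ^ k` (`Yangian.grade_le_filt`); and in the double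
the second differences of the modes lie in `𝒥 ^ 2` (`x_second_difference_mem`).

Existence of `Φ`: if all modes `≥ N` vanish, a family `y_r` extends to `r ∈ ℤ` by evaluating
the linear map `X ^ n ↦ y_n` on `(1 + X) ^ r` modulo `X ^ N`, and the relations extend because they are
multilinear identities in polynomials (`IsSolution.binomial`). Applied modulo every step of the
filtration of the completion, this shows that the binomial series satisfy the relations of the double
(`phiGen_isSolution`). Uniqueness: two candidates for the value at a negative mode differ by some `u`
with `u = - S u`, where `S` raises the filtration degree, so `u = 0` (`phi_unique`).

For `gr(Γ)`, the Chevalley-Serre presentation of the Kac-Moody algebra shows that `𝒥` is generated by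
`ħ` and the differences of modes (`mem_span_of_mem_evIdeal`). By the statement on second differences
every element of `𝒥` is then congruent modulo `𝒥 ^ 2` to an element of `Γ(Y_1)`, and, by
multiplicativity, every element of `𝒥 ^ n` is congruent modulo `𝒥 ^ (n + 1)` to an element of `Γ(Y_n)`
(`evFilt_le_gammaSpan`): `gr(Γ)` is surjective. Since `Φ ∘ Γ` is the canonical map of the Yangian to its
completion, `gr(Φ) ∘ gr(Γ)` is the canonical isomorphism, so `gr(Γ)` is injective and `gr(Φ)` inverts
it (`grMap_Gamma_bijective`). No basis theorem for the Yangian or the double is needed.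

The statements on the extended Rees algebra hold for any ideal, by comparing coefficients of Laurent
polynomials.
-/

open scoped Polynomial PowerSeries DirectSum LaurentPolynomial

noncomputable section

namespace YangianDouble

variable {I : Type*} [Fintype I] {𝔥 : Type*} [AddCommGroup 𝔥] [Module ℂ 𝔥]

/-! ### The raising operators -/

/-- The operator `u ↦ c⁻¹ [a, u] - ½ ħ (b u + u b)`. For `c = ± 2 d_i`, `a = h_{i1}`, `b = h_{i0}` it
sends `x_{is}^±` to `x_{i,s+1}^±`. -/
def raise {R : Type*} [Ring R] [Algebra ℂ R] (c : ℂ) (ħ a b : R) : R →ₗ[ℂ] R :=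
  c⁻¹ • (LinearMap.mulLeft ℂ a - LinearMap.mulRight ℂ a) -
    (1 / 2 : ℂ) • (LinearMap.mulLeft ℂ ħ ∘ₗ (LinearMap.mulLeft ℂ b + LinearMap.mulRight ℂ b))

theorem raise_apply {R : Type*} [Ring R] [Algebra ℂ R] (c : ℂ) (ħ a b u : R) :
    raise c ħ a b u = c⁻¹ • ⁅a, u⁆ - (1 / 2 : ℂ) • (ħ * (b * u + u * b)) := rfl

theorem map_raise {R S : Type*} [Ring R] [Algebra ℂ R] [Ring S] [Algebra ℂ S] (f : R →ₐ[ℂ] S)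
    (c : ℂ) (ħ a b u : R) : f (raise c ħ a b u) = raise c (f ħ) (f a) (f b) (f u) := by
  simp only [raise_apply, map_sub, map_smul, map_mul, map_add, Ring.lie_def]

/-- The number `± 2 d_i`, the eigenvalue of `ad h_{i0}` on each `x_{is}^±`. -/
def KacMoodyDatum.weight (D : KacMoodyDatum I 𝔥) (ε : ℤˣ) (i : I) : ℂ := ((ε : ℤ) : ℂ) * (2 * D.d i)

theorem KacMoodyDatum.weight_ne_zero (D : KacMoodyDatum I 𝔥) (ε : ℤˣ) (i : I) :
    D.weight ε i ≠ 0 := by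
  have h1 : ((ε : ℤ) : ℂ) ≠ 0 := Int.cast_ne_zero.mpr ε.ne_zero
  have h2 : (D.d i : ℂ) ≠ 0 := Nat.cast_ne_zero.mpr (D.d_pos i).ne'
  exact mul_ne_zero h1 (mul_ne_zero two_ne_zero h2)

section
variable {D : KacMoodyDatum I 𝔥} {K : Type*} [AddMonoidWithOne K] {R : Type*} [Ring R] [Algebra ℂ R]
  {ħ : R} {g : Gen I 𝔥 K → R}

theorem IsSolution.lie_h_zero_x (hg : IsSolution D ħ g) (ε : ℤˣ) (i : I) (s : K) :
    ⁅g (.h i 0), g (.x ε i s)⁆ = D.weight ε i • g (.x ε i s) := by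
  rw [hg _ _ (.h_zero i), hg _ _ (.cartan_x ε _ i s), map_smul, D.root_coroot, D.a_diag,
    KacMoodyDatum.weight, smul_eq_mul]
  congr 2
  push_cast
  ring

theorem IsSolution.x_succ (hg : IsSolution D ħ g) (ε : ℤˣ) (i : I) (s : K) :
    g (.x ε i (s + 1)) = raise (D.weight ε i) ħ (g (.h i 1)) (g (.h i 0)) (g (.x ε i s)) := by
  have h := hg _ _ (.h_x ε i i 0 s)
  rw [zero_add, hg.lie_h_zero_x, sub_eq_iff_eq_add] at h
  rw [raise_apply, h, smul_add, smul_smul, smul_smul, inv_mul_cancel₀ (D.weight_ne_zero ε i), one_smul]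
  have : (D.weight ε i)⁻¹ * (((ε : ℤ) : ℂ) * D.dd i i) = 1 / 2 := by
    rw [inv_mul_eq_iff_eq_mul₀ (D.weight_ne_zero ε i), KacMoodyDatum.dd, KacMoodyDatum.weight, D.a_diag]
    push_cast
    ring
  rw [this, add_sub_cancel_left]

/-- The difference `x_{i,s+1}^± - x_{is}^±` comes from `x_{is}^±` by a raising operator built from
`h_{i1} - h_{i0}` and `ħ`, which lie in the evaluation ideal. -/
theorem IsSolution.x_succ_sub (hg : IsSolution D ħ g) (ε : ℤˣ) (i : I) (s : K) :
    g (.x ε i (s + 1)) - g (.x ε i s) =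
      raise (D.weight ε i) ħ (g (.h i 1) - g (.h i 0)) (g (.h i 0)) (g (.x ε i s)) := by
  have h : (D.weight ε i)⁻¹ • ⁅g (.h i 0), g (.x ε i s)⁆ = g (.x ε i s) := by
    rw [hg.lie_h_zero_x, smul_smul, inv_mul_cancel₀ (D.weight_ne_zero ε i), one_smul]
  have h' : ∀ u, raise (D.weight ε i) ħ (g (.h i 1) - g (.h i 0)) (g (.h i 0)) u =
      raise (D.weight ε i) ħ (g (.h i 1)) (g (.h i 0)) u -
        (D.weight ε i)⁻¹ • ⁅g (.h i 0), u⁆ := by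
    intro u
    simp only [raise_apply, Ring.lie_def, sub_mul, mul_sub, smul_sub]
    abel
  rw [h', h, ← hg.x_succ]

theorem IsSolution.h_eq_lie_left (hg : IsSolution D ħ g) (i : I) (s : K) :
    g (.h i s) = ⁅g (.x 1 i s), g (.x (-1) i 0)⁆ := by
  rw [hg _ _ (.x_x_same i s 0), add_zero]

end

theorem FilteredAlg.raise_mem {A : Type*} [Ring A] [Algebra ℂ A] [Algebra ℂ[X] A]
    (𝓕 : FilteredAlg A) (c : ℂ) {ħ a : A} (hħ : ħ ∈ 𝓕.F 1) (ha : a ∈ 𝓕.F 1) (b : A) {n : ℕ} {u : A}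
    (hu : u ∈ 𝓕.F n) : raise c ħ a b u ∈ 𝓕.F (n + 1) := by
  have hb : b ∈ 𝓕.F 0 := by rw [𝓕.zero_eq_top]; trivial
  have h1 : ⁅a, u⁆ ∈ 𝓕.F (n + 1) := by
    rw [Ring.lie_def]
    exact sub_mem (add_comm 1 n ▸ 𝓕.mul_mem ha hu) (𝓕.mul_mem hu ha)
  have h2 : b * u + u * b ∈ 𝓕.F n := by
    have h := 𝓕.mul_mem hb hu
    rw [zero_add] at h
    exact add_mem h (𝓕.mul_mem hu hb)
  rw [raise_apply]
  exact sub_mem (Submodule.smul_mem _ _ h1)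
    (Submodule.smul_mem _ _ (add_comm 1 n ▸ 𝓕.mul_mem hħ h2))

theorem FilteredAlg.le_of_le {A : Type*} [Ring A] [Algebra ℂ A] [Algebra ℂ[X] A]
    (𝓕 : FilteredAlg A) {m n : ℕ} (h : m ≤ n) : 𝓕.F n ≤ 𝓕.F m :=
  antitone_nat_of_succ_le 𝓕.succ_le h

/-! ### The grading of the Yangian -/

section
variable (D : KacMoodyDatum I 𝔥)

theorem toHat_gen (x : Gen I 𝔥 ℕ) :
    toHat D (Yangian.gen D x) = YHat.single D x.deg (Yangian.gen D x) (Yangian.gen_mem D x) :=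
  Yangian.lift_gen D _ _ x

theorem toHat_hbar :
    toHat D (Yangian.hbar D) = YHat.single D 1 (Yangian.hbar D) (Yangian.hbar_mem D) := by
  rw [← YHat.algebraMap_X]
  exact (toHat D).commutes _

/-- A homogeneous element of degree `k` is its own component of degree `k`. -/
theorem toHat_of_mem {k : ℕ} {y : Yangian D} (hy : y ∈ Yangian.grade D k) :
    toHat D y = YHat.single D k y hy := by
  let f : Yangian D →ₐ[ℂ] PowerSeries (Yangian D) :=
    (hatSubalgebra D).val.comp ((toHat D).restrictScalars ℂ)
  have hgen : ∀ x, f (Yangian.gen D x) = PowerSeries.monomial x.deg (Yangian.gen D x) :=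
    fun x => congrArg Subtype.val (toHat_gen D x)
  have hħ : f (Yangian.hbar D) = PowerSeries.monomial 1 (Yangian.hbar D) :=
    congrArg Subtype.val (toHat_hbar D)
  suffices h : f y = PowerSeries.monomial k y from Subtype.ext h
  refine Submodule.span_induction (p := fun y _ => f y = PowerSeries.monomial k y) ?_ ?_ ?_ ?_ hy
  · rintro _ ⟨n, l, rfl, rfl⟩
    clear hy
    have hn : f (Yangian.hbar D ^ n) = PowerSeries.monomial n (Yangian.hbar D ^ n) := by
      rw [map_pow, hħ]
      induction n with
      | zero => simp [PowerSeries.monomial_zero_eq_C_apply]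
      | succ n ih => rw [pow_succ, ih, PowerSeries.monomial_mul_monomial, ← pow_succ]
    have hl : f (l.map (Yangian.gen D)).prod =
        PowerSeries.monomial (l.map Gen.deg).sum (l.map (Yangian.gen D)).prod := by
      induction l with
      | nil => simp [PowerSeries.monomial_zero_eq_C_apply]
      | cons x l ih =>
        simp only [List.map_cons, List.prod_cons, List.sum_cons]
        rw [map_mul, ih, hgen, PowerSeries.monomial_mul_monomial]
    rw [map_mul, hn, hl, PowerSeries.monomial_mul_monomial]
  · simp
  · intro y z _ _ h h'
    rw [map_add, h, h', map_add]
  · intro c y _ h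
    rw [map_smul, h, monomial_csmul]

theorem YHat.coeff_single (k n : ℕ) (y : Yangian D) (hy : y ∈ Yangian.grade D k) :
    YHat.coeff D n (YHat.single D k y hy) = if n = k then y else 0 :=
  PowerSeries.coeff_monomial n k y

theorem coeff_toHat_of_mem {k : ℕ} {y : Yangian D} (hy : y ∈ Yangian.grade D k) (n : ℕ) :
    YHat.coeff D n (toHat D y) = if n = k then y else 0 := by
  rw [toHat_of_mem D hy, YHat.coeff_single]

theorem Yangian.mk_surjective : Function.Surjective (Yangian.mk D) := (yangianCon D).mk'_surjective

/-- A subalgebra over `ℂ` that contains `ħ` and the generators is the whole Yangian. -/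
theorem Yangian.subalgebra_eq_top {S : Subalgebra ℂ (Yangian D)} (hħ : Yangian.hbar D ∈ S)
    (hg : ∀ x, Yangian.gen D x ∈ S) : S = ⊤ := by
  refine eq_top_iff.mpr fun y h => ?_
  obtain ⟨y, rfl⟩ := Yangian.mk_surjective D y
  clear h
  induction y using FreeAlgebra.induction with
  | grade0 p =>
    rw [AlgHom.commutes]
    induction p using Polynomial.induction_on' with
    | add p q hp hq => rw [map_add]; exact S.add_mem hp hq
    | monomial n c =>
      rw [← Polynomial.C_mul_X_pow_eq_monomial, map_mul, map_pow]
      refine S.mul_mem ?_ (S.pow_mem hħ n)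
      have : algebraMap ℂ[X] (Yangian D) (Polynomial.C c) = algebraMap ℂ (Yangian D) c :=
        (IsScalarTower.algebraMap_apply ℂ ℂ[X] (Yangian D) c).symm
      rw [this]
      exact S.algebraMap_mem c
  | grade1 x => exact hg x
  | mul a b ha hb => rw [map_mul]; exact S.mul_mem ha hb
  | add a b ha hb => rw [map_add]; exact S.add_mem ha hb

/-- The Yangian is the direct sum of its homogeneous components: the canonical map to the completion
separates them. -/
theorem Yangian.grade_isInternal : DirectSum.IsInternal (Yangian.grade D) := by
  classical
  constructor
  · refine (injective_iff_map_eq_zero _).mpr fun u hu => ?_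
    refine DFinsupp.ext fun k => Subtype.ext ?_
    have key : ∀ u : ⨁ n, Yangian.grade D n, YHat.coeff D k (toHat D
        (DirectSum.coeAddMonoidHom (Yangian.grade D) u)) = u k := by
      intro u
      induction u using DirectSum.induction_on with
      | zero => simp
      | of n y =>
        rw [DirectSum.coeAddMonoidHom_of, coeff_toHat_of_mem D y.2, DirectSum.coe_of_apply]
        simp only [eq_comm]
        split_ifs <;> rfl
      | add u w hu hw => simp [hu, hw]
    rw [← key, hu]
    simp
  · have h : (DirectSum.coeAlgHom (Yangian.grade D)).range = ⊤ := by
      refine Yangian.subalgebra_eq_top D ?_ fun x => ?_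
      · exact ⟨DirectSum.of (fun n => Yangian.grade D n) 1 ⟨_, Yangian.hbar_mem D⟩,
          DirectSum.coeAlgHom_of _ _ _⟩
      · exact ⟨DirectSum.of (fun n => Yangian.grade D n) x.deg ⟨_, Yangian.gen_mem D x⟩,
          DirectSum.coeAlgHom_of _ _ _⟩
    intro y
    obtain ⟨u, hu⟩ := (h ▸ trivial : y ∈ (DirectSum.coeAlgHom (Yangian.grade D)).range)
    exact ⟨u, hu⟩

instance : GradedAlgebra (Yangian.grade D) where
  toGradedMonoid := Yangian.gradedMonoid D
  toDecomposition := (Yangian.grade_isInternal D).chooseDecomposition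

/-- The homogeneous elements span the Yangian. -/
theorem Yangian.induction_homogeneous {P : Yangian D → Prop} (h0 : P 0)
    (hs : ∀ k, ∀ y ∈ Yangian.grade D k, P y) (hadd : ∀ y z, P y → P z → P (y + z)) (y : Yangian D) :
    P y :=
  DirectSum.Decomposition.inductionOn (Yangian.grade D) h0 (fun y => hs _ y y.2) hadd y

/-- An element of the Yangian is the sum of its homogeneous components, all but finitely many of which
vanish. -/
theorem Yangian.eq_sum_coeff (y : Yangian D) : ∃ N, ∀ M ≥ N,
    y = ∑ k ∈ Finset.range M, YHat.coeff D k (toHat D y) := by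
  induction y using Yangian.induction_homogeneous with
  | h0 => exact ⟨0, by simp⟩
  | hs k y hy =>
    refine ⟨k + 1, fun M hM => ?_⟩
    simp only [coeff_toHat_of_mem D hy]
    rw [Finset.sum_ite_eq', if_pos (by simpa using hM)]
  | hadd y z hy hz =>
    obtain ⟨N, hN⟩ := hy
    obtain ⟨N', hN'⟩ := hz
    refine ⟨max N N', fun M hM => ?_⟩
    simp only [map_add, Finset.sum_add_distrib]
    rw [← hN M (le_of_max_le_left hM), ← hN' M (le_of_max_le_right hM)]

theorem toHat_injective : Function.Injective (toHat D) := by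
  refine (injective_iff_map_eq_zero _).mpr fun y hy => ?_
  obtain ⟨N, hN⟩ := Yangian.eq_sum_coeff D y
  rw [hN N le_rfl, hy]
  simp

/-! ### The powers of `Y_+` -/

theorem Yangian.mem_filt_one_of_grade {k : ℕ} (hk : 0 < k) {y : Yangian D}
    (hy : y ∈ Yangian.grade D k) : y ∈ (yFilt D).F 1 := by
  change y ∈ Yangian.plus D ^ 1
  rw [Submodule.pow_one]
  exact TwoSidedIdeal.mem_asIdeal.mpr (TwoSidedIdeal.subset_span ⟨k, hk, hy⟩)

variable {B : Type*} [Ring B] [Algebra ℂ B] [Algebra ℂ[X] B] [IsScalarTower ℂ ℂ[X] B]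
  (𝓖 : FilteredAlg B) (f : Yangian D →ₐ[ℂ[X]] B)

theorem Yangian.map_gen_mem_filt (h1 : ∀ i, f (Yangian.gen D (.h i 1)) ∈ 𝓖.F 1) (x : Gen I 𝔥 ℕ) :
    f (Yangian.gen D x) ∈ 𝓖.F x.deg := by
  have hx : ∀ ε i r, f (Yangian.gen D (.x ε i r)) ∈ 𝓖.F r := by
    intro ε i r
    induction r with
    | zero => rw [𝓖.zero_eq_top]; trivial
    | succ r ih =>
      rw [(Yangian.gen_isSolution D).x_succ]
      have := map_raise (f.restrictScalars ℂ) (D.weight ε i) (Yangian.hbar D)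
        (Yangian.gen D (.h i 1)) (Yangian.gen D (.h i 0)) (Yangian.gen D (.x ε i r))
      simp only [AlgHom.restrictScalars_apply] at this
      rw [this]
      refine 𝓖.raise_mem _ ?_ (h1 i) _ ih
      rw [Yangian.hbar, f.commutes]
      exact 𝓖.hbar_mem
  cases x with
  | cartan y => change _ ∈ 𝓖.F 0; rw [𝓖.zero_eq_top]; trivial
  | x ε i r => exact hx ε i r
  | h i r =>
    change _ ∈ 𝓖.F r
    rw [(Yangian.gen_isSolution D).h_eq_lie_left, Ring.lie_def, map_sub, map_mul, map_mul]
    have h0 := hx (-1) i 0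
    refine sub_mem (𝓖.mul_mem (hx 1 i r) h0) ?_
    have := 𝓖.mul_mem h0 (hx 1 i r)
    rwa [zero_add] at this

/-- The Yangian is generated in degrees zero and one: a homomorphism that maps each `h_{i1}` to the
first step of a filtration maps the component of degree `k` to the `k`-th step. -/
theorem Yangian.map_mem_filt_of_grade (h1 : ∀ i, f (Yangian.gen D (.h i 1)) ∈ 𝓖.F 1) {k : ℕ}
    {y : Yangian D} (hy : y ∈ Yangian.grade D k) : f y ∈ 𝓖.F k := by
  suffices h : Yangian.grade D k ≤ (𝓖.F k).comap (f.restrictScalars ℂ).toLinearMap from h hy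
  refine Submodule.span_le.mpr ?_
  rintro _ ⟨n, l, rfl, rfl⟩
  change f _ ∈ 𝓖.F _
  rw [map_mul]
  clear hy
  refine 𝓖.mul_mem ?_ ?_
  · induction n with
    | zero => rw [𝓖.zero_eq_top]; trivial
    | succ n ih =>
      rw [pow_succ, map_mul]
      refine 𝓖.mul_mem ih ?_
      rw [Yangian.hbar, f.commutes]
      exact 𝓖.hbar_mem
  · induction l with
    | nil => change _ ∈ 𝓖.F 0; rw [𝓖.zero_eq_top]; trivial
    | cons x l ih =>
      simp only [List.map_cons, List.prod_cons, List.sum_cons, map_mul]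
      exact 𝓖.mul_mem (Yangian.map_gen_mem_filt D 𝓖 f h1 x) ih

theorem Yangian.h_one_mem_filt (i : I) : Yangian.gen D (.h i 1) ∈ (yFilt D).F 1 :=
  Yangian.mem_filt_one_of_grade D one_pos (Yangian.gen_mem D (.h i 1))

theorem Yangian.gen_mem_filt (x : Gen I 𝔥 ℕ) : Yangian.gen D x ∈ (yFilt D).F x.deg :=
  Yangian.map_gen_mem_filt D (yFilt D) (AlgHom.id _ _) (Yangian.h_one_mem_filt D) x

theorem Yangian.grade_le_filt (k : ℕ) : Yangian.grade D k ≤ (yFilt D).F k := fun _ hy =>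
  Yangian.map_mem_filt_of_grade D (yFilt D) (AlgHom.id _ _) (Yangian.h_one_mem_filt D) hy

end

/-- A homomorphism that maps an ideal to the first step of a filtration maps the `n`-th power of the
ideal to the `n`-th step. -/
theorem FilteredAlg.map_pow_mem {A B : Type*} [Ring A] [Ring B] [Algebra ℂ B] [Algebra ℂ[X] B]
    (𝓖 : FilteredAlg B) (f : A →+* B) (J : Ideal A)
    (h : ∀ x ∈ J, f x ∈ 𝓖.F 1) (n : ℕ) : ∀ x ∈ J ^ n, f x ∈ 𝓖.F n := by
  induction n with
  | zero => intro x _; rw [𝓖.zero_eq_top]; trivial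
  | succ n ih =>
    intro x hx
    rw [Submodule.pow_succ] at hx
    refine Submodule.mul_induction_on hx (fun a ha b hb => ?_) fun a b ha hb => ?_
    · rw [map_mul]
      exact 𝓖.mul_mem (ih a ha) (h b hb)
    · rw [map_add]
      exact add_mem ha hb

section
variable (D : KacMoodyDatum I 𝔥)

/-- The component of degree zero, as a homomorphism. -/
def YHat.coeffZero : YHat D →ₐ[ℂ] Yangian D :=
  AlgHom.ofLinearMap (YHat.coeff D 0) (by rw [YHat.coeff_one, if_pos rfl])
    (fun f g => by simp [YHat.coeff_mul])

theorem YHat.mem_filt_one {f : YHat D} : f ∈ (hatFilt D).F 1 ↔ YHat.coeffZero D f = 0 :=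
  ⟨fun h => h 0 one_pos, fun h k hk => by
    obtain rfl : k = 0 := by omega
    exact h⟩

theorem toHat_isFiltered : FilteredAlg.IsFiltered (yFilt D) (hatFilt D) (toHat D) := by
  refine fun n => FilteredAlg.map_pow_mem (hatFilt D) (toHat D : Yangian D →+* YHat D) _ ?_ n
  intro y hy
  rw [YHat.mem_filt_one]
  have h : TwoSidedIdeal.span {y | ∃ k > 0, y ∈ Yangian.grade D k} ≤
      TwoSidedIdeal.ker ((YHat.coeffZero D : YHat D →+* Yangian D).comp
        (toHat D : Yangian D →+* YHat D)) := by
    rw [TwoSidedIdeal.span_le]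
    rintro y ⟨k, hk, hy⟩
    refine (TwoSidedIdeal.mem_ker _).mpr ?_
    exact (coeff_toHat_of_mem D hy 0).trans (if_neg hk.ne)
  have h' := h (TwoSidedIdeal.mem_asIdeal.mp hy)
  have h'' := (TwoSidedIdeal.mem_ker _).mp h'
  exact h''

/-- The ideal `Y_+ ^ n` is the sum of the components of degree at least `n`. -/
theorem Yangian.mem_filt_iff {n : ℕ} {y : Yangian D} :
    y ∈ (yFilt D).F n ↔ toHat D y ∈ (hatFilt D).F n := by
  refine ⟨toHat_isFiltered D n y, fun h => ?_⟩
  obtain ⟨N, hN⟩ := Yangian.eq_sum_coeff D y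
  rw [hN N le_rfl]
  refine Submodule.sum_mem _ fun k _ => ?_
  rcases lt_or_ge k n with hk | hk
  · rw [h k hk]; exact zero_mem _
  · exact (yFilt D).le_of_le hk (Yangian.grade_le_filt D k (YHat.coeff_mem D k _))

/-- An element of `Y_+ ^ n` is congruent modulo `Y_+ ^ (n + 1)` to its component of degree `n`. -/
theorem Yangian.sub_coeff_mem_filt {n : ℕ} {y : Yangian D} (hy : y ∈ (yFilt D).F n) :
    y - YHat.coeff D n (toHat D y) ∈ (yFilt D).F (n + 1) := by
  rw [Yangian.mem_filt_iff] at hy ⊢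
  intro k hk
  rw [map_sub, map_sub, coeff_toHat_of_mem D (YHat.coeff_mem D n _)]
  split_ifs with h
  · rw [h, sub_self]
  · rw [hy k (by omega), sub_zero]

theorem Yangian.eq_zero_of_mem_filt_succ {n : ℕ} {y : Yangian D} (hy : y ∈ Yangian.grade D n)
    (h : y ∈ (yFilt D).F (n + 1)) : y = 0 := by
  rw [Yangian.mem_filt_iff] at h
  rw [← h n n.lt_succ_self, coeff_toHat_of_mem D hy, if_pos rfl]

end

/-! ### The Yangian and its associated graded algebras -/

theorem FilteredAlg.symb_eq {A : Type*} [Ring A] [Algebra ℂ A] [Algebra ℂ[X] A]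
    (𝓕 : FilteredAlg A) {n : ℕ} {x y : 𝓕.F n} (h : (x : A) - y ∈ 𝓕.F (n + 1)) :
    𝓕.symb n x = 𝓕.symb n y :=
  congrArg (DirectSum.lof ℂ ℕ 𝓕.Piece n) (𝓕.cls_eq.mpr h)

theorem FilteredAlg.symb_apply {A : Type*} [Ring A] [Algebra ℂ A] [Algebra ℂ[X] A]
    (𝓕 : FilteredAlg A) (n k : ℕ) (x : 𝓕.F n) (h : n = k) :
    (𝓕.symb n x) k = 𝓕.cls k ⟨x, h ▸ x.2⟩ := by
  subst h
  exact DirectSum.of_eq_same (β := 𝓕.Piece) n _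

theorem FilteredAlg.symb_apply_ne {A : Type*} [Ring A] [Algebra ℂ A] [Algebra ℂ[X] A]
    (𝓕 : FilteredAlg A) (n k : ℕ) (x : 𝓕.F n) (h : n ≠ k) :
    (𝓕.symb n x) k = 0 :=
  DirectSum.of_eq_of_ne (β := 𝓕.Piece) n k _ h.symm

theorem FilteredAlg.cls_eq_zero {A : Type*} [Ring A] [Algebra ℂ A] [Algebra ℂ[X] A]
    (𝓕 : FilteredAlg A) {n : ℕ} {x : 𝓕.F n} : 𝓕.cls n x = 0 ↔ (x : A) ∈ 𝓕.F (n + 1) := by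
  rw [← map_zero (𝓕.cls n), 𝓕.cls_eq]
  simp

/-- The associated graded map is injective if the map is strict: `f x ∈ G (n + 1)` with `x ∈ F n`
only for `x ∈ F (n + 1)`. -/
theorem FilteredAlg.grMap_injective {A B : Type*} [Ring A] [Algebra ℂ A] [Algebra ℂ[X] A]
    [IsScalarTower ℂ ℂ[X] A] [Ring B] [Algebra ℂ B] [Algebra ℂ[X] B] [IsScalarTower ℂ ℂ[X] B]
    (𝓕 : FilteredAlg A) (𝓖 : FilteredAlg B) (f : A →ₐ[ℂ[X]] B) (hf : IsFiltered 𝓕 𝓖 f)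
    (h : ∀ n, ∀ x ∈ 𝓕.F n, f x ∈ 𝓖.F (n + 1) → x ∈ 𝓕.F (n + 1)) :
    Function.Injective (grMap 𝓕 𝓖 f hf) := by
  have key : ∀ (w : 𝓕.Gr) (k : ℕ), grMap 𝓕 𝓖 f hf w k = grMapPiece 𝓕 𝓖 f hf k (w k) := by
    intro w k
    induction w using Gr.induction with
    | h0 => simp
    | hs n x =>
      rw [grMap_symb]
      by_cases hk : n = k
      · rw [symb_apply _ _ _ _ hk, symb_apply _ _ _ _ hk]
        rfl
      · rw [symb_apply_ne _ _ _ _ hk, symb_apply_ne _ _ _ _ hk, map_zero]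
    | hadd a b ha hb =>
      rw [map_add, DirectSum.add_apply, DirectSum.add_apply, ha, hb, map_add]
  refine (injective_iff_map_eq_zero _).mpr fun w hw => DFinsupp.ext fun k => ?_
  obtain ⟨x, hx⟩ := 𝓕.cls_surjective k (w k)
  have h1 := key w k
  rw [hw, ← hx] at h1
  have h2 : 𝓖.cls k ⟨f x, hf k x x.2⟩ = 0 := h1.symm
  rw [cls_eq_zero] at h2
  change w k = 0
  rw [← hx, cls_eq_zero]
  exact h k x x.2 h2

theorem FilteredAlg.grMap_surjective {A B : Type*} [Ring A] [Algebra ℂ A] [Algebra ℂ[X] A]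
    [IsScalarTower ℂ ℂ[X] A] [Ring B] [Algebra ℂ B] [Algebra ℂ[X] B] [IsScalarTower ℂ ℂ[X] B]
    (𝓕 : FilteredAlg A) (𝓖 : FilteredAlg B) (f : A →ₐ[ℂ[X]] B) (hf : IsFiltered 𝓕 𝓖 f)
    (h : ∀ n, ∀ y ∈ 𝓖.F n, ∃ x ∈ 𝓕.F n, y - f x ∈ 𝓖.F (n + 1)) :
    Function.Surjective (grMap 𝓕 𝓖 f hf) := by
  intro w
  induction w using Gr.induction with
  | h0 => exact ⟨0, map_zero _⟩
  | hs n y =>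
    obtain ⟨x, hx, hxy⟩ := h n y y.2
    exact ⟨𝓕.symb n ⟨x, hx⟩, by rw [grMap_symb]; exact (𝓖.symb_eq hxy).symm⟩
  | hadd a b ha hb =>
    obtain ⟨u, rfl⟩ := ha
    obtain ⟨v, rfl⟩ := hb
    exact ⟨u + v, map_add _ _ _⟩

theorem FilteredAlg.grMap_comp {A B C : Type*} [Ring A] [Algebra ℂ A] [Algebra ℂ[X] A]
    [IsScalarTower ℂ ℂ[X] A] [Ring B] [Algebra ℂ B] [Algebra ℂ[X] B] [IsScalarTower ℂ ℂ[X] B]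
    [Ring C] [Algebra ℂ C] [Algebra ℂ[X] C] [IsScalarTower ℂ ℂ[X] C]
    {𝓕 : FilteredAlg A} {𝓖 : FilteredAlg B} {𝓗 : FilteredAlg C}
    {f : A →ₐ[ℂ[X]] B} (hf : IsFiltered 𝓕 𝓖 f) {g : B →ₐ[ℂ[X]] C} (hg : IsFiltered 𝓖 𝓗 g)
    {k : A →ₐ[ℂ[X]] C} (hk : IsFiltered 𝓕 𝓗 k) (h : ∀ x, g (f x) = k x) (w : 𝓕.Gr) :
    grMap 𝓖 𝓗 g hg (grMap 𝓕 𝓖 f hf w) = grMap 𝓕 𝓗 k hk w := by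
  induction w using Gr.induction with
  | h0 => simp
  | hs n x =>
    rw [grMap_symb, grMap_symb, grMap_symb]
    exact 𝓗.symb_congr rfl (h x)
  | hadd a b ha hb => simp only [map_add, ha, hb]

section
variable (D : KacMoodyDatum I 𝔥)

/-- The homomorphism sending `y` of degree `n` to its class in `Y_+ ^ n / Y_+ ^ (n + 1)`, over
`ℂ`. -/
def symbHomℂ : Yangian D →ₐ[ℂ] (yFilt D).Gr :=
  (DirectSum.toAlgebra ℂ (fun n => Yangian.grade D n)
    (fun n => ((yFilt D).symb n).comp (Submodule.inclusion (Yangian.grade_le_filt D n)))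
    ((yFilt D).symb_one) (fun {i j} y z => ((yFilt D).symb_mul (i := i) (j := j)
      ⟨y, Yangian.grade_le_filt D i y.2⟩ ⟨z, Yangian.grade_le_filt D j z.2⟩).symm)).comp
    (DirectSum.decomposeAlgEquiv (Yangian.grade D)).toAlgHom

theorem symbHomℂ_of_mem {n : ℕ} {y : Yangian D} (hy : y ∈ Yangian.grade D n) :
    symbHomℂ D y = (yFilt D).symb n ⟨y, Yangian.grade_le_filt D n hy⟩ := by
  rw [symbHomℂ]
  change DirectSum.toModule ℂ ℕ (yFilt D).Gr
    (fun n => ((yFilt D).symb n).comp (Submodule.inclusion (Yangian.grade_le_filt D n)))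
    (DirectSum.decompose (Yangian.grade D) y) = _
  rw [DirectSum.decompose_of_mem _ hy]
  exact DirectSum.toModule_lof ℂ n _

/-- The homomorphism sending `y` of degree `n` to its class in `Y_+ ^ n / Y_+ ^ (n + 1)`. -/
def symbHom : Yangian D →ₐ[ℂ[X]] (yFilt D).Gr :=
  { (symbHomℂ D : Yangian D →+* (yFilt D).Gr) with
    commutes' := fun p => by
      change symbHomℂ D (algebraMap ℂ[X] (Yangian D) p) = Polynomial.aeval (yFilt D).grHbar p
      have h : algebraMap ℂ[X] (Yangian D) p = Polynomial.aeval (Yangian.hbar D) p := by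
        rw [Yangian.hbar, Polynomial.aeval_algebraMap_apply, Polynomial.aeval_X_left_apply]
      rw [h, ← Polynomial.aeval_algHom_apply, symbHomℂ_of_mem D (Yangian.hbar_mem D)]
      rfl }

theorem symbHom_of_mem {n : ℕ} {y : Yangian D} (hy : y ∈ Yangian.grade D n) :
    symbHom D y = (yFilt D).symb n ⟨y, Yangian.grade_le_filt D n hy⟩ :=
  symbHomℂ_of_mem D hy

/-- The image of `y` has the class of the `k`-th component of `y` as its `k`-th component. -/
theorem symbHom_apply (y : Yangian D) (k : ℕ) : symbHom D y k =
    (yFilt D).cls k ⟨YHat.coeff D k (toHat D y),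
      Yangian.grade_le_filt D k (YHat.coeff_mem D k _)⟩ := by
  induction y using Yangian.induction_homogeneous with
  | h0 =>
    simp only [map_zero]
    exact (map_zero _).symm
  | hs n y hy =>
    rw [symbHom_of_mem D hy]
    by_cases hk : n = k
    · subst hk
      rw [FilteredAlg.symb_apply _ _ _ _ rfl]
      congr 2
      rw [coeff_toHat_of_mem D hy, if_pos rfl]
    · rw [FilteredAlg.symb_apply_ne _ _ _ _ hk, eq_comm, FilteredAlg.cls_eq_zero]
      change YHat.coeff D k (toHat D y) ∈ _
      rw [coeff_toHat_of_mem D hy, if_neg (Ne.symm hk)]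
      exact zero_mem _
  | hadd y z hy hz =>
    rw [map_add, DirectSum.add_apply, hy, hz, ← map_add]
    congr 1
    exact Subtype.ext (by simp)

theorem symbHom_bijective : Function.Bijective (symbHom D) := by
  constructor
  · refine (injective_iff_map_eq_zero _).mpr fun y hy => toHat_injective D ?_
    rw [map_zero]
    refine YHat.ext D fun k => ?_
    rw [map_zero]
    have h := symbHom_apply D y k
    rw [hy, eq_comm] at h
    exact Yangian.eq_zero_of_mem_filt_succ D (YHat.coeff_mem D k _)
      ((yFilt D).cls_eq_zero.mp h)
  · intro w
    induction w using FilteredAlg.Gr.induction with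
    | h0 => exact ⟨0, map_zero _⟩
    | hs n y =>
      refine ⟨YHat.coeff D n (toHat D y), ?_⟩
      rw [symbHom_of_mem D (YHat.coeff_mem D n _)]
      exact ((yFilt D).symb_eq (Yangian.sub_coeff_mem_filt D y.2)).symm
    | hadd a b ha hb =>
      obtain ⟨u, rfl⟩ := ha
      obtain ⟨v, rfl⟩ := hb
      exact ⟨u + v, map_add _ _ _⟩

theorem grMap_toHat_bijective : Function.Bijective
    (FilteredAlg.grMap (yFilt D) (hatFilt D) (toHat D) (toHat_isFiltered D)) := by
  refine ⟨FilteredAlg.grMap_injective _ _ _ _ fun n y _ h => (Yangian.mem_filt_iff D).mpr h,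
    FilteredAlg.grMap_surjective _ _ _ _ fun n f hf => ?_⟩
  refine ⟨YHat.coeff D n f, Yangian.grade_le_filt D n (YHat.coeff_mem D n f), fun k hk => ?_⟩
  rw [map_sub, coeff_toHat_of_mem D (YHat.coeff_mem D n f)]
  split_ifs with h
  · rw [h, sub_self]
  · rw [hf k (by omega), sub_zero]

end

/-! ### Solutions with integral modes from nilpotent solutions with natural modes -/

section
variable {R : Type*} [Ring R] [Algebra ℂ R]

theorem polyEval_lie (b : ℂ) (y z w : ℕ → R)
    (h : ∀ r s : ℕ, ⁅y r, z s⁆ = b • w (r + s)) (p q : ℂ[X]) :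
    ⁅polyEval y p, polyEval z q⁆ = b • polyEval w (p * q) := by
  let C : R →ₗ[ℂ] R →ₗ[ℂ] R := LinearMap.mul ℂ R - (LinearMap.mul ℂ R).flip
  let B : ℂ[X] →ₗ[ℂ] ℂ[X] →ₗ[ℂ] R :=
    C.compl₁₂ (polyEval y) (polyEval z) - (LinearMap.mul ℂ ℂ[X]).compr₂ (b • polyEval w)
  have hB : ∀ p q, B p q = ⁅polyEval y p, polyEval z q⁆ - b • polyEval w (p * q) := fun p q => rfl
  have : B = 0 := poly_bilin B fun r s => by
    rw [hB, ← pow_add]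
    simp only [polyEval_X_pow]
    rw [h, sub_self]
  rw [← sub_eq_zero, ← hB, this]
  rfl

theorem polyEval_lie_left (b : ℂ) (u : R) (z : ℕ → R) (h : ∀ s : ℕ, ⁅u, z s⁆ = b • z s) (q : ℂ[X]) :
    ⁅u, polyEval z q⁆ = b • polyEval z q := by
  induction q using Polynomial.induction_on' with
  | add p q hp hq =>
    rw [Ring.lie_def] at hp hq ⊢
    rw [map_add, mul_add, add_mul, smul_add, ← hp, ← hq]
    abel
  | monomial n c =>
    rw [polyEval_monomial, Ring.lie_def, mul_smul_comm, smul_mul_assoc, ← smul_sub, ← Ring.lie_def,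
      h, smul_comm]

theorem polyEval_eq_sum (y : ℕ → R) {N : ℕ} (hy : ∀ n, N ≤ n → y n = 0) (p : ℂ[X]) :
    polyEval y p = ∑ n ∈ Finset.range N, p.coeff n • y n := by
  induction p using Polynomial.induction_on' with
  | add p q hp hq => simp only [map_add, hp, hq, Polynomial.coeff_add, add_smul, Finset.sum_add_distrib]
  | monomial n c =>
    simp only [polyEval_monomial, Polynomial.coeff_monomial, ite_smul, zero_smul]
    rw [Finset.sum_ite_eq]
    split_ifs with h
    · rfl
    · rw [hy n (by simpa using h), smul_zero]

theorem polyEval_congr (y : ℕ → R) {N : ℕ} (hy : ∀ n, N ≤ n → y n = 0) {p q : ℂ[X]}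
    (h : ∀ n < N, p.coeff n = q.coeff n) : polyEval y p = polyEval y q := by
  rw [polyEval_eq_sum y hy, polyEval_eq_sum y hy]
  exact Finset.sum_congr rfl fun n hn => by rw [h n (Finset.mem_range.mp hn)]

end

/-- The polynomial `∑_{n < N} (r choose n) X ^ n`, which is `(1 + X) ^ r` modulo `X ^ N`. -/
def binomialTrunc (N : ℕ) (r : ℤ) : ℂ[X] := PowerSeries.trunc N (PowerSeries.binomialSeries ℂ r)

theorem coeff_binomialTrunc {N n : ℕ} (h : n < N) (r : ℤ) :
    (binomialTrunc N r).coeff n = ((Ring.choose r n : ℤ) : ℂ) := by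
  rw [binomialTrunc, PowerSeries.coeff_trunc, if_pos h, PowerSeries.binomialSeries_coeff]
  simp

theorem coeff_binomialTrunc_zero {N n : ℕ} (h : n < N) :
    (binomialTrunc N 0).coeff n = (1 : ℂ[X]).coeff n := by
  rw [coeff_binomialTrunc h, Ring.choose_zero_ite, Polynomial.coeff_one]
  split_ifs <;> simp

theorem coeff_binomialTrunc_add {N n : ℕ} (h : n < N) (r s : ℤ) :
    (binomialTrunc N (r + s)).coeff n = (binomialTrunc N r * binomialTrunc N s).coeff n := by
  rw [binomialTrunc, PowerSeries.coeff_trunc, if_pos h, PowerSeries.binomialSeries_add,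
    PowerSeries.coeff_mul_eq_coeff_trunc_mul_trunc _ _ h, ← Polynomial.coe_mul, Polynomial.coeff_coe]
  rfl

theorem coeff_binomialTrunc_succ {N n : ℕ} (h : n < N) (r : ℤ) :
    (binomialTrunc N (r + 1)).coeff n =
      (Polynomial.X * binomialTrunc N r + binomialTrunc N r).coeff n := by
  rw [coeff_binomialTrunc h, Polynomial.coeff_add, coeff_binomialTrunc h]
  cases n with
  | zero => simp
  | succ n =>
    rw [Polynomial.coeff_X_mul, coeff_binomialTrunc (by omega), Ring.choose_succ_succ]
    push_cast
    rfl

section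
variable {R : Type*} [Ring R] [Algebra ℂ R]

/-- The values `x_{ir} ↦ ∑_{n < N} (r choose n) x_{in}` and likewise for `h_{ir}`, with `r ∈ ℤ`. -/
def binomialGen (N : ℕ) (g : Gen I 𝔥 ℕ → R) : Gen I 𝔥 ℤ → R
  | .cartan y => g (.cartan y)
  | .x ε i r => polyEval (fun n => g (.x ε i n)) (binomialTrunc N r)
  | .h i r => polyEval (fun n => g (.h i n)) (binomialTrunc N r)

theorem polyEval_binomialTrunc_exchange (ħ : R) (c : ℂ) (y z : ℕ → R) {N : ℕ}
    (hy : ∀ n, N ≤ n → y n = 0) (hz : ∀ n, N ≤ n → z n = 0)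
    (h : ∀ r s : ℕ, ⁅y (r + 1), z s⁆ - ⁅y r, z (s + 1)⁆ = c • (ħ * (y r * z s + z s * y r)))
    (r s : ℤ) :
    ⁅polyEval y (binomialTrunc N (r + 1)), polyEval z (binomialTrunc N s)⁆ -
        ⁅polyEval y (binomialTrunc N r), polyEval z (binomialTrunc N (s + 1))⁆ =
      c • (ħ * (polyEval y (binomialTrunc N r) * polyEval z (binomialTrunc N s) +
        polyEval z (binomialTrunc N s) * polyEval y (binomialTrunc N r))) := by
  rw [← poly_exchange ħ c y z h, polyEval_congr y hy fun n hn => coeff_binomialTrunc_succ hn r,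
    polyEval_congr z hz fun n hn => coeff_binomialTrunc_succ hn s, map_add, map_add]
  simp only [Ring.lie_def, add_mul, mul_add]
  abel

/-- If all `x_{in}`, `h_{in}` with `n ≥ N` vanish, a solution with modes in `ℕ` extends to one with
modes in `ℤ`, because `1 + X` is invertible modulo `X ^ N`. -/
theorem IsSolution.binomial {D : KacMoodyDatum I 𝔥} {ħ : R} {g : Gen I 𝔥 ℕ → R}
    (hg : IsSolution D ħ g) (N : ℕ) (hx : ∀ ε i n, N ≤ n → g (.x ε i n) = 0)
    (hh : ∀ i n, N ≤ n → g (.h i n) = 0) : IsSolution D ħ (binomialGen N g) := by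
  intro a b h
  cases h with
  | cartan_add h h' => have := hg _ _ (DefRel.cartan_add h h'); exact this
  | cartan_smul c h => have := hg _ _ (DefRel.cartan_smul c h); exact this
  | h_zero i =>
    have := hg _ _ (DefRel.h_zero i)
    simp only [binomialGen]
    rw [polyEval_congr _ (hh i) fun n hn => coeff_binomialTrunc_zero hn,
      ← pow_zero Polynomial.X, polyEval_X_pow]
    exact this
  | h_h i j r s =>
    have := polyEval_lie 0 (fun k => g (.h i k)) (fun k => g (.h j k)) 0
      (fun r s => by rw [zero_smul]; exact hg _ _ (DefRel.h_h i j r s))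
    simp only [zero_smul] at this
    exact this _ _
  | h_cartan i r h =>
    have := polyEval_lie_left 0 (g (.cartan h)) (fun k => g (.h i k))
      (fun s => by
        have := hg _ _ (DefRel.h_cartan i s h)
        rw [Ring.lie_def, sub_eq_zero] at this
        rw [zero_smul, Ring.lie_def, this, sub_self]) (binomialTrunc N r)
    rw [zero_smul, Ring.lie_def, sub_eq_zero] at this
    simp only [binomialGen]
    rw [Ring.lie_def, this, sub_self]
  | cartan_cartan h h' => have := hg _ _ (DefRel.cartan_cartan h h'); exact this
  | cartan_x ε h j s =>
    exact polyEval_lie_left _ (g (.cartan h)) (fun k => g (.x ε j k))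
      (fun s => hg _ _ (DefRel.cartan_x ε h j s)) _
  | x_x_same i r s =>
    have := polyEval_lie 1 (fun k => g (.x 1 i k)) (fun k => g (.x (-1) i k))
      (fun k => g (.h i k)) (fun r s => by rw [one_smul]; exact hg _ _ (DefRel.x_x_same i r s))
      (binomialTrunc N r) (binomialTrunc N s)
    rw [one_smul, ← polyEval_congr _ (hh i) fun n hn => coeff_binomialTrunc_add hn r s] at this
    exact this
  | x_x_ne i j hij r s =>
    have := polyEval_lie 0 (fun k => g (.x 1 i k)) (fun k => g (.x (-1) j k)) 0
      (fun r s => by rw [zero_smul]; exact hg _ _ (DefRel.x_x_ne i j hij r s))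
    simp only [zero_smul] at this
    exact this _ _
  | h_x ε i j r s =>
    exact polyEval_binomialTrunc_exchange ħ _ (fun k => g (.h i k)) (fun k => g (.x ε j k))
      (hh i) (hx ε j) (fun r s => hg _ _ (DefRel.h_x ε i j r s)) r s
  | x_x ε i j r s =>
    exact polyEval_binomialTrunc_exchange ħ _ (fun k => g (.x ε i k)) (fun k => g (.x ε j k))
      (hx ε i) (hx ε j) (fun r s => hg _ _ (DefRel.x_x ε i j r s)) r s
  | serre ε i j hij r s =>
    exact poly_serre (D.serreDeg i j) (fun k => g (.x ε i k)) (fun k => g (.x ε j k))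
      (fun r s => hg _ _ (DefRel.serre ε i j hij r s)) (fun k => binomialTrunc N (r k))
      (binomialTrunc N s)

end

/-! ### The homomorphism from the double to the completed Yangian -/

/-- The two-sided ideal `F n` of a filtered algebra. -/
def FilteredAlg.ideal {A : Type*} [Ring A] [Algebra ℂ A] [Algebra ℂ[X] A] (𝓕 : FilteredAlg A)
    (n : ℕ) : Ideal A where
  carrier := 𝓕.F n
  add_mem' := fun ha hb => add_mem ha hb
  zero_mem' := zero_mem _
  smul_mem' := fun c x hx => by
    have hc : c ∈ 𝓕.F 0 := by rw [𝓕.zero_eq_top]; trivial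
    have := 𝓕.mul_mem hc hx
    rwa [zero_add] at this

instance {A : Type*} [Ring A] [Algebra ℂ A] [Algebra ℂ[X] A] (𝓕 : FilteredAlg A) (n : ℕ) :
    (𝓕.ideal n).IsTwoSided := ⟨fun {a} b ha => by
  have hb : b ∈ 𝓕.F 0 := by rw [𝓕.zero_eq_top]; trivial
  exact 𝓕.mul_mem ha hb⟩

section
variable (D : KacMoodyDatum I 𝔥)

theorem YHat.eq_of_forall_sub_mem {f g : YHat D} (h : ∀ n, f - g ∈ (hatFilt D).F n) : f = g := by
  refine YHat.ext D fun k => ?_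
  have := h (k + 1) k k.lt_succ_self
  rwa [map_sub, sub_eq_zero] at this

/-- The element `ħ` of the completion. -/
def YHat.hbar : YHat D := YHat.single D 1 (Yangian.hbar D) (Yangian.hbar_mem D)

theorem YHat.hbar_mem_filt : YHat.hbar D ∈ (hatFilt D).F 1 := by
  have := (hatFilt D).hbar_mem
  rwa [YHat.algebraMap_X] at this

theorem toHat_gen_isSolution : IsSolution D (YHat.hbar D) (toHat D ∘ Yangian.gen D) := by
  intro a b h
  obtain ⟨a', b', h', rfl, rfl⟩ := h.exists_preimage ((toHat D).restrictScalars ℂ)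
    (ħ := Yangian.hbar D) (g := Yangian.gen D) (toHat_hbar D) (fun x => rfl)
  rw [Yangian.gen_isSolution D _ _ h']

/-- Modulo degree `N`, the series `∑ (r choose n) y_n` is its truncation. -/
theorem phiSeq_sub_mem (y : ℕ → Yangian D) (hy : ∀ n, y n ∈ Yangian.grade D n) (r : ℤ) (N : ℕ) :
    phiSeq D y hy r - ∑ n ∈ Finset.range N, ((Ring.choose r n : ℤ) : ℂ) • toHat D (y n) ∈
      (hatFilt D).F N := by
  intro k hk
  rw [map_sub, map_sum, phiSeq, YHat.coeff_mk]
  simp only [map_smul, coeff_toHat_of_mem D (hy _), smul_ite, smul_zero]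
  rw [Finset.sum_ite_eq, if_pos (by simpa using hk), sub_self]

/-- The binomial series satisfy the relations of the double: modulo each step of the filtration of the
completion all but finitely many modes vanish. -/
theorem phiGen_isSolution : IsSolution D (YHat.hbar D) (phiGen D) := by
  intro a b h
  refine YHat.eq_of_forall_sub_mem D fun N => ?_
  let π : YHat D →ₐ[ℂ] YHat D ⧸ (hatFilt D).ideal N := Ideal.Quotient.mkₐ ℂ _
  have hπ : ∀ f g, π f = π g ↔ f - g ∈ (hatFilt D).F N := fun f g => Ideal.Quotient.eq
  have hsol : IsSolution D (π (YHat.hbar D)) (π ∘ toHat D ∘ Yangian.gen D) := by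
    intro a b h
    obtain ⟨a', b', h', rfl, rfl⟩ := h.exists_preimage π (g := toHat D ∘ Yangian.gen D) rfl
      (fun x => rfl)
    rw [toHat_gen_isSolution D _ _ h']
  have hzero : ∀ x : Gen I 𝔥 ℕ, N ≤ x.deg → (π ∘ toHat D ∘ Yangian.gen D) x = 0 := by
    intro x hx
    rw [← map_zero π]
    refine (hπ _ _).mpr ?_
    rw [sub_zero]
    exact (hatFilt D).le_of_le hx (toHat_isFiltered D _ _ (Yangian.gen_mem_filt D x))
  have hx : ∀ ε i n, N ≤ n → (π ∘ toHat D ∘ Yangian.gen D) (.x ε i n) = 0 :=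
    fun ε i n hn => hzero _ hn
  have hh : ∀ i n, N ≤ n → (π ∘ toHat D ∘ Yangian.gen D) (.h i n) = 0 := fun i n hn => hzero _ hn
  have hseq : ∀ (y : ℕ → Yangian D) (hy : ∀ n, y n ∈ Yangian.grade D n)
      (hy' : ∀ n, N ≤ n → π (toHat D (y n)) = 0) (r : ℤ),
      π (phiSeq D y hy r) = polyEval (fun n => π (toHat D (y n))) (binomialTrunc N r) := by
    intro y hy hy' r
    rw [(hπ _ _).mpr (phiSeq_sub_mem D y hy r N), polyEval_eq_sum _ hy', map_sum]
    refine Finset.sum_congr rfl fun n hn => ?_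
    rw [map_smul, coeff_binomialTrunc (Finset.mem_range.mp hn)]
  -- the truncated values satisfy the relations because the modes at least `N` vanish in the quotient
  refine (hπ _ _).mp (hsol.binomial N hx hh _ _ (h.map π rfl fun x => ?_))
  cases x with
  | cartan y => rfl
  | x ε i r => exact hseq _ (fun n => Yangian.gen_mem D (.x ε i n)) (hx ε i) r
  | h i r => exact hseq _ (fun n => Yangian.gen_mem D (.h i n)) (hh i) r

end

open Finset.HasAntidiagonal in
/-- A sum over the decompositions `k = n₁ + m₁ + n₂ + m₂` is unchanged when `m₁` and `n₂` are
swapped. -/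
theorem sum_antidiagonal_middle_swap {M : Type*} [AddCommMonoid M] (F : ℕ → ℕ → ℕ → ℕ → M) (k : ℕ) :
    ∑ p ∈ antidiagonal k, ∑ q ∈ antidiagonal p.1, ∑ r ∈ antidiagonal p.2, F q.1 q.2 r.1 r.2 =
      ∑ p ∈ antidiagonal k, ∑ q ∈ antidiagonal p.1, ∑ r ∈ antidiagonal p.2, F q.1 r.1 q.2 r.2 := by
  simp only [Finset.sum_sigma']
  refine Finset.sum_nbij'
    (fun u => ⟨(u.2.1.1 + u.2.2.1, u.2.1.2 + u.2.2.2), (u.2.1.1, u.2.2.1), (u.2.1.2, u.2.2.2)⟩)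
    (fun u => ⟨(u.2.1.1 + u.2.2.1, u.2.1.2 + u.2.2.2), (u.2.1.1, u.2.2.1), (u.2.1.2, u.2.2.2)⟩)
    ?_ ?_ ?_ ?_ ?_
  all_goals
    rintro ⟨⟨p₁, p₂⟩, ⟨q₁, q₂⟩, r₁, r₂⟩ h
    simp only [Finset.mem_sigma, mem_antidiagonal] at h
    obtain ⟨rfl, rfl, rfl⟩ := h
    first
      | rfl
      | simp only [Finset.mem_sigma, mem_antidiagonal]
        exact ⟨by ring, trivial, trivial⟩

section
variable (D : KacMoodyDatum I 𝔥) {F : Type*} [Ring F] [Algebra ℂ F] (φ : F →ₐ[ℂ] YHat D)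

/-- The element `∑ ħ ^ n φ(a_n)` of the completion. -/
def YHat.evalSeriesFun (a : PowerSeries F) : YHat D :=
  YHat.mk D
    (fun k => ∑ p ∈ Finset.HasAntidiagonal.antidiagonal k,
      Yangian.hbar D ^ p.1 * YHat.coeff D p.2 (φ (PowerSeries.coeff p.1 a)))
    (fun k => Submodule.sum_mem _ fun p hp => by
      rw [← Finset.HasAntidiagonal.mem_antidiagonal.mp hp]
      refine SetLike.mul_mem_graded ?_ (YHat.coeff_mem D _ _)
      simpa using Yangian.smul_hbar_pow_mem D 1 p.1)

theorem YHat.coeff_evalSeriesFun (a : PowerSeries F) (k : ℕ) :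
    YHat.coeff D k (YHat.evalSeriesFun D φ a) = ∑ p ∈ Finset.HasAntidiagonal.antidiagonal k,
      Yangian.hbar D ^ p.1 * YHat.coeff D p.2 (φ (PowerSeries.coeff p.1 a)) :=
  YHat.coeff_mk D _ _ k

theorem YHat.evalSeriesFun_monomial (n : ℕ) (x : F) :
    YHat.evalSeriesFun D φ (PowerSeries.monomial n x) = YHat.hbar D ^ n * φ x := by
  have hpow : YHat.hbar D ^ n = YHat.ofSeries D (PowerSeries.X ^ n) := by
    rw [map_pow]
    congr 1
    refine YHat.ext D fun k => ?_
    rw [YHat.hbar, YHat.coeff_single, YHat.coeff_ofSeries, PowerSeries.coeff_X]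
    split_ifs with h <;> simp [h]
  refine YHat.ext D fun k => ?_
  rw [YHat.coeff_evalSeriesFun, YHat.coeff_mul]
  refine Finset.sum_congr rfl fun p _ => ?_
  rw [hpow, YHat.coeff_ofSeries, PowerSeries.coeff_X_pow, PowerSeries.coeff_monomial]
  split_ifs <;> simp

theorem YHat.evalSeriesFun_mul (a b : PowerSeries F) :
    YHat.evalSeriesFun D φ (a * b) = YHat.evalSeriesFun D φ a * YHat.evalSeriesFun D φ b := by
  have hcomm : ∀ (m n : ℕ) (y z : Yangian D), Yangian.hbar D ^ m * y * (Yangian.hbar D ^ n * z) =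
      Yangian.hbar D ^ (m + n) * (y * z) := by
    intro m n y z
    rw [mul_assoc, ← mul_assoc y, ← ((Yangian.hbar_commute D y).pow_left n).eq, pow_add]
    simp only [mul_assoc]
  refine YHat.ext D fun k => ?_
  rw [YHat.coeff_mul]
  simp only [YHat.coeff_evalSeriesFun, Finset.sum_mul_sum, hcomm]
  rw [sum_antidiagonal_middle_swap fun n₁ m₁ n₂ m₂ => Yangian.hbar D ^ (n₁ + n₂) *
    (YHat.coeff D m₁ (φ (PowerSeries.coeff n₁ a)) * YHat.coeff D m₂ (φ (PowerSeries.coeff n₂ b)))]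
  refine Finset.sum_congr rfl fun p _ => ?_
  rw [PowerSeries.coeff_mul, map_sum, map_sum, Finset.mul_sum]
  refine Finset.sum_congr rfl fun q hq => ?_
  rw [map_mul, YHat.coeff_mul, Finset.mul_sum, Finset.HasAntidiagonal.mem_antidiagonal.mp hq]

/-- The extension `∑ ħ ^ n a_n ↦ ∑ ħ ^ n φ(a_n)` of a homomorphism to formal power series; the sum
makes sense because `ħ` has positive degree. -/
def YHat.evalSeries : PowerSeries F →ₐ[ℂ] YHat D :=
  AlgHom.ofLinearMap
    { toFun := YHat.evalSeriesFun D φ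
      map_add' := fun a b => YHat.ext D fun k => by
        simp only [YHat.coeff_evalSeriesFun, map_add, mul_add, Finset.sum_add_distrib]
      map_smul' := fun c a => YHat.ext D fun k => by
        simp only [YHat.coeff_evalSeriesFun, map_smul, PowerSeries.coeff_smul, mul_smul_comm,
          Finset.smul_sum, RingHom.id_apply] }
    (by
      have := YHat.evalSeriesFun_monomial D φ 0 1
      rw [pow_zero, map_one φ, one_mul, PowerSeries.monomial_zero_eq_C_apply,
        map_one PowerSeries.C] at this
      exact this)
    (YHat.evalSeriesFun_mul D φ)

theorem YHat.evalSeries_C (x : F) : YHat.evalSeries D φ (PowerSeries.C x) = φ x := by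
  have := YHat.evalSeriesFun_monomial D φ 0 x
  rw [pow_zero, one_mul, PowerSeries.monomial_zero_eq_C_apply] at this
  exact this

theorem YHat.evalSeries_X : YHat.evalSeries D φ PowerSeries.X = YHat.hbar D := by
  have := YHat.evalSeriesFun_monomial D φ 1 1
  rw [pow_one, map_one φ, mul_one] at this
  exact this

theorem YHat.evalSeries_map (f : PowerSeries ℂ) :
    YHat.evalSeries D φ (PowerSeries.map (algebraMap ℂ F) f) = YHat.ofSeries D f := by
  refine YHat.ext D fun k => ?_
  change YHat.coeff D k (YHat.evalSeriesFun D φ _) = _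
  rw [YHat.coeff_evalSeriesFun, YHat.coeff_ofSeries, Finset.sum_eq_single (k, 0)]
  · rw [PowerSeries.coeff_map, AlgHom.commutes, Algebra.algebraMap_eq_smul_one, map_smul,
      YHat.coeff_one, if_pos rfl, mul_smul_comm, mul_one]
  · rintro ⟨i, j⟩ hp hne
    have hj : j ≠ 0 := by
      rintro rfl
      simp_all
    rw [PowerSeries.coeff_map, AlgHom.commutes, Algebra.algebraMap_eq_smul_one, map_smul,
      YHat.coeff_one, if_neg hj, smul_zero, mul_zero]
  · simp

end

section
variable (D : KacMoodyDatum I 𝔥)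

/-- The homomorphism `Φ`, over `ℂ`. -/
def phiℂ : DY D →ₐ[ℂ] YHat D :=
  (dCon D).liftₐ (YHat.evalSeries D (FreeAlgebra.lift ℂ (phiGen D))) (by
    intro a b h
    refine YHat.eq_of_forall_sub_mem D fun N => ?_
    let π : YHat D →ₐ[ℂ] YHat D ⧸ (hatFilt D).ideal N := Ideal.Quotient.mkₐ ℂ _
    have hπ : ∀ f g, π f = π g ↔ f - g ∈ (hatFilt D).F N := fun f g => Ideal.Quotient.eq
    refine (hπ _ _).mp ?_
    have hle : dCon D ≤ RingCon.ker ((π.comp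
        (YHat.evalSeries D (FreeAlgebra.lift ℂ (phiGen D)))).toRingHom) := by
      refine (iInf_le _ N).trans (RingCon.ringConGen_le.mpr ?_)
      rintro a b (h | ⟨rfl, rfl⟩)
      · refine congrArg π (phiGen_isSolution D _ _ (h.map _ (YHat.evalSeries_X D _) fun x => ?_))
        rw [YHat.evalSeries_C, FreeAlgebra.lift_ι_apply]
      · refine (hπ _ _).mpr ?_
        change YHat.evalSeries D (FreeAlgebra.lift ℂ (phiGen D)) _ -
          YHat.evalSeries D (FreeAlgebra.lift ℂ (phiGen D)) _ ∈ _
        rw [map_pow, YHat.evalSeries_X, map_zero, sub_zero]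
        clear π hπ h
        induction N with
        | zero => rw [(hatFilt D).zero_eq_top]; trivial
        | succ n ih => rw [pow_succ]; exact (hatFilt D).mul_mem ih (YHat.hbar_mem_filt D)
    exact hle h)

/-- The homomorphism `Φ` from the Yangian double to the completed Yangian. -/
def phi : DY D →ₐ[ℂ⟦X⟧] YHat D :=
  { (phiℂ D : DY D →+* YHat D) with
    commutes' := fun f => YHat.evalSeries_map D _ f }

theorem phi_gen (x : Gen I 𝔥 ℤ) : phi D (DY.gen D x) = phiGen D x := by
  change YHat.evalSeries D (FreeAlgebra.lift ℂ (phiGen D)) (PowerSeries.C _) = _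
  rw [YHat.evalSeries_C, FreeAlgebra.lift_ι_apply]

theorem Yangian.algHom_ext {B : Type*} [Ring B] [Algebra ℂ[X] B] {f g : Yangian D →ₐ[ℂ[X]] B}
    (h : ∀ x, f (Yangian.gen D x) = g (Yangian.gen D x)) : f = g := by
  have : f.comp (Yangian.mk D) = g.comp (Yangian.mk D) := FreeAlgebra.hom_ext (funext h)
  refine AlgHom.ext fun y => ?_
  obtain ⟨y, rfl⟩ := Yangian.mk_surjective D y
  exact DFunLike.congr_fun this y

theorem iota_gen (x : Gen I 𝔥 ℕ) : iota D (Yangian.gen D x) = DY.gen D x.ofNat :=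
  Yangian.lift_gen D _ _ x

theorem tau_gen (c : ℂ) (x : Gen I 𝔥 ℕ) :
    tau D c (Yangian.gen D x) = shiftGen c (Yangian.gen D) x :=
  Yangian.lift_gen D _ _ x

theorem phiSeq_natCast (y : ℕ → Yangian D) (hy : ∀ n, y n ∈ Yangian.grade D n) (r : ℕ) :
    phiSeq D y hy r = toHat D (shiftSeq 1 y r) := by
  refine YHat.ext D fun k => ?_
  rw [phiSeq, YHat.coeff_mk, shiftSeq, map_sum, map_sum]
  have hs : ∀ (c : ℂ) (z : Yangian D), toHat D (c • z) = c • toHat D z :=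
    map_smul ((toHat D).restrictScalars ℂ)
  simp only [hs, map_smul, coeff_toHat_of_mem D (hy _), smul_ite, smul_zero, Ring.choose_natCast]
  rw [Finset.sum_ite_eq]
  split_ifs with h
  · simp
  · rw [Nat.choose_eq_zero_of_lt (by simpa using h)]
    simp

theorem phi_iota (y : Yangian D) : phi D (iota D y) = toHat D (tau D 1 y) := by
  have : ((phi D).restrictScalars ℂ[X]).comp (iota D) = (toHat D).comp (tau D 1) := by
    refine Yangian.algHom_ext D fun x => ?_
    change phi D (iota D _) = toHat D (tau D 1 _)
    rw [iota_gen, phi_gen, tau_gen]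
    cases x with
    | cartan y => rfl
    | x ε i r => exact phiSeq_natCast D _ (fun n => Yangian.gen_mem D (.x ε i n)) r
    | h i r => exact phiSeq_natCast D _ (fun n => Yangian.gen_mem D (.h i n)) r
  exact DFunLike.congr_fun this y

/-! ### Uniqueness of the homomorphism -/

theorem algHom_hbar (f : DY D →ₐ[ℂ⟦X⟧] YHat D) : f (DY.hbar D) = YHat.hbar D := by
  rw [← DY.algebraMap_X]
  exact ((f.restrictScalars ℂ[X]).commutes _).trans (YHat.algebraMap_X D)

/-- Modulo `ħ` the Yangian double is generated by the elements `DY.gen`. -/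
theorem DY.exists_eq_add_hbar_mul (S : Subalgebra ℂ (DY D)) (hg : ∀ x, DY.gen D x ∈ S)
    (y : DY D) : ∃ z ∈ S, ∃ w, y = z + DY.hbar D * w := by
  obtain ⟨a, rfl⟩ := DY.mk_surjective D y
  have h : PowerSeries.X ∣ a - PowerSeries.C (PowerSeries.coeff 0 a) := by
    rw [PowerSeries.X_dvd_iff]
    simp
  obtain ⟨b, hb⟩ := h
  rw [sub_eq_iff_eq_add'] at hb
  refine ⟨DY.mk D (PowerSeries.C (PowerSeries.coeff 0 a)), ?_, DY.mk D b, ?_⟩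
  · generalize PowerSeries.coeff 0 a = u
    induction u using FreeAlgebra.induction with
    | grade0 c =>
      have : DY.mk D (PowerSeries.C (algebraMap ℂ (FreeAlgebra ℂ (Gen I 𝔥 ℤ)) c)) =
        algebraMap ℂ (DY D) c := by
        rw [← (DY.mk D).commutes c, PowerSeries.algebraMap_apply]
      rw [this]
      exact S.algebraMap_mem c
    | grade1 x => exact hg x
    | mul a b ha hb => rw [map_mul, map_mul]; exact S.mul_mem ha hb
    | add a b ha hb => rw [map_add, map_add]; exact S.add_mem ha hb
  · conv_lhs => rw [hb]
    rw [map_add, map_mul]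
    rfl

theorem phi_unique_of_gen {f g : DY D →ₐ[ℂ⟦X⟧] YHat D} (h : ∀ x, f (DY.gen D x) = g (DY.gen D x)) :
    f = g := by
  refine AlgHom.ext fun y => YHat.eq_of_forall_sub_mem D fun N => ?_
  induction N generalizing y with
  | zero => rw [(hatFilt D).zero_eq_top]; trivial
  | succ N ih =>
    obtain ⟨z, hz, w, rfl⟩ := DY.exists_eq_add_hbar_mul D
      (AlgHom.equalizer (f.restrictScalars ℂ) (g.restrictScalars ℂ)) h y
    have hz' : f z = g z := hz
    have := (hatFilt D).mul_mem (YHat.hbar_mem_filt D) (ih w)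
    rw [map_add, map_add, map_mul, map_mul, hz', algHom_hbar, algHom_hbar, add_sub_add_left_eq_sub,
      ← mul_sub, add_comm N 1]
    exact this

/-- A homomorphism from the double to the completed Yangian is determined by its values on the
modes in `ℕ`: the difference `u` of two candidates for the value at `x_{is}` satisfies
`u = - S u`, where the raising operator `S` increases the filtration degree. -/
theorem phi_unique (f : DY D →ₐ[ℂ⟦X⟧] YHat D) (hf : ∀ y, f (iota D y) = toHat D (tau D 1 y)) :
    f = phi D := by
  have hnat : ∀ x : Gen I 𝔥 ℕ, f (DY.gen D x.ofNat) = phi D (DY.gen D x.ofNat) := by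
    intro x
    rw [← iota_gen, hf, phi_iota]
  have hx : ∀ ε i (s : ℤ), f (DY.gen D (.x ε i s)) = phi D (DY.gen D (.x ε i s)) := by
    intro ε i s
    have h1 : f (DY.gen D (.h i 1)) = phi D (DY.gen D (.h i 1)) := hnat (.h i 1)
    have h0 : f (DY.gen D (.h i 0)) = phi D (DY.gen D (.h i 0)) := hnat (.h i 0)
    have hmem : phi D (DY.gen D (.h i 1)) - phi D (DY.gen D (.h i 0)) ∈ (hatFilt D).F 1 := by
      rw [phi_gen, phi_gen, YHat.mem_filt_one]
      change YHat.coeff D 0 _ = 0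
      simp [phiGen, phiSeq, YHat.coeff_mk]
    induction s using Int.induction_on with
    | zero => exact hnat (.x ε i 0)
    | succ n _ => exact hnat (.x ε i (n + 1))
    | pred n ih =>
      have e : (-(n : ℤ) - 1) + 1 = -n := by ring
      have key : ∀ k : DY D →ₐ[ℂ⟦X⟧] YHat D,
          k (DY.gen D (.x ε i (-(n : ℤ)))) - k (DY.gen D (.x ε i (-(n : ℤ) - 1))) =
            raise (D.weight ε i) (YHat.hbar D) (k (DY.gen D (.h i 1)) - k (DY.gen D (.h i 0)))
              (k (DY.gen D (.h i 0))) (k (DY.gen D (.x ε i (-(n : ℤ) - 1)))) := by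
        intro k
        have := (DY.gen_isSolution D).x_succ_sub ε i (-(n : ℤ) - 1)
        rw [e] at this
        have := congrArg (k.restrictScalars ℂ) this
        rw [map_raise] at this
        simp only [AlgHom.restrictScalars_apply, map_sub, algHom_hbar] at this
        exact this
      -- both candidates satisfy `k(x_{-n}) - u = S u` with the same `S` and the same `k(x_{-n})`
      have kf := key f
      have kp := key (phi D)
      rw [h1, h0, ih] at kf
      refine YHat.eq_of_forall_sub_mem D fun N => ?_
      induction N with
      | zero => rw [(hatFilt D).zero_eq_top]; trivial
      | succ N ihN =>
        have := (hatFilt D).raise_mem (D.weight ε i) (YHat.hbar_mem_filt D) hmem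
          (phi D (DY.gen D (.h i 0))) ihN
        rw [map_sub, ← kf, ← kp, sub_sub_sub_cancel_left] at this
        rw [← neg_sub]
        exact neg_mem this
  refine phi_unique_of_gen D fun x => ?_
  cases x with
  | cartan y => exact hnat (.cartan y)
  | x ε i s => exact hx ε i s
  | h i s =>
    rw [(DY.gen_isSolution D).h_eq_lie_left]
    simp only [Ring.lie_def, map_sub, map_mul, hx]

end

/-! ### Generators of the evaluation ideal -/

section
attribute [local instance] LieRing.ofAssociativeRing

theorem lieHom_ad_pow {L R : Type*} [LieRing L] [LieAlgebra ℂ L] [Ring R] [Algebra ℂ R]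
    (f : L →ₗ⁅ℂ⁆ R) (y z : L) (m : ℕ) : f ((LieAlgebra.ad ℂ L y ^ m) z) =
      ((LinearMap.mulLeft ℂ (f y) - LinearMap.mulRight ℂ (f y)) ^ m) (f z) := by
  induction m with
  | zero => simp
  | succ m ih =>
    rw [pow_succ', pow_succ', Module.End.mul_apply, Module.End.mul_apply, ← ih, LieAlgebra.ad_apply,
      LieHom.map_lie, Ring.lie_def]
    rfl

variable (D : KacMoodyDatum I 𝔥) {R : Type*} [Ring R] [Algebra ℂ R]

/-- Elements of `R` corresponding to the Chevalley generators under a solution with `ħ = 0`. -/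
def chevalleyGen {K : Type*} [Zero K] (g : Gen I 𝔥 K → R) : KMGen I 𝔥 → R
  | .cartan h => g (.cartan h)
  | .e i => (Real.sqrt (D.d i) : ℂ)⁻¹ • g (.x 1 i 0)
  | .f i => (Real.sqrt (D.d i) : ℂ)⁻¹ • g (.x (-1) i 0)

/-- With all modes zero, the symmetrized Serre relation is `m!` times the usual one. -/
theorem IsSolution.serre_pow {D : KacMoodyDatum I 𝔥} {K : Type*} [AddMonoidWithOne K] {ħ : R}
    {g : Gen I 𝔥 K → R} (hg : IsSolution D ħ g) (ε : ℤˣ) {i j : I} (hij : i ≠ j) :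
    ((LinearMap.mulLeft ℂ (g (.x ε i 0)) - LinearMap.mulRight ℂ (g (.x ε i 0))) ^ D.serreDeg i j)
      (g (.x ε j 0)) = 0 := by
  have := hg _ _ (.serre ε i j hij (fun _ => 0) 0)
  simp only [foldr_bracket_eq, List.ofFn_const, List.map_replicate, List.prod_replicate,
    Finset.sum_const] at this
  rw [← Nat.cast_smul_eq_nsmul ℂ] at this
  refine (smul_eq_zero.mp this).resolve_left ?_
  simp [Fintype.card_perm, Nat.factorial_ne_zero]

/-- A solution with `ħ = 0` satisfies the Chevalley-Serre relations after rescaling. -/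
theorem lift_chevalleyGen_eq_zero {K : Type*} [AddMonoidWithOne K] {g : Gen I 𝔥 K → R}
    (hg : IsSolution D 0 g) {y : FreeLieAlgebra ℂ (KMGen I 𝔥)} (h : KMRel D y) :
    FreeLieAlgebra.lift ℂ (chevalleyGen D g) y = 0 := by
  have hd : ∀ i, (Real.sqrt (D.d i) : ℂ) ≠ 0 := fun i => by
    rw [Ne, Complex.ofReal_eq_zero, Real.sqrt_eq_zero (Nat.cast_nonneg _), Nat.cast_eq_zero]
    exact (D.d_pos i).ne'
  have hd' : ∀ i, (Real.sqrt (D.d i) : ℂ) * (Real.sqrt (D.d i) : ℂ) = D.d i := fun i => by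
    rw [← Complex.ofReal_mul, Real.mul_self_sqrt (Nat.cast_nonneg _)]
    simp
  have hcs : ∀ (c : ℂ) h, g (.cartan (c • h)) = c • g (.cartan h) := fun c h =>
    hg _ _ (.cartan_smul c h)
  set L := FreeLieAlgebra.lift ℂ (chevalleyGen D g) with hL
  have hof : ∀ x, L (FreeLieAlgebra.of ℂ x) = chevalleyGen D g x := fun x =>
    FreeLieAlgebra.lift_of_apply _ _
  have hserre : ∀ (ε : ℤˣ) (i j : I) (hij : i ≠ j) (c b : ℂ),
      ((LinearMap.mulLeft ℂ (c • g (.x ε i 0)) - LinearMap.mulRight ℂ (c • g (.x ε i 0))) ^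
        D.serreDeg i j) (b • g (.x ε j 0)) = 0 := by
    intro ε i j hij c b
    have e : LinearMap.mulLeft ℂ (c • g (.x ε i 0)) - LinearMap.mulRight ℂ (c • g (.x ε i 0)) =
        c • (LinearMap.mulLeft ℂ (g (.x ε i 0)) - LinearMap.mulRight ℂ (g (.x ε i 0))) := by
      ext u
      simp [smul_sub]
    rw [e, smul_pow, map_smul, LinearMap.smul_apply, hg.serre_pow ε hij, smul_zero, smul_zero]
  cases h with
  | cartan_add h h' =>
    rw [map_sub, map_add, hof, hof, hof, sub_eq_zero]
    exact hg _ _ (.cartan_add h h')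
  | cartan_smul c h =>
    rw [map_sub, map_smul, hof, hof, sub_eq_zero]
    exact hcs c h
  | cartan_cartan h h' =>
    rw [LieHom.map_lie, hof, hof]
    exact hg _ _ (.cartan_cartan h h')
  | cartan_e h i =>
    have := hg _ _ (.cartan_x 1 h i 0)
    rw [map_sub, LieHom.map_lie, map_smul, hof, hof, sub_eq_zero]
    simp only [chevalleyGen]
    rw [lie_smul, this, smul_comm]
    simp
  | cartan_f h i =>
    have := hg _ _ (.cartan_x (-1) h i 0)
    rw [map_add, LieHom.map_lie, map_smul, hof, hof, ← sub_neg_eq_add, sub_eq_zero]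
    simp only [chevalleyGen]
    rw [lie_smul, this, smul_comm, ← neg_smul]
    simp
  | e_f_same i =>
    have := hg _ _ (.x_x_same i 0 0)
    rw [map_sub, LieHom.map_lie, hof, hof, hof, sub_eq_zero]
    simp only [chevalleyGen]
    rw [lie_smul, smul_lie, this, add_zero, hg _ _ (.h_zero i), hcs, smul_smul, smul_smul, ← hd' i]
    have := hd i
    field_simp
    simp
  | e_f_ne i j hij =>
    rw [LieHom.map_lie, hof, hof]
    simp only [chevalleyGen]
    rw [lie_smul, smul_lie, hg _ _ (.x_x_ne i j hij 0 0), smul_zero, smul_zero]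
  | serre_e i j hij =>
    rw [lieHom_ad_pow, hof, hof]
    exact hserre 1 i j hij _ _
  | serre_f i j hij =>
    rw [lieHom_ad_pow, hof, hof]
    exact hserre (-1) i j hij _ _

/-- The homomorphism from the Kac-Moody algebra given by a solution with `ħ = 0`. -/
def kmLift {K : Type*} [AddMonoidWithOne K] (g : Gen I 𝔥 K → R) (hg : IsSolution D 0 g) :
    KacMoody D →ₗ⁅ℂ⁆ R :=
  { (kmIdeal D).toSubmodule.liftQ
      (FreeLieAlgebra.lift ℂ (chevalleyGen D g) : FreeLieAlgebra ℂ (KMGen I 𝔥) →ₗ[ℂ] R) (by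
        have : kmIdeal D ≤ (FreeLieAlgebra.lift ℂ (chevalleyGen D g)).ker :=
          LieSubmodule.lieSpan_le.mpr fun y hy =>
            LieHom.mem_ker.mpr (lift_chevalleyGen_eq_zero D hg hy)
        intro y hy
        exact LieHom.mem_ker.mp (this hy)) with
    map_lie' := by
      intro y z
      obtain ⟨y, rfl⟩ := LieSubmodule.Quotient.surjective_mk' _ y
      obtain ⟨z, rfl⟩ := LieSubmodule.Quotient.surjective_mk' _ z
      exact LieHom.map_lie (FreeLieAlgebra.lift ℂ (chevalleyGen D g)) y z }

/-- The homomorphism from the enveloping algebra given by a solution with `ħ = 0`. -/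
def uLift {K : Type*} [AddMonoidWithOne K] (g : Gen I 𝔥 K → R) (hg : IsSolution D 0 g) :
    UKacMoody D →ₐ[ℂ] R :=
  UniversalEnvelopingAlgebra.lift ℂ (kmLift D g hg)

theorem uLift_toU {K : Type*} [AddMonoidWithOne K] (g : Gen I 𝔥 K → R) (hg : IsSolution D 0 g)
    (x : KMGen I 𝔥) : uLift D g hg (toU D (FreeLieAlgebra.of ℂ x)) = chevalleyGen D g x := by
  rw [uLift, toU]
  refine (UniversalEnvelopingAlgebra.lift_ι_apply ℂ (kmLift D g hg) _).trans ?_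
  exact FreeLieAlgebra.lift_of_apply _ _

/-- The homomorphism from the enveloping algebra recovers the solution, if the solution does not
depend on the modes. -/
theorem uLift_evGen {K : Type*} [AddMonoidWithOne K] (g : Gen I 𝔥 K → R) (hg : IsSolution D 0 g)
    (hx : ∀ ε i r, g (.x ε i r) = g (.x ε i 0)) (hh : ∀ i r, g (.h i r) = g (.h i 0))
    (x : Gen I 𝔥 K) : uLift D g hg (evGen D x) = g x := by
  have hd : ∀ i, (Real.sqrt (D.d i) : ℂ) ≠ 0 := fun i => by
    rw [Ne, Complex.ofReal_eq_zero, Real.sqrt_eq_zero (Nat.cast_nonneg _), Nat.cast_eq_zero]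
    exact (D.d_pos i).ne'
  cases x with
  | cartan h => exact uLift_toU D g hg _
  | x ε i r =>
    rw [hx]
    rcases Int.units_eq_one_or ε with rfl | rfl
    · simp only [evGen, if_true]
      rw [map_smul, uLift_toU]
      exact smul_inv_smul₀ (hd i) _
    · simp only [evGen, if_neg (show (-1 : ℤˣ) ≠ 1 by decide)]
      rw [map_smul, uLift_toU]
      exact smul_inv_smul₀ (hd i) _
  | h i r =>
    rw [hh, hg _ _ (.h_zero i), hg _ _ (.cartan_smul _ _)]
    simp only [evGen]
    rw [map_smul, uLift_toU]
    rfl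

end

section
variable (D : KacMoodyDatum I 𝔥)

/-- Generators of the evaluation ideal: `ħ` and the differences of modes. -/
inductive EvIdealGen : DY D → Prop
  | hbar : EvIdealGen (DY.hbar D)
  | x (ε : ℤˣ) (i : I) (r : ℤ) : EvIdealGen (DY.gen D (.x ε i r) - DY.gen D (.x ε i 0))
  | h (i : I) (r : ℤ) : EvIdealGen (DY.gen D (.h i r) - DY.gen D (.h i 0))

theorem mem_evIdeal {y : DY D} : y ∈ evIdeal D ↔ ev D y = 0 := RingHom.mem_ker

theorem EvIdealGen.mem_evIdeal {y : DY D} (h : EvIdealGen D y) : y ∈ evIdeal D := by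
  rw [YangianDouble.mem_evIdeal]
  cases h with
  | hbar => exact ev_hbar D
  | x ε i r => rw [map_sub, ev_gen, ev_gen, sub_eq_zero]; rfl
  | h i r => rw [map_sub, ev_gen, ev_gen, sub_eq_zero]; rfl

/-- The evaluation ideal is generated by `ħ` and the differences of modes: modulo these, the double
satisfies the Chevalley-Serre presentation. -/
theorem mem_span_of_mem_evIdeal {y : DY D} (hy : y ∈ evIdeal D) :
    y ∈ TwoSidedIdeal.span {y | EvIdealGen D y} := by
  let J : Ideal (DY D) := (TwoSidedIdeal.span {y | EvIdealGen D y}).asIdeal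
  let π : DY D →ₐ[ℂ] DY D ⧸ J := Ideal.Quotient.mkₐ ℂ J
  have hπ : ∀ {y}, EvIdealGen D y → π y = 0 := fun h =>
    Ideal.Quotient.eq_zero_iff_mem.mpr (TwoSidedIdeal.mem_asIdeal.mpr (TwoSidedIdeal.subset_span h))
  have hsol : IsSolution D 0 (π ∘ DY.gen D) := by
    intro a b h
    obtain ⟨a', b', h', rfl, rfl⟩ := h.exists_preimage π (g := DY.gen D) (ħ := DY.hbar D)
      (hπ .hbar) (fun x => rfl)
    rw [DY.gen_isSolution D _ _ h']
  let ψ : UKacMoody D →ₐ[ℂ] DY D ⧸ J := uLift D (π ∘ DY.gen D) hsol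
  have hx : ∀ ε i r, (π ∘ DY.gen D) (.x ε i r) = (π ∘ DY.gen D) (.x ε i 0) := fun ε i r => by
    rw [← sub_eq_zero, Function.comp_apply, Function.comp_apply, ← map_sub]
    exact hπ (.x ε i r)
  have hh : ∀ i r, (π ∘ DY.gen D) (.h i r) = (π ∘ DY.gen D) (.h i 0) := fun i r => by
    rw [← sub_eq_zero, Function.comp_apply, Function.comp_apply, ← map_sub]
    exact hπ (.h i r)
  have hψ : ψ (ev D y) = π y := by
    obtain ⟨z, hz, w, rfl⟩ := DY.exists_eq_add_hbar_mul D
      (AlgHom.equalizer (ψ.comp (ev D)) π) (fun x => by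
        change ψ (ev D _) = _
        rw [ev_gen]
        exact uLift_evGen D _ hsol hx hh x) y
    have hz' : ψ (ev D z) = π z := hz
    rw [map_add, map_add, map_add, hz', map_mul, ev_hbar, zero_mul, map_zero, map_mul, hπ .hbar,
      zero_mul]
  rw [(mem_evIdeal D).mp hy, map_zero, eq_comm] at hψ
  exact TwoSidedIdeal.mem_asIdeal.mp (Ideal.Quotient.eq_zero_iff_mem.mp hψ)

theorem phi_isFiltered :
    FilteredAlg.IsFiltered (evFilt D) (hatFilt D) ((phi D).restrictScalars ℂ[X]) := by
  refine fun n => FilteredAlg.map_pow_mem (hatFilt D) (phi D : DY D →+* YHat D) _ ?_ n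
  intro y hy
  rw [YHat.mem_filt_one]
  have h : TwoSidedIdeal.span {y | EvIdealGen D y} ≤
      TwoSidedIdeal.ker ((YHat.coeffZero D : YHat D →+* Yangian D).comp
        (phi D : DY D →+* YHat D)) := by
    rw [TwoSidedIdeal.span_le]
    intro y hy
    refine (TwoSidedIdeal.mem_ker _).mpr ?_
    change YHat.coeff D 0 (phi D y) = 0
    cases hy with
    | hbar => rw [algHom_hbar]; exact YHat.hbar_mem_filt D 0 one_pos
    | x ε i r => rw [map_sub, phi_gen, phi_gen]; simp [phiGen, phiSeq, YHat.coeff_mk]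
    | h i r => rw [map_sub, phi_gen, phi_gen]; simp [phiGen, phiSeq, YHat.coeff_mk]
  have h' := (TwoSidedIdeal.mem_ker _).mp (h (mem_span_of_mem_evIdeal D hy))
  exact h'

/-! ### The associated graded map of `Γ` -/

theorem Gamma_gen (x : Gen I 𝔥 ℕ) :
    Gamma D (Yangian.gen D x) = shiftGen (-1) (DY.gen D ∘ Gen.ofNat) x := by
  have hs : ∀ (y : ℕ → Yangian D) (r : ℕ),
      iota D (shiftSeq (-1) y r) = shiftSeq (-1) (fun k => iota D (y k)) r := by
    intro y r
    rw [shiftSeq, map_sum]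
    exact Finset.sum_congr rfl fun k _ => map_smul ((iota D).restrictScalars ℂ) _ _
  rw [Gamma, AlgHom.comp_apply, tau_gen]
  cases x with
  | cartan y => exact iota_gen D _
  | x ε i r => simp only [shiftGen, hs, iota_gen]; rfl
  | h i r => simp only [shiftGen, hs, iota_gen]; rfl

theorem Gamma_x_zero (ε : ℤˣ) (i : I) :
    Gamma D (Yangian.gen D (.x ε i 0)) = DY.gen D (.x ε i 0) := by
  rw [Gamma_gen]
  simp [shiftGen, shiftSeq_zero, Gen.ofNat]

theorem Gamma_h_zero (i : I) : Gamma D (Yangian.gen D (.h i 0)) = DY.gen D (.h i 0) := by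
  rw [Gamma_gen]
  simp [shiftGen, shiftSeq_zero, Gen.ofNat]

theorem Gamma_x_one (ε : ℤˣ) (i : I) :
    Gamma D (Yangian.gen D (.x ε i 1)) = DY.gen D (.x ε i 1) - DY.gen D (.x ε i 0) := by
  rw [Gamma_gen]
  simp [shiftGen, shiftSeq, Gen.ofNat, Finset.sum_range_succ]
  abel

theorem Gamma_h_one (i : I) :
    Gamma D (Yangian.gen D (.h i 1)) = DY.gen D (.h i 1) - DY.gen D (.h i 0) := by
  rw [Gamma_gen]
  simp [shiftGen, shiftSeq, Gen.ofNat, Finset.sum_range_succ]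
  abel

theorem Gamma_hbar : Gamma D (Yangian.hbar D) = DY.hbar D := by
  rw [← DY.algebraMap_X]
  exact (Gamma D).commutes _

theorem mem_evFilt_one {y : DY D} : y ∈ (evFilt D).F 1 ↔ y ∈ evIdeal D := by
  change y ∈ evIdeal D ^ 1 ↔ _
  rw [Submodule.pow_one]

theorem Gamma_mem_of_grade {k : ℕ} {y : Yangian D} (hy : y ∈ Yangian.grade D k) :
    Gamma D y ∈ (evFilt D).F k :=
  Yangian.map_mem_filt_of_grade D _ _ (fun i => by
    rw [Gamma_h_one, mem_evFilt_one]
    exact (EvIdealGen.h i 1).mem_evIdeal) hy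

theorem Gamma_isFiltered : FilteredAlg.IsFiltered (yFilt D) (evFilt D) (Gamma D) := by
  intro n y hy
  obtain ⟨N, hN⟩ := Yangian.eq_sum_coeff D y
  rw [hN N le_rfl, map_sum]
  refine Submodule.sum_mem _ fun k _ => ?_
  rcases lt_or_ge k n with hk | hk
  · rw [(Yangian.mem_filt_iff D).mp hy k hk, map_zero]; exact zero_mem _
  · exact (evFilt D).le_of_le hk (Gamma_mem_of_grade D (YHat.coeff_mem D k _))

/-- The elements that are congruent modulo `𝒥 ^ (n + 1)` to the image under `Γ` of an element of
degree `n`. -/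
def gammaSpan (n : ℕ) : Submodule ℂ (DY D) :=
  (Yangian.grade D n).map ((Gamma D).restrictScalars ℂ).toLinearMap ⊔ (evFilt D).F (n + 1)

theorem mem_gammaSpan {n : ℕ} {y : DY D} :
    y ∈ gammaSpan D n ↔ ∃ z ∈ Yangian.grade D n, y - Gamma D z ∈ (evFilt D).F (n + 1) := by
  rw [gammaSpan, Submodule.mem_sup]
  constructor
  · rintro ⟨_, ⟨z, hz, rfl⟩, w, hw, rfl⟩
    refine ⟨z, hz, ?_⟩
    change Gamma D z + w - Gamma D z ∈ _
    rwa [add_sub_cancel_left]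
  · rintro ⟨z, hz, h⟩
    exact ⟨Gamma D z, ⟨z, hz, rfl⟩, _, h, by abel⟩

theorem mul_mem_gammaSpan {m n : ℕ} {y z : DY D} (hy : y ∈ gammaSpan D m) (hz : z ∈ gammaSpan D n) :
    y * z ∈ gammaSpan D (m + n) := by
  rw [mem_gammaSpan] at *
  obtain ⟨u, hu, hyu⟩ := hy
  obtain ⟨w, hw, hzw⟩ := hz
  refine ⟨u * w, SetLike.mul_mem_graded hu hw, ?_⟩
  have hz : z ∈ (evFilt D).F n := by
    have := add_mem ((evFilt D).succ_le n hzw) (Gamma_mem_of_grade D hw)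
    rwa [sub_add_cancel] at this
  have h1 := (evFilt D).mul_mem hyu hz
  have h2 := (evFilt D).mul_mem (Gamma_mem_of_grade D hu) hzw
  rw [show m + 1 + n = m + n + 1 by ring] at h1
  have := add_mem h1 h2
  rw [map_mul]
  convert this using 1
  noncomm_ring

theorem hbar_mem_gammaSpan : DY.hbar D ∈ gammaSpan D 1 := by
  rw [mem_gammaSpan]
  refine ⟨_, Yangian.hbar_mem D, ?_⟩
  rw [Gamma_hbar, sub_self]
  exact zero_mem _

/-- Modulo `𝒥` the double is generated by the elements of mode zero, which are images under `Γ`. -/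
theorem gammaSpan_zero : gammaSpan D 0 = ⊤ := by
  have hmem : ∀ {y : Yangian D} {z : DY D}, y ∈ Yangian.grade D 0 → z - Gamma D y ∈ evIdeal D →
      z ∈ gammaSpan D 0 := fun {y z} hy hz =>
    (mem_gammaSpan D).mpr ⟨y, hy, (mem_evFilt_one D).mpr hz⟩
  have hgen : ∀ x, DY.gen D x ∈ gammaSpan D 0 := by
    intro x
    cases x with
    | cartan h =>
      refine hmem (Yangian.gen_mem D (.cartan h)) ?_
      have : Gamma D (Yangian.gen D (.cartan h)) = DY.gen D (.cartan h) := Gamma_gen D _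
      rw [this, sub_self]
      exact zero_mem _
    | x ε i r =>
      refine hmem (Yangian.gen_mem D (.x ε i 0)) ?_
      rw [Gamma_x_zero]
      exact (EvIdealGen.x ε i r).mem_evIdeal
    | h i r =>
      refine hmem (Yangian.gen_mem D (.h i 0)) ?_
      rw [Gamma_h_zero]
      exact (EvIdealGen.h i r).mem_evIdeal
  have hone : (1 : DY D) ∈ gammaSpan D 0 := by
    refine hmem (y := 1) SetLike.GradedOne.one_mem ?_
    rw [map_one, sub_self]
    exact zero_mem _
  let S : Subalgebra ℂ (DY D) := (gammaSpan D 0).toSubalgebra hone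
    fun _ _ ha hb => mul_mem_gammaSpan D (m := 0) (n := 0) ha hb
  refine eq_top_iff.mpr fun y _ => ?_
  obtain ⟨z, hz, w, rfl⟩ := DY.exists_eq_add_hbar_mul D S hgen y
  have hz' : z ∈ gammaSpan D 0 := hz
  refine add_mem hz' (hmem (y := 0) (zero_mem _) ?_)
  rw [map_zero, sub_zero]
  exact Ideal.mul_mem_right _ _ EvIdealGen.hbar.mem_evIdeal

/-- Elements `y_r` whose second differences lie in `𝒥 ^ 2` and for which `y_1 - y_0` is in the span of
`Γ` have all their differences in this span. -/
theorem sub_mem_gammaSpan (y : ℤ → DY D) (h1 : y 1 - y 0 ∈ gammaSpan D 1)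
    (h2 : ∀ r, (y (r + 1 + 1) - y (r + 1)) - (y (r + 1) - y r) ∈ (evFilt D).F 2) (r : ℤ) :
    y r - y 0 ∈ gammaSpan D 1 := by
  have hF : (evFilt D).F 2 ≤ gammaSpan D 1 := le_sup_right
  have hδ : ∀ r : ℤ, y (r + 1) - y r ∈ gammaSpan D 1 := by
    intro r
    induction r using Int.induction_on with
    | zero => simpa using h1
    | succ n ih =>
      have := add_mem (hF (h2 n)) ih
      rwa [sub_add_cancel] at this
    | pred n ih =>
      have h := h2 (-(n : ℤ) - 1)
      rw [sub_add_cancel] at h ⊢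
      have := sub_mem ih (hF h)
      rwa [sub_sub_cancel] at this
  induction r using Int.induction_on with
  | zero => rw [sub_self]; exact zero_mem _
  | succ n ih =>
    have := add_mem (hδ n) ih
    rwa [sub_add_sub_cancel] at this
  | pred n ih =>
    have h := hδ (-(n : ℤ) - 1)
    rw [sub_add_cancel] at h
    have := sub_mem ih h
    rwa [sub_sub_sub_cancel_left] at this

/-- The second differences of the `x_{ir}^±` lie in `𝒥 ^ 2`. -/
theorem x_second_difference_mem (ε : ℤˣ) (i : I) (r : ℤ) :
    (DY.gen D (.x ε i (r + 1 + 1)) - DY.gen D (.x ε i (r + 1))) -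
      (DY.gen D (.x ε i (r + 1)) - DY.gen D (.x ε i r)) ∈ (evFilt D).F 2 := by
  have hħ : DY.hbar D ∈ (evFilt D).F 1 := (mem_evFilt_one D).mpr EvIdealGen.hbar.mem_evIdeal
  have hh : DY.gen D (.h i 1) - DY.gen D (.h i 0) ∈ (evFilt D).F 1 :=
    (mem_evFilt_one D).mpr (EvIdealGen.h i 1).mem_evIdeal
  have h := (DY.gen_isSolution D).x_succ_sub ε i
  rw [h (r + 1), h r, ← map_sub, h r]
  refine (evFilt D).raise_mem _ hħ hh _ ((evFilt D).raise_mem (n := 0) _ hħ hh _ ?_)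
  rw [(evFilt D).zero_eq_top]
  trivial

/-- The second differences of the `h_{ir}` lie in `𝒥 ^ 2`. -/
theorem h_second_difference_mem (i : I) (r : ℤ) :
    (DY.gen D (.h i (r + 1 + 1)) - DY.gen D (.h i (r + 1))) -
      (DY.gen D (.h i (r + 1)) - DY.gen D (.h i r)) ∈ (evFilt D).F 2 := by
  simp only [(DY.gen_isSolution D).h_eq_lie_left i]
  have h := x_second_difference_mem D 1 i r
  have h0 : DY.gen D (.x (-1) i 0) ∈ (evFilt D).F 0 := by rw [(evFilt D).zero_eq_top]; trivial
  have h1 := (evFilt D).mul_mem h h0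
  have h2 := (evFilt D).mul_mem h0 h
  rw [zero_add] at h2
  convert sub_mem h1 h2 using 1
  simp only [Ring.lie_def]
  noncomm_ring

theorem evIdeal_le_gammaSpan {y : DY D} (hy : y ∈ evIdeal D) : y ∈ gammaSpan D 1 := by
  have h0 : ∀ a : DY D, a ∈ gammaSpan D 0 := fun a => by rw [gammaSpan_zero]; trivial
  have hΓ : ∀ x : Gen I 𝔥 ℕ, x.deg = 1 → Gamma D (Yangian.gen D x) ∈ gammaSpan D 1 := by
    intro x hx
    refine (mem_gammaSpan D).mpr ⟨_, hx ▸ Yangian.gen_mem D x, ?_⟩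
    rw [sub_self]
    exact zero_mem _
  have hy' := mem_span_of_mem_evIdeal D hy
  clear hy
  induction hy' using TwoSidedIdeal.span_induction with
  | mem y h =>
    cases h with
    | hbar => exact hbar_mem_gammaSpan D
    | x ε i r =>
      refine sub_mem_gammaSpan D (fun r => DY.gen D (.x ε i r)) ?_ (x_second_difference_mem D ε i) r
      rw [← Gamma_x_one]
      exact hΓ (.x ε i 1) rfl
    | h i r =>
      refine sub_mem_gammaSpan D (fun r => DY.gen D (.h i r)) ?_ (h_second_difference_mem D i) r
      rw [← Gamma_h_one]
      exact hΓ (.h i 1) rfl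
  | zero => exact zero_mem _
  | add _ _ _ _ ha hb => exact add_mem ha hb
  | neg _ _ ha => exact neg_mem ha
  | left_absorb a y _ h => exact mul_mem_gammaSpan D (m := 0) (n := 1) (h0 a) h
  | right_absorb a y _ h => exact mul_mem_gammaSpan D (m := 1) (n := 0) h (h0 a)

/-- Each element of `𝒥 ^ n` is congruent modulo `𝒥 ^ (n + 1)` to the image under `Γ` of an element of
degree `n`. -/
theorem evFilt_le_gammaSpan (n : ℕ) : (evFilt D).F n ≤ gammaSpan D n := by
  induction n with
  | zero => rw [gammaSpan_zero]; exact le_top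
  | succ n ih =>
    intro y hy
    change y ∈ evIdeal D ^ (n + 1) at hy
    rw [Submodule.pow_succ] at hy
    refine Submodule.mul_induction_on hy (fun a ha b hb => ?_) fun a b ha hb => add_mem ha hb
    exact mul_mem_gammaSpan D (ih ha) (evIdeal_le_gammaSpan D hb)

theorem polyEval_comp {R : Type*} [Ring R] [Algebra ℂ R] (y : ℕ → R) (p q : ℂ[X]) :
    polyEval (fun k => polyEval y (q ^ k)) p = polyEval y (p.comp q) := by
  induction p using Polynomial.induction_on' with
  | add p₁ p₂ h₁ h₂ => rw [map_add, Polynomial.add_comp, map_add, h₁, h₂]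
  | monomial n c =>
    rw [polyEval_monomial, Polynomial.monomial_comp, ← Polynomial.smul_eq_C_mul, map_smul]

theorem shiftSeq_neg_shiftSeq {R : Type*} [Ring R] [Algebra ℂ R] (c : ℂ) (y : ℕ → R) (r : ℕ) :
    shiftSeq (-c) (shiftSeq c y) r = y r := by
  have : shiftSeq c y = fun k => polyEval y ((Polynomial.X + Polynomial.C c) ^ k) :=
    funext (shiftSeq_eq c y)
  rw [this, shiftSeq_eq, polyEval_comp]
  simp [polyEval_X_pow]

theorem tau_one_tau_neg_one (y : Yangian D) : tau D 1 (tau D (-1) y) = y := by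
  have hs : ∀ (y : ℕ → Yangian D) (r : ℕ),
      tau D 1 (shiftSeq (-1) y r) = shiftSeq (-1) (fun k => tau D 1 (y k)) r := by
    intro y r
    rw [shiftSeq, map_sum]
    exact Finset.sum_congr rfl fun k _ => map_smul ((tau D 1).restrictScalars ℂ) _ _
  have : (tau D 1).comp (tau D (-1)) = AlgHom.id _ _ := by
    refine Yangian.algHom_ext D fun x => ?_
    rw [AlgHom.comp_apply, tau_gen]
    cases x with
    | cartan y => exact tau_gen D 1 _
    | x ε i r =>
      simp only [shiftGen, hs, tau_gen]
      exact shiftSeq_neg_shiftSeq 1 (fun k => Yangian.gen D (.x ε i k)) r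
    | h i r =>
      simp only [shiftGen, hs, tau_gen]
      exact shiftSeq_neg_shiftSeq 1 (fun k => Yangian.gen D (.h i k)) r
  exact DFunLike.congr_fun this y

theorem phi_Gamma (y : Yangian D) : phi D (Gamma D y) = toHat D y := by
  rw [Gamma, AlgHom.comp_apply, phi_iota, tau_one_tau_neg_one]

theorem grMap_Gamma_surjective :
    Function.Surjective (FilteredAlg.grMap (yFilt D) (evFilt D) (Gamma D) (Gamma_isFiltered D)) := by
  refine FilteredAlg.grMap_surjective _ _ _ _ fun n y hy => ?_
  obtain ⟨z, hz, h⟩ := (mem_gammaSpan D).mp (evFilt_le_gammaSpan D n hy)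
  exact ⟨z, Yangian.grade_le_filt D n hz, h⟩

theorem grMap_phi_grMap_Gamma (w : (yFilt D).Gr) :
    FilteredAlg.grMap (evFilt D) (hatFilt D) ((phi D).restrictScalars ℂ[X]) (phi_isFiltered D)
      (FilteredAlg.grMap (yFilt D) (evFilt D) (Gamma D) (Gamma_isFiltered D) w) =
    FilteredAlg.grMap (yFilt D) (hatFilt D) (toHat D) (toHat_isFiltered D) w :=
  FilteredAlg.grMap_comp _ _ _ (phi_Gamma D) w

theorem grMap_Gamma_bijective :
    Function.Bijective (FilteredAlg.grMap (yFilt D) (evFilt D) (Gamma D) (Gamma_isFiltered D)) := by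
  refine ⟨fun u w h => (grMap_toHat_bijective D).1 ?_, grMap_Gamma_surjective D⟩
  rw [← grMap_phi_grMap_Gamma, h, grMap_phi_grMap_Gamma]

end

/-! ### The extended Rees algebra -/

section
variable (D : KacMoodyDatum I 𝔥)

theorem mem_evFilt {n : ℕ} {x : DY D} : x ∈ (evFilt D).F n ↔ x ∈ evIdeal D ^ n := Iff.rfl

/-- The extended Rees algebra is spanned by its monomials. -/
theorem rees_le {S : AddSubmonoid (DY D)[T;T⁻¹]}
    (h : ∀ (n : ℤ) (x : DY D), x ∈ evIdeal D ^ (-n).toNat → AddMonoidAlgebra.single n x ∈ S)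
    {f : (DY D)[T;T⁻¹]} (hf : f ∈ rees D) : f ∈ S := by
  rw [← AddMonoidAlgebra.sum_coeff_single f]
  exact sum_mem fun n _ => h n _ (hf n)

/-- The monomial `v ^ (-m) x` with `x ∈ 𝒥 ^ m` is a sum of products of `m` elements of `v⁻¹ 𝒥`. -/
theorem rees_eq_adjoin : rees D = Algebra.adjoin ℂ
    ({LaurentPolynomial.T 1} ∪ Set.range LaurentPolynomial.C ∪
      {f | ∃ x ∈ evIdeal D, f = LaurentPolynomial.C x * LaurentPolynomial.T (-1)}) := by
  refine le_antisymm (fun f hf => ?_) (Algebra.adjoin_le ?_)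
  · let A : Subalgebra ℂ (DY D)[T;T⁻¹] := Algebra.adjoin ℂ
      ({LaurentPolynomial.T 1} ∪ Set.range LaurentPolynomial.C ∪
        {f | ∃ x ∈ evIdeal D, f = LaurentPolynomial.C x * LaurentPolynomial.T (-1)})
    have hC : ∀ x : DY D, LaurentPolynomial.C x ∈ A := fun x =>
      Algebra.subset_adjoin (Or.inl (Or.inr ⟨x, rfl⟩))
    have hT : (LaurentPolynomial.T 1 : (DY D)[T;T⁻¹]) ∈ A :=
      Algebra.subset_adjoin (Or.inl (Or.inl rfl))
    refine rees_le D (S := A.toSubsemiring.toAddSubmonoid) (fun n x hx => ?_) hf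
    change _ ∈ A
    rw [LaurentPolynomial.single_eq_C_mul_T]
    obtain ⟨m, rfl | rfl⟩ := n.eq_nat_or_neg
    · have hm : (LaurentPolynomial.T (m : ℤ) : (DY D)[T;T⁻¹]) = LaurentPolynomial.T 1 ^ m := by
        rw [LaurentPolynomial.T_pow, mul_one]
      rw [hm]
      exact mul_mem (hC x) (pow_mem hT m)
    · rw [neg_neg, Int.toNat_natCast] at hx
      induction m generalizing x with
      | zero => simpa using hC x
      | succ m ih =>
        rw [Submodule.pow_succ] at hx
        refine Submodule.mul_induction_on hx (fun a ha b hb => ?_) fun a b ha hb => ?_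
        · have : LaurentPolynomial.C (a * b) * LaurentPolynomial.T (-((m + 1 : ℕ) : ℤ)) =
              (LaurentPolynomial.C a * LaurentPolynomial.T (-(m : ℤ))) *
                (LaurentPolynomial.C b * LaurentPolynomial.T (-1)) := by
            rw [← LaurentPolynomial.single_eq_C_mul_T, ← LaurentPolynomial.single_eq_C_mul_T,
              ← LaurentPolynomial.single_eq_C_mul_T, AddMonoidAlgebra.single_mul_single]
            congr 1
            push_cast
            ring
          rw [this]
          exact mul_mem (ih a ha) (Algebra.subset_adjoin (Or.inr ⟨b, hb, rfl⟩))
        · rw [map_add, add_mul]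
          exact add_mem ha hb
  · rintro f ((rfl | ⟨x, rfl⟩) | ⟨x, hx, rfl⟩)
    · exact (Rees.v D).2
    · exact (single_mem_rees D (n := 0)).mpr (by
        rw [neg_zero, Int.toNat_zero, Submodule.pow_zero, Ideal.one_eq_top]
        trivial)
    · rw [← LaurentPolynomial.single_eq_C_mul_T]
      refine (single_mem_rees D).mpr ?_
      rw [neg_neg, show (1 : ℤ).toNat = 1 from rfl, Submodule.pow_one]
      exact hx

namespace Rees

theorem coeff_v_pow_mul (k : ℕ) (f : Rees D) (n : ℤ) :
    (v D ^ k * f).1.coeff n = f.1.coeff (n - k) := by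
  have : (v D ^ k * f).1 = AddMonoidAlgebra.single (k : ℤ) 1 * f.1 := by
    change (LaurentPolynomial.T 1 : (DY D)[T;T⁻¹]) ^ k * f.1 = _
    rw [LaurentPolynomial.T_pow, mul_one]
    rfl
  rw [this, AddMonoidAlgebra.coeff_single_mul_apply, one_mul, neg_add_eq_sub]

theorem coeff_aeval_mul (p : ℂ[X]) (f : Rees D) (n : ℤ) :
    (Polynomial.aeval (v D) p * f).1.coeff n = p.sum fun k c => c • f.1.coeff (n - k) := by
  induction p using Polynomial.induction_on' with
  | add p q hp hq =>
    rw [map_add, add_mul, Polynomial.sum_add_index _ _ _ (by simp) (by simp [add_smul]), ← hp, ← hq]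
    rfl
  | monomial k c =>
    rw [Polynomial.aeval_monomial, Polynomial.sum_monomial_index _ _ (by simp), mul_assoc,
      ← Algebra.smul_def]
    change c • (v D ^ k * f).1.coeff n = _
    rw [coeff_v_pow_mul]

/-- The extended Rees algebra is torsion free over `ℂ[v]`: top coefficients multiply. -/
theorem isTorsionFree : Module.IsTorsionFree ℂ[X] (Rees D) where
  isSMulRegular p hp := by
    refine isSMulRegular_iff_right_eq_zero_of_smul.mpr fun f hf => ?_
    by_contra hne
    have hp0 : p ≠ 0 := hp.ne_zero
    have hsupp : f.1.coeff.support.Nonempty := by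
      rw [Finsupp.support_nonempty_iff]
      intro h
      exact hne (Subtype.ext (AddMonoidAlgebra.ext h))
    set m := f.1.coeff.support.max' hsupp with hm
    have hmem : f.1.coeff m ≠ 0 := Finsupp.mem_support_iff.mp (Finset.max'_mem _ hsupp)
    have h := coeff_aeval_mul D p f (p.natDegree + m)
    have hz : Polynomial.aeval (v D) p * f = 0 := hf
    rw [hz, Polynomial.sum_def, Finset.sum_eq_single p.natDegree] at h
    · rw [add_sub_cancel_left] at h
      exact smul_ne_zero (Polynomial.leadingCoeff_ne_zero.mpr hp0) hmem h.symm
    · intro k hk hne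
      have hlt : k < p.natDegree := lt_of_le_of_ne (Polynomial.le_natDegree_of_mem_supp k hk) hne
      have : f.1.coeff (p.natDegree + m - k) = 0 := by
        by_contra hc
        have := Finset.le_max' _ _ (Finsupp.mem_support_iff.mpr hc)
        omega
      rw [this, smul_zero]
    · intro hk
      rw [Polynomial.notMem_support_iff.mp hk, zero_smul]

/-- The degree-zero embedding of the Yangian double in the extended Rees algebra. -/
def const : DY D →ₐ[ℂ] Rees D :=
  AlgHom.codRestrict (AddMonoidAlgebra.singleZeroAlgHom : DY D →ₐ[ℂ] (DY D)[T;T⁻¹]) (rees D) fun x =>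
    (single_mem_rees D (n := 0)).mpr (by
      rw [neg_zero, Int.toNat_zero, Submodule.pow_zero, Ideal.one_eq_top]
      trivial)

theorem mono_zero (x : DY D) (h : x ∈ evIdeal D ^ 0) : mono D 0 x h = const D x := by
  refine Subtype.ext ?_
  change LaurentPolynomial.C x * LaurentPolynomial.T (-((0 : ℕ) : ℤ)) = AddMonoidAlgebra.single 0 x
  rw [← LaurentPolynomial.single_eq_C_mul_T, Nat.cast_zero, neg_zero]

theorem coe_mono (n : ℕ) (x : DY D) (h : x ∈ evIdeal D ^ n) :
    (mono D n x h).1 = AddMonoidAlgebra.single (-(n : ℤ)) x :=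
  (LaurentPolynomial.single_eq_C_mul_T x (-(n : ℤ))).symm

theorem v_pow_mul_mono (k n : ℕ) (x : DY D) (h : x ∈ evIdeal D ^ (k + n)) :
    v D ^ k * mono D (k + n) x h = mono D n x (Ideal.pow_le_pow_right (Nat.le_add_left n k) h) := by
  refine Subtype.ext (AddMonoidAlgebra.ext (Finsupp.ext fun m => ?_))
  rw [coeff_v_pow_mul, coe_mono, coe_mono, AddMonoidAlgebra.coeff_single, AddMonoidAlgebra.coeff_single,
    Finsupp.single_apply, Finsupp.single_apply]
  push_cast
  congr 1
  exact propext ⟨fun h => by omega, fun h => by omega⟩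

/-- Additive predicates on the extended Rees algebra are checked on the elements `v ^ k x` and
`v ^ (-n) x` with `x ∈ 𝒥 ^ n`. -/
theorem induction {P : Rees D → Prop} (h0 : P 0) (hadd : ∀ f g, P f → P g → P (f + g))
    (hpos : ∀ (k : ℕ) (x : DY D), P (v D ^ k * const D x))
    (hneg : ∀ (n : ℕ) (x : DY D) (h : x ∈ evIdeal D ^ n), P (mono D n x h)) (f : Rees D) : P f := by
  let S : AddSubmonoid (DY D)[T;T⁻¹] :=
    { carrier := {f | ∃ h : f ∈ rees D, P ⟨f, h⟩}
      zero_mem' := ⟨zero_mem _, h0⟩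
      add_mem' := fun ⟨ha, ha'⟩ ⟨hb, hb'⟩ => ⟨add_mem ha hb, hadd _ _ ha' hb'⟩ }
  obtain ⟨_, h⟩ := rees_le D (S := S) (fun n x hx => by
    refine ⟨(single_mem_rees D).mpr hx, ?_⟩
    obtain ⟨m, rfl | rfl⟩ := n.eq_nat_or_neg
    · have e : v D ^ m * const D x =
          ⟨AddMonoidAlgebra.single (m : ℤ) x, (single_mem_rees D).mpr hx⟩ := by
        refine Subtype.ext ?_
        change (LaurentPolynomial.T 1 : (DY D)[T;T⁻¹]) ^ m * AddMonoidAlgebra.single 0 x =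
          AddMonoidAlgebra.single (m : ℤ) x
        rw [LaurentPolynomial.T_pow, mul_one]
        refine (AddMonoidAlgebra.single_mul_single _ _ _ _).trans ?_
        rw [add_zero, one_mul]
      exact e ▸ hpos m x
    · have hx' := hx
      rw [neg_neg, Int.toNat_natCast] at hx'
      convert hneg m x hx'
      exact (coe_mono D m x hx').symm) f.2
  exact h

/-! ### The fibres of the extended Rees algebra -/

theorem toFibre_eq_zero_iff {c : ℂ} {f : Rees D} :
    toFibre D c f = 0 ↔ ∃ g, g * (v D - algebraMap ℂ (Rees D) c) = f :=
  Ideal.Quotient.eq_zero_iff_mem.trans Ideal.mem_span_singleton'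

theorem toFibre_v (c : ℂ) : toFibre D c (v D) = algebraMap ℂ (Fibre D c) c := by
  rw [← sub_eq_zero, ← (toFibre D c).commutes, ← map_sub, toFibre_eq_zero_iff]
  exact ⟨1, one_mul _⟩

theorem toFibre_surjective (c : ℂ) : Function.Surjective (toFibre D c) :=
  Ideal.Quotient.mk_surjective

/-- Evaluation of Laurent polynomials at `v = c`, for a unit `c`. -/
def evalUnit (c : ℂˣ) : (DY D)[T;T⁻¹] →+* DY D :=
  AddMonoidAlgebra.liftNCRingHom (RingHom.id _)
    (((algebraMap ℂ (DY D) : ℂ →* DY D).comp (Units.coeHom ℂ)).comp (zpowersHom ℂˣ c))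
    fun x y => Algebra.commute_algebraMap_right ((zpowersHom ℂˣ c y : ℂˣ) : ℂ) x

theorem evalUnit_single (c : ℂˣ) (n : ℤ) (x : DY D) :
    evalUnit D c (AddMonoidAlgebra.single n x) = x * algebraMap ℂ (DY D) ((c ^ n : ℂˣ) : ℂ) :=
  (AddMonoidAlgebra.liftNCRingHom_single (RingHom.id (DY D))
    (((algebraMap ℂ (DY D) : ℂ →* DY D).comp (Units.coeHom ℂ)).comp (zpowersHom ℂˣ c)) _ n x).trans rfl

/-- For `c ≠ 0` the double is the fibre at `v = c`. Evaluation at `v = c` gives injectivity, and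
`v ^ (-n) x` is congruent to `c ^ (-n) x`. -/
theorem toFibre_const_bijective {c : ℂ} (hc : c ≠ 0) :
    Function.Bijective ((toFibre D c).comp (const D)) := by
  have hv : ∀ k : ℕ, toFibre D c (v D) ^ k = algebraMap ℂ _ (c ^ k) := fun k => by
    rw [toFibre_v, map_pow]
  constructor
  · refine (injective_iff_map_eq_zero _).mpr fun x hx => ?_
    obtain ⟨g, hg⟩ := (toFibre_eq_zero_iff D).mp hx
    have h := congrArg (fun f : Rees D => evalUnit D (Units.mk0 c hc) f.1) hg
    have e1 : evalUnit D (Units.mk0 c hc) (const D x).1 = x := by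
      refine (evalUnit_single D _ 0 x).trans ?_
      simp
    have e2 : evalUnit D (Units.mk0 c hc) (v D - algebraMap ℂ (Rees D) c).1 = 0 := by
      change evalUnit D (Units.mk0 c hc) (AddMonoidAlgebra.single 1 1 -
        AddMonoidAlgebra.single 0 (algebraMap ℂ (DY D) c)) = 0
      rw [map_sub, evalUnit_single, evalUnit_single]
      simp
    have e3 : evalUnit D (Units.mk0 c hc) (g * (v D - algebraMap ℂ (Rees D) c)).1 =
        evalUnit D (Units.mk0 c hc) g.1 *
          evalUnit D (Units.mk0 c hc) (v D - algebraMap ℂ (Rees D) c).1 := map_mul _ _ _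
    change evalUnit D _ (g * _).1 = evalUnit D _ (const D x).1 at h
    rw [e1, e3, e2, mul_zero] at h
    exact h.symm
  · intro u
    obtain ⟨f, rfl⟩ := toFibre_surjective D c u
    induction f using Rees.induction with
    | h0 => exact ⟨0, by rw [map_zero, map_zero]⟩
    | hadd f g hf hg =>
      obtain ⟨x, hx⟩ := hf
      obtain ⟨y, hy⟩ := hg
      exact ⟨x + y, by rw [map_add, map_add, hx, hy]⟩
    | hpos k x =>
      refine ⟨c ^ k • x, ?_⟩
      rw [map_smul, map_mul, map_pow, hv, ← Algebra.smul_def]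
      rfl
    | hneg n x h =>
      refine ⟨(c ^ n)⁻¹ • x, ?_⟩
      have h' := congrArg (toFibre D c) (v_pow_mul_mono D n 0 x h)
      rw [map_mul, map_pow, hv, ← Algebra.smul_def, mono_zero] at h'
      rw [map_smul, inv_smul_eq_iff₀ (pow_ne_zero n hc)]
      exact h'.symm

/-- The map `𝒥 ^ n → R`, sending `x` to `v ^ (-n) x`. -/
def monoLinear (n : ℕ) : (evFilt D).F n →ₗ[ℂ] Rees D where
  toFun x := mono D n x ((mem_evFilt D).mp x.2)
  map_add' x y := Subtype.ext (by
    rw [Subalgebra.coe_add, coe_mono, coe_mono, coe_mono, Submodule.coe_add,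
      AddMonoidAlgebra.single_add])
  map_smul' c x := Subtype.ext (by
    rw [RingHom.id_apply, Subalgebra.coe_smul, coe_mono, coe_mono, Submodule.coe_smul,
      AddMonoidAlgebra.smul_single])

/-- The map `𝒥 ^ n → R / v R`, sending `x` to the class of `v ^ (-n) x`. -/
def monoFibre (n : ℕ) : (evFilt D).F n →ₗ[ℂ] Fibre D 0 :=
  (toFibre D 0).toLinearMap.comp (monoLinear D n)

theorem monoFibre_apply (n : ℕ) (x : (evFilt D).F n) :
    monoFibre D n x = toFibre D 0 (mono D n x ((mem_evFilt D).mp x.2)) := rfl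

theorem toFibre_zero_v : toFibre D 0 (v D) = 0 := by rw [toFibre_v, map_zero]

theorem monoFibre_eq_zero (n : ℕ) (x : (evFilt D).F n) (h : (x : DY D) ∈ (evFilt D).F (n + 1)) :
    monoFibre D n x = 0 := by
  have h' : (x : DY D) ∈ evIdeal D ^ (1 + n) := by rw [add_comm]; exact h
  rw [monoFibre_apply, ← v_pow_mul_mono D 1 n x h', pow_one, map_mul, toFibre_zero_v, zero_mul]

/-- The map from the associated graded algebra to the fibre at `v = 0`, sending the class of
`x ∈ 𝒥 ^ n` to the class of `v ^ (-n) x`. -/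
def grToFibre : (evFilt D).Gr →ₐ[ℂ] Fibre D 0 :=
  DirectSum.toAlgebra ℂ (evFilt D).Piece
    (fun n => Submodule.liftQ _ (monoFibre D n) fun x hx => monoFibre_eq_zero D n x hx)
    (by
      change monoFibre D 0 ⟨1, (evFilt D).one_mem⟩ = 1
      refine (monoFibre_apply D 0 _).trans ?_
      refine (congrArg (toFibre D 0)
        (mono_zero D 1 ((mem_evFilt D).mp (evFilt D).one_mem))).trans ?_
      rw [map_one, map_one])
    (by
      intro i j a b
      obtain ⟨x, rfl⟩ := (evFilt D).cls_surjective _ a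
      obtain ⟨y, rfl⟩ := (evFilt D).cls_surjective _ b
      change monoFibre D (i + j) ⟨x * y, _⟩ = monoFibre D i x * monoFibre D j y
      rw [monoFibre_apply, monoFibre_apply, monoFibre_apply, ← map_mul]
      congr 1
      refine Subtype.ext ?_
      rw [Subalgebra.coe_mul, coe_mono, coe_mono, coe_mono, AddMonoidAlgebra.single_mul_single]
      congr 1
      push_cast
      ring)

theorem grToFibre_symb (n : ℕ) (x : (evFilt D).F n) :
    grToFibre D ((evFilt D).symb n x) = toFibre D 0 (mono D n x ((mem_evFilt D).mp x.2)) :=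
  (DirectSum.toModule_lof ℂ n ((evFilt D).cls n x)).trans (monoFibre_apply D n x)

theorem coeff_neg_mem (f : Rees D) (k : ℕ) : f.1.coeff (-(k : ℤ)) ∈ (evFilt D).F k := by
  have := f.2 (-(k : ℤ))
  rwa [neg_neg, Int.toNat_natCast] at this

/-- An element of the associated graded algebra lifts to an element of the extended Rees algebra whose
coefficients represent its components. -/
theorem exists_lift_gr (w : (evFilt D).Gr) : ∃ f : Rees D, toFibre D 0 f = grToFibre D w ∧
    ∀ k : ℕ, (evFilt D).cls k ⟨f.1.coeff (-(k : ℤ)), coeff_neg_mem D f k⟩ = w k := by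
  induction w using FilteredAlg.Gr.induction with
  | h0 =>
    refine ⟨0, by rw [map_zero, map_zero], fun k => ?_⟩
    exact map_zero ((evFilt D).cls k)
  | hs n x =>
    refine ⟨mono D n x ((mem_evFilt D).mp x.2), (grToFibre_symb D n x).symm, fun k => ?_⟩
    by_cases h : n = k
    · subst h
      rw [FilteredAlg.symb_apply _ _ _ _ rfl]
      congr 2
      rw [coe_mono, AddMonoidAlgebra.coeff_single, Finsupp.single_eq_same]
    · rw [FilteredAlg.symb_apply_ne _ _ _ _ h, FilteredAlg.cls_eq_zero]
      change (mono D n x ((mem_evFilt D).mp x.2)).1.coeff _ ∈ _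
      rw [coe_mono, AddMonoidAlgebra.coeff_single, Finsupp.single_apply, if_neg (by omega)]
      exact zero_mem _
  | hadd a b ha hb =>
    obtain ⟨f, hf, hf'⟩ := ha
    obtain ⟨g, hg, hg'⟩ := hb
    refine ⟨f + g, by rw [map_add, map_add, hf, hg], fun k => ?_⟩
    rw [DirectSum.add_apply, ← hf', ← hg', ← map_add]
    rfl

theorem grToFibre_bijective : Function.Bijective (grToFibre D) := by
  constructor
  · refine (injective_iff_map_eq_zero _).mpr fun w hw => DFinsupp.ext fun k => ?_
    obtain ⟨f, hf, hf'⟩ := exists_lift_gr D w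
    rw [hw, toFibre_eq_zero_iff, map_zero, sub_zero] at hf
    obtain ⟨g, hg⟩ := hf
    change w k = 0
    rw [← hf', FilteredAlg.cls_eq_zero]
    change f.1.coeff _ ∈ _
    have h := coeff_v_pow_mul D 1 g (-(k : ℤ))
    rw [pow_one, (v_commute D g).eq, hg] at h
    have h' := coeff_neg_mem D g (k + 1)
    rw [h, show (-(k : ℤ) - (1 : ℕ)) = -((k + 1 : ℕ) : ℤ) by push_cast; ring]
    exact h'
  · intro u
    obtain ⟨f, rfl⟩ := toFibre_surjective D 0 u
    induction f using Rees.induction with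
    | h0 => exact ⟨0, by rw [map_zero, map_zero]⟩
    | hadd f g hf hg =>
      obtain ⟨x, hx⟩ := hf
      obtain ⟨y, hy⟩ := hg
      exact ⟨x + y, by rw [map_add, map_add, hx, hy]⟩
    | hpos k x =>
      cases k with
      | zero =>
        have hx : x ∈ evIdeal D ^ 0 := by rw [Submodule.pow_zero, Ideal.one_eq_top]; trivial
        refine ⟨(evFilt D).symb 0 ⟨x, (mem_evFilt D).mpr hx⟩, ?_⟩
        rw [grToFibre_symb, pow_zero, one_mul, mono_zero]
      | succ k =>
        refine ⟨0, ?_⟩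
        rw [map_zero, map_mul, map_pow, toFibre_zero_v, zero_pow k.succ_ne_zero, zero_mul]
    | hneg n x h => exact ⟨(evFilt D).symb n ⟨x, (mem_evFilt D).mpr h⟩, grToFibre_symb D n _⟩

end Rees

end

/-! ### The degeneration of the double to the Yangian -/

instance {A : Type*} [Ring A] [Algebra ℂ A] [Algebra ℂ[X] A] (𝓕 : FilteredAlg A) :
    IsScalarTower ℂ ℂ[X] 𝓕.Gr :=
  IsScalarTower.of_algebraMap_eq fun c => (Polynomial.aeval_C 𝓕.grHbar c).symm

section
variable (D : KacMoodyDatum I 𝔥)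

/-- The canonical isomorphism of the Yangian with its associated graded algebra. -/
def grEquiv : Yangian D ≃ₐ[ℂ[X]] (yFilt D).Gr := AlgEquiv.ofBijective _ (symbHom_bijective D)

/-- The isomorphism `gr(Γ)` of the Yangian with the associated graded algebra of the double. -/
def grGammaEquiv : Yangian D ≃ₐ[ℂ[X]] (evFilt D).Gr :=
  (grEquiv D).trans (AlgEquiv.ofBijective _ (grMap_Gamma_bijective D))

theorem grGammaEquiv_apply (y : Yangian D) : grGammaEquiv D y =
    FilteredAlg.grMap (yFilt D) (evFilt D) (Gamma D) (Gamma_isFiltered D) (grEquiv D y) := rfl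

theorem grGammaEquiv_of_mem {n : ℕ} {y : Yangian D} (hy : y ∈ Yangian.grade D n) :
    grGammaEquiv D y = (evFilt D).symb n ⟨Gamma D y, Gamma_mem_of_grade D hy⟩ := by
  rw [grGammaEquiv_apply]
  have : grEquiv D y = _ := symbHom_of_mem D hy
  rw [this, FilteredAlg.grMap_symb]

theorem mem_grade_iff_grGammaEquiv_mem (n : ℕ) (y : Yangian D) :
    y ∈ Yangian.grade D n ↔ grGammaEquiv D y ∈ (evFilt D).homog n := by
  refine ⟨fun hy => ⟨_, (grGammaEquiv_of_mem D hy).symm⟩, fun ⟨x, hx⟩ => ?_⟩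
  obtain ⟨z, hz, h⟩ := (mem_gammaSpan D).mp (evFilt_le_gammaSpan D n x.2)
  have : grGammaEquiv D z = grGammaEquiv D y := by
    rw [← hx, grGammaEquiv_of_mem D hz]
    exact ((evFilt D).symb_eq h).symm
  exact (grGammaEquiv D).injective this ▸ hz

end

end YangianDouble

end

theorem corollary5p8 {I : Type*} [Fintype I] {𝔥 : Type*} [AddCommGroup 𝔥] [Module ℂ 𝔥]
    (D : KacMoodyDatum I 𝔥) :
    DirectSum.IsInternal (Yangian.grade D) ∧
    ∃ Φ : DY D →ₐ[ℂ⟦X⟧] YHat D,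
      -- `Φ` exists, with explicit values on generators, and is the unique extension of `τ_1` along `ι`.
      (∀ x, Φ (DY.gen D x) = phiGen D x) ∧
      (∀ Φ' : DY D →ₐ[ℂ⟦X⟧] YHat D,
        (∀ y, Φ' (iota D y) = toHat D (tau D 1 y)) ↔ Φ' = Φ) ∧
      -- `Γ`, `Φ` and the canonical map of the Yangian to its completion are filtered; `eY` and `eHat` are
      -- the canonical identifications of the Yangian, its associated graded and that of its completion;
      -- `G` is `gr(Γ)`.
      ∃ (hΓ : IsFiltered (yFilt D) (evFilt D) (Gamma D))
        (hΦ : IsFiltered (evFilt D) (hatFilt D) (Φ.restrictScalars ℂ[X]))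
        (hi : IsFiltered (yFilt D) (hatFilt D) (toHat D))
        (eY : Yangian D ≃ₐ[ℂ[X]] (yFilt D).Gr)
        (eHat : (yFilt D).Gr ≃ₐ[ℂ[X]] (hatFilt D).Gr)
        (G : Yangian D ≃ₐ[ℂ[X]] (evFilt D).Gr),
        (∀ n, ∀ y ∈ Yangian.grade D n, ∃ h : y ∈ (yFilt D).F n, eY y = (yFilt D).symb n ⟨y, h⟩) ∧
        (∀ u, eHat u = grMap (yFilt D) (hatFilt D) (toHat D) hi u) ∧
        (∀ y, G y = grMap (yFilt D) (evFilt D) (Gamma D) hΓ (eY y)) ∧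
        -- the inverse of `gr(Γ)` is `gr(Φ)`
        (∀ w, eHat (eY (G.symm w)) =
          grMap (evFilt D) (hatFilt D) (Φ.restrictScalars ℂ[X]) hΦ w) ∧
        -- `gr(Γ)` is graded
        (∀ n y, y ∈ Yangian.grade D n ↔ G y ∈ (evFilt D).homog n) ∧
        -- the extended Rees algebra is generated over `ℂ[v]` by the double and `v⁻¹ 𝒥`
        rees D = Algebra.adjoin ℂ
          ({LaurentPolynomial.T 1} ∪ Set.range LaurentPolynomial.C ∪
            {f | ∃ x ∈ evIdeal D, f = LaurentPolynomial.C x * LaurentPolynomial.T (-1)}) ∧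
        -- it is torsion free and flat over `ℂ[v]`
        Module.IsTorsionFree ℂ[X] (Rees D) ∧
        Module.Flat ℂ[X] (Rees D) ∧
        -- its fibre at each `v = c ≠ 0` is the Yangian double
        (∀ c : ℂ, c ≠ 0 → ∃ θ : Rees.Fibre D c ≃ₐ[ℂ] DY D,
          ∀ (x : DY D) (h : x ∈ evIdeal D ^ 0), θ (Rees.toFibre D c (Rees.mono D 0 x h)) = x) ∧
        -- its fibre at `v = 0` is the associated graded algebra, hence the Yangian through `gr(Φ)`
        ∃ (ψ : Rees.Fibre D 0 ≃ₐ[ℂ] (evFilt D).Gr) (ρ : Rees.Fibre D 0 ≃ₐ[ℂ] Yangian D),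
          (∀ (n : ℕ) (x : DY D) (h : x ∈ evIdeal D ^ n),
            ψ (Rees.toFibre D 0 (Rees.mono D n x h)) = (evFilt D).symb n ⟨x, h⟩) ∧
          (∀ w, ρ w = G.symm (ψ w)) ∧
          (∀ h : DY.hbar D ∈ evIdeal D ^ 1,
            ρ (Rees.toFibre D 0 (Rees.mono D 1 (DY.hbar D) h)) = Yangian.hbar D) := by
  refine ⟨Yangian.grade_isInternal D, phi D, phi_gen D,
    fun Φ' => ⟨phi_unique D Φ', fun h => h ▸ phi_iota D⟩, Gamma_isFiltered D, phi_isFiltered D,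
    toHat_isFiltered D, grEquiv D, AlgEquiv.ofBijective _ (grMap_toHat_bijective D), grGammaEquiv D,
    fun n y hy => ⟨Yangian.grade_le_filt D n hy, symbHom_of_mem D hy⟩, fun _ => rfl, fun _ => rfl,
    fun w => ?_, mem_grade_iff_grGammaEquiv_mem D, rees_eq_adjoin D, Rees.isTorsionFree D, ?_,
    fun c hc => ?_, (AlgEquiv.ofBijective _ (Rees.grToFibre_bijective D)).symm,
    (AlgEquiv.ofBijective _ (Rees.grToFibre_bijective D)).symm.trans
      ((grGammaEquiv D).restrictScalars ℂ).symm, fun n x h => ?_, fun _ => rfl, fun h => ?_⟩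
  · obtain ⟨y, rfl⟩ := (grGammaEquiv D).surjective w
    rw [AlgEquiv.symm_apply_apply, grGammaEquiv_apply, grMap_phi_grMap_Gamma]
    rfl
  -- a torsion free module over the principal ideal domain `ℂ[v]` is flat
  · have := Rees.isTorsionFree D
    infer_instance
  · refine ⟨(AlgEquiv.ofBijective _ (Rees.toFibre_const_bijective D hc)).symm, fun x h => ?_⟩
    rw [AlgEquiv.symm_apply_eq, Rees.mono_zero]
    rfl
  · rw [AlgEquiv.symm_apply_eq]
    exact (Rees.grToFibre_symb D n ⟨x, h⟩).symm
  · rw [AlgEquiv.trans_apply, AlgEquiv.symm_apply_eq]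
    change (AlgEquiv.ofBijective _ (Rees.grToFibre_bijective D)).symm _ =
      grGammaEquiv D (Yangian.hbar D)
    rw [AlgEquiv.symm_apply_eq, grGammaEquiv_of_mem D (Yangian.hbar_mem D)]
    refine (Rees.grToFibre_symb D 1 ⟨_, h⟩).symm.trans ?_
    exact congrArg _ ((evFilt D).symb_congr rfl (Gamma_hbar D).symm)
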